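/- **Setting.** Let $f:\mathbb R^d\times\mathbb R^k\to\mathbb R^d$ and $g,y:\mathbb R^d\to\mathbb R$ be $C^2$, and let $\mu$ be a probability measure on $\mathbb R^d$. Assume: (1) for some constant $C_1$, $|\partial_x^i\partial_\theta^j f(x,\theta)|\le C_1|\theta|^i(|x|+1)^j$ for all $x,\theta$ and all $i,j\ge 0$ with $0<i+j\le 2$; (2) for every $R>0$ the set of functions $x\mapsto\int f(x,\theta)\,d\rho(\theta)$, with $\rho$ ranging over the probability measures on $\mathbb R^k$ with finite second moment, is dense in $C(\{|x|<R\};\mathbb R^d)$ (locally uniform convergence); (3) $g$ and $\nabla g$ are Lipschitz and $\inf_x|\nabla g(x)|>0$; (4) $\mu$ has a density in $L^\infty$, and $\mu(\{|x|\ge R\})=0$ for some $R>0$; (5) $y$ is bounded on bounded sets. *Discrete ResNet.* For $\Theta_{L,M}=\{\theta_{l,m}\}_{0\le l<L,\,1\le m\le M}\subset\mathbb R^k$ let $z_0=x$, $z_{l+1}=z_l+\frac1{ML}\sum_{m=1}^M f(z_l,\theta_{l,m})$, and $E(\Theta_{L,M})=\mathbb E_{x\sim\mu}\big[\tfrac12(g(z_L(x))-y(x))^2\big]$.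 Its gradient flow is $$\frac{d\Theta_{L,M}}{ds}=-ML\,\nabla E(\Theta_{L,M}(s))-2e^{-s}\Theta_{L,M}(s),\qquad s>0,$$ with $\Theta_{L,M}(s)$ continuous in $s\ge0$. *Continuous-depth ResNet.* For $\Theta=\{\theta_m\}_{m=1}^M\subset C([0,1];\mathbb R^k)$ let $Z_\Theta(\cdot;x)$ solve $\frac{dz}{dt}=\frac1M\sum_{m=1}^M f(z,\theta_m(t))$ on $[0,1]$, $z(0)=x$, and let $E(\Theta)=\mathbb E_{x\sim\mu}\big[\tfrac12(g(Z_\Theta(1;x))-y(x))^2\big]$. Its gradient flow is $$\frac{d\theta_m(s;t)}{ds}=-M\frac{\delta E(\Theta(s))}{\delta\theta_m}(t)-2e^{-s}\theta_m(s;t),\qquad s>0,\ t\in[0,1],\ 1\le m\le M,$$ where $s\mapsto\Theta(s;\cdot)$ is continuous from $[0,\infty)$ to $C([0,1];\mathbb R^k)^M$ and $\frac{\delta E}{\delta\theta_m}\in C([0,1];\mathbb R^k)$ is the functional derivative, i.e. $\frac{d}{d\epsilon}\big|_{\epsilon=0}E(\theta_1,\dots,\theta_m+\epsilon h,\dots,\theta_M)=\int_0^1\langle\frac{\delta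 E}{\delta\theta_m}(t),h(t)\rangle\,dt$ for all $h\in C([0,1];\mathbb R^k)$. *Limit-admissibility.* Let $\rho_{\rm ini}(\cdot,t)$, $t\in[0,1]$, be probability measures on $\mathbb R^k$ with finite second moments. A particle presentation of $\rho_{\rm ini}$ is a law $Q$ on $C([0,1];\mathbb R^k)$ of a process $\theta(t)$ with $\theta(t)\sim\rho_{\rm ini}(\cdot,t)$ for all $t$ and $\lim_{t\to t_0}\mathbb E|\theta(t)-\theta(t_0)|^2=0$ for all $t_0$. Given constants $C_3,C_4>\sup_{t}\int|\theta|^2\,d\rho_{\rm ini}(\theta,t)$, call $\rho_{\rm ini}$, presented by $Q$, *limit-admissible with constants $C_3,C_4$* if for every $\eta>0$ and every integer $M>C_3/\eta$, i.i.d. processes $\theta_1,\dots,\theta_M$ with law $Q$ satisfy $$\mathbb P\Big(\sup_{t\in[0,1]}\tfrac1M\sum_{m=1}^M|\theta_m(t)|^2\le C_4\Big)\ge1-\eta$$ and, for every integer $L>0$, $$\mathbb P\Big(\tfrac1M\sum_{l=0}^{L-1}\sum_{m=1}^M\int_{l/L}^{(l+1)/L}\big|\theta_m(t)-\theta_m(\tfrac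 lL)\big|^2dt\le\tfrac{C_4}{L^2}\Big)\ge1-\eta .$$ **Theorem.** Let $\rho_{\rm ini}$, $C_3,C_4$ and $S>0$ be given (with $f,g,y,\mu$ fixed as above). There is a constant $C>0$, depending only on these (in particular not on $Q,\epsilon,\eta,M,L$), such that the following holds. Let $Q$ be any particle presentation of $\rho_{\rm ini}$ by which it is limit-admissible with constants $C_3,C_4$; let $\epsilon,\eta>0$, and let $M,L$ be integers with $$M\ge\frac C\eta,\qquad L\ge\frac C\epsilon .$$ Let $\{\theta_m(0;\cdot)\}_{m=1}^M$ be i.i.d. with law $Q$; let, almost surely, $\Theta(s;\cdot)=\{\theta_m(s;\cdot)\}_m$ solve the continuous-depth gradient flow with initial condition $\theta_m(0;\cdot)$, and $\Theta_{L,M}(s)=\{\theta_{l,m}(s)\}$ solve the discrete gradient flow with initial condition $\theta_{l,m}(0)=\theta_m(0;\tfrac lL)$. Then for all $0\le s<S$, $$\mathbb P\Big(\big|E(\Theta(s;\cdot))-E(\Theta_{L,M}(s))\big|\le\epsilon\Big)\ge1-\eta .$$ -/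

import Mathlib

open MeasureTheory ProbabilityTheory Filter Topology
open scoped NNReal ENNReal unitInterval

namespace DeepResNet

noncomputable section

/-- `ℝⁿ` with the Euclidean norm. -/
abbrev Euc (n : ℕ) : Type := EuclideanSpace ℝ (Fin n)

/-- Continuous parameter trajectories `t ∈ [0,1] ↦ θ(t) ∈ ℝᵏ`, with the sup-norm topology. -/
abbrev ParamPath (k : ℕ) : Type := C(I, Euc k)

/-- Path space carries its Borel σ-algebra. -/
instance instMeasurableSpaceParamPath (k : ℕ) : MeasurableSpace (ParamPath k) := borel _

instance instBorelSpaceParamPath (k : ℕ) : BorelSpace (ParamPath k) := ⟨rfl⟩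

/-- The point of `[0,1]` given by a real time `t` (only used for `t ∈ [0,1]`). -/
def toI (t : ℝ) : I := Set.projIcc 0 1 zero_le_one t

/-- Probability measures on `ℝᵏ` with finite second moment. -/
def P2 (k : ℕ) : Set (Measure (Euc k)) :=
  {ρ | IsProbabilityMeasure ρ ∧ ∫⁻ θ, ‖θ‖ₑ ^ 2 ∂ρ < ∞}

/-! ### Standing assumption on activation, measuring function, labels and input law -/

/-- The standing assumption on `f`, `g`, `y` and the input distribution `μ`. The norm of a mixed
derivative is the operator norm of the corresponding multilinear map; the constant `C₁` absorbs
the difference with the Frobenius norm. In the density condition, `C(|x| < R; ℝᵈ)` carries the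
topology of locally uniform convergence. -/
structure StandingAssumption {d k : ℕ} (f : Euc d → Euc k → Euc d) (g y : Euc d → ℝ)
    (μ : Measure (Euc d)) : Prop where
  contDiff_f : ContDiff ℝ 2 (fun q : Euc d × Euc k => f q.1 q.2)
  contDiff_g : ContDiff ℝ 2 g
  contDiff_y : ContDiff ℝ 2 y
  deriv_bound : ∃ C₁ : ℝ, ∀ i j : ℕ, 0 < i + j → i + j ≤ 2 → ∀ (x : Euc d) (θ : Euc k),
    ‖iteratedFDeriv ℝ i (fun x' => iteratedFDeriv ℝ j (f x') θ) x‖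
      ≤ C₁ * ‖θ‖ ^ i * (‖x‖ + 1) ^ j
  dense : ∀ R : ℝ, 0 < R →
    Dense {h : C(Metric.ball (0 : Euc d) R, Euc d) |
      ∃ ρ ∈ P2 k, ∀ x, h x = ∫ θ, f x θ ∂ρ}
  lipschitz_g : ∃ K : ℝ≥0, LipschitzWith K g
  lipschitz_grad_g : ∃ K : ℝ≥0, LipschitzWith K (gradient g)
  grad_g_pos : 0 < ⨅ x, ‖gradient g x‖
  isProbabilityMeasure : IsProbabilityMeasure μ
  density : ∃ p : Euc d → ℝ, Measurable p ∧ (∀ x, 0 ≤ p x) ∧ MemLp p ∞ volume ∧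
    μ = volume.withDensity (fun x => ENNReal.ofReal (p x))
  compact_support : ∃ R : ℝ, 0 < R ∧ μ {x | R ≤ ‖x‖} = 0
  bounded_y : ∀ R : ℝ, BddAbove ((fun x => |y x|) '' Metric.closedBall 0 R)

/-! ### Finite-depth ResNet -/

/-- `z_l(x)`: `z_0 = x`, `z_{l+1} = z_l + (1/(ML)) ∑ₘ f(z_l, θ_{l,m})` for `l < L`. -/
def layer {d k L M : ℕ} (f : Euc d → Euc k → Euc d) (Θ : Fin L → Fin M → Euc k) (x : Euc d) :
    ℕ → Euc d
  | 0 => x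
  | l + 1 => layer f Θ x l +
      if h : l < L then ((M : ℝ) * L)⁻¹ • ∑ m, f (layer f Θ x l) (Θ ⟨l, h⟩ m) else 0

/-- The loss `E(Θ_{L,M})` of the finite-depth ResNet. -/
def discreteLoss {d k L M : ℕ} (f : Euc d → Euc k → Euc d) (g y : Euc d → ℝ)
    (μ : Measure (Euc d)) (Θ : Fin L → Fin M → Euc k) : ℝ :=
  ∫ x, (1 / 2 : ℝ) * (g (layer f Θ x L) - y x) ^ 2 ∂μ

/-- The partial gradient `∂E/∂θ_{l,m}` at `Θ_{L,M}`. -/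
def partialGrad {k L M : ℕ} (J : (Fin L → Fin M → Euc k) → ℝ) (Θ : Fin L → Fin M → Euc k)
    (l : Fin L) (m : Fin M) : Euc k :=
  gradient (fun v : Euc k => J (Function.update Θ l (Function.update (Θ l) m v))) (Θ l m)

/-- `s ↦ Θ_{L,M}(s)` solves, on `[0,∞)`, the regularized gradient flow
`dΘ/ds = -ML ∇E(Θ) - 2 e^{-s} Θ` with initial condition `Θ₀`. -/
def IsDiscreteFlow {d k L M : ℕ} (f : Euc d → Euc k → Euc d) (g y : Euc d → ℝ)
    (μ : Measure (Euc d)) (Θ₀ : Fin L → Fin M → Euc k) (Θ : ℝ → Fin L → Fin M → Euc k) : Prop :=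
  ContinuousOn Θ (Set.Ici 0) ∧ Θ 0 = Θ₀ ∧
  ∀ s : ℝ, 0 < s → ∀ l m, HasDerivAt (fun s' => Θ s' l m)
    (-(((M : ℝ) * L) • partialGrad (discreteLoss f g y μ) (Θ s) l m)
      - (2 * Real.exp (-s)) • Θ s l m) s

/-! ### Infinite-depth ResNet with `M` particle trajectories -/

/-- `z` solves `dz/dt = (1/M) ∑ₘ f(z, θₘ(t))` on `[0,1]`, `z(0) = x`. -/
def IsResNetODE {d k M : ℕ} (f : Euc d → Euc k → Euc d) (Θ : Fin M → ParamPath k) (x : Euc d)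
    (z : ℝ → Euc d) : Prop :=
  z 0 = x ∧ ∀ t ∈ Set.Icc (0 : ℝ) 1,
    HasDerivWithinAt z ((M : ℝ)⁻¹ • ∑ m, f (z t) (Θ m (toI t))) (Set.Icc 0 1) t

/-- `Z_Θ(·;x)`, the solution of the ODE (unique on `[0,1]` under the standing assumption). -/
def flowZ {d k M : ℕ} (f : Euc d → Euc k → Euc d) (Θ : Fin M → ParamPath k) (x : Euc d) :
    ℝ → Euc d :=
  Classical.epsilon (IsResNetODE f Θ x)

/-- The loss `E(Θ)` of the continuous-depth ResNet. -/
def continuousLoss {d k M : ℕ} (f : Euc d → Euc k → Euc d) (g y : Euc d → ℝ)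
    (μ : Measure (Euc d)) (Θ : Fin M → ParamPath k) : ℝ :=
  ∫ x, (1 / 2 : ℝ) * (g (flowZ f Θ x 1) - y x) ^ 2 ∂μ

/-- `G` is the (continuous representative of the) functional derivative `δJ/δθₘ` at `Θ`: for every
direction `h`, the derivative at `ε = 0` of `J` along the perturbation `θₘ + ε h` of the `m`-th
trajectory is `∫₀¹ ⟨G(t), h(t)⟩ dt`. -/
def IsFunctionalDeriv {k M : ℕ} (J : (Fin M → ParamPath k) → ℝ) (Θ : Fin M → ParamPath k)
    (m : Fin M) (G : ParamPath k) : Prop :=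
  ∀ h : ParamPath k, HasDerivAt (fun ε : ℝ => J (Function.update Θ m (Θ m + ε • h)))
    (∫ t : I, inner ℝ (G t) (h t)) 0

/-- `s ↦ Θ(s;·)` solves, on `[0,∞)`, the regularized gradient flow
`dθₘ(s;t)/ds = -M (δE(Θ(s))/δθₘ)(t) - 2 e^{-s} θₘ(s;t)` with initial condition `Θ₀`; it is a
continuous curve of lists of continuous trajectories. -/
def IsContinuousFlow {d k M : ℕ} (f : Euc d → Euc k → Euc d) (g y : Euc d → ℝ)
    (μ : Measure (Euc d)) (Θ₀ : Fin M → ParamPath k) (Θ : ℝ → Fin M → ParamPath k) : Prop :=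
  ContinuousOn Θ (Set.Ici 0) ∧ Θ 0 = Θ₀ ∧
  ∀ s : ℝ, 0 < s → ∀ m, ∃ G : ParamPath k,
    IsFunctionalDeriv (continuousLoss f g y μ) (Θ s) m G ∧
    ∀ t : I, HasDerivAt (fun s' => Θ s' m t)
      (-((M : ℝ) • G t) - (2 * Real.exp (-s)) • Θ s m t) s

/-! ### Particle presentations and limit-admissibility -/

/-- `Q` is the law of a particle presentation of `ρ`: a continuous stochastic process `θ(t)` with
`θ(t) ∼ ρ(·,t)` for all `t` and `E|θ(t) - θ(t₀)|² → 0` as `t → t₀`. -/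
structure IsParticlePresentation {k : ℕ} (ρ : I → Measure (Euc k)) (Q : Measure (ParamPath k)) :
    Prop where
  isProbabilityMeasure : IsProbabilityMeasure Q
  mem_P2 : ∀ t, ρ t ∈ P2 k
  marginal : ∀ t, Q.map (fun q => q t) = ρ t
  mean_square_continuous : ∀ t₀ : I,
    Tendsto (fun t => ∫⁻ q, ‖q t - q t₀‖ₑ ^ 2 ∂Q) (𝓝 t₀) (𝓝 0)

/-- `ρ`, presented by the path law `Q`, is limit-admissible with constants `C₃`, `C₄`: both exceed
the supremum of the second moments of `ρ(·,t)`, and for all `η > 0`, `M > C₃/η`, the list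
`{θₘ}` of `M` independent trajectories with law `Q` satisfies, with probability at least `1 - η`
each, the second moment bound and, for every depth `L`, the discretization bound. -/
structure IsLimitAdmissible {k : ℕ} (ρ : I → Measure (Euc k)) (C₃ C₄ : ℝ)
    (Q : Measure (ParamPath k)) : Prop where
  presentation : IsParticlePresentation ρ Q
  moment_lt_C₃ : ⨆ t, ∫⁻ θ, ‖θ‖ₑ ^ 2 ∂(ρ t) < ENNReal.ofReal C₃
  moment_lt_C₄ : ⨆ t, ∫⁻ θ, ‖θ‖ₑ ^ 2 ∂(ρ t) < ENNReal.ofReal C₄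
  second_moment : ∀ (η : ℝ) (M : ℕ), 0 < η → C₃ / η < M →
    1 - η ≤ (Measure.pi fun _ : Fin M => Q).real
      {Θ | ∀ t : I, (M : ℝ)⁻¹ * ∑ m, ‖Θ m t‖ ^ 2 ≤ C₄}
  discretization : ∀ (η : ℝ) (M : ℕ), 0 < η → C₃ / η < M → ∀ L : ℕ, 0 < L →
    1 - η ≤ (Measure.pi fun _ : Fin M => Q).real
      {Θ | (M : ℝ)⁻¹ * ∑ l : Fin L, ∑ m,
          ∫ t in ((l : ℕ) / L : ℝ)..(((l : ℕ) + 1) / L : ℝ),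
            ‖Θ m (toI t) - Θ m (toI ((l : ℕ) / L))‖ ^ 2
        ≤ C₄ / (L : ℝ) ^ 2}

end

end DeepResNet

/-! Both networks are instances of one Volterra equation `z t = x + ∫_{r < t} F (z r) (θ r) dν(r)`
on a compact, linearly ordered time scale. For continuous depth this is `[0,1]` with Lebesgue
measure; for depth `L` it is `Fin L` with mass `1/L` at each layer. The strict inequality turns the
grid equation into the explicit recursion `layer`. The output `z_L` is then not the state at any
grid time, but the integral over the whole scale, `finalState`. The adjoint equation integrates over
the strict future. Fubini on `{t < r}` then gives one gradient formula for both networks, with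
integrand `D(z,θ)* q` (`exists_loss_taylor`, `hasFDerivAt_loss`).

The `M` particles also become a single parameter, in an `ℓ²` space scaled so that the norm is the
root mean square. The averaged activation satisfies the bounds of `f` with the same constant
(`Activation.meanField`), so no later constant depends on `M`. The prefactors `M` and `ML` of the
flows are exactly those that turn them into gradient flows for the `L²(ν)` pairing.

A priori bounds: the energy `E + e^{-s} ∫ |θ|²` decreases along the flow, which bounds the mean
square of the parameters for `s < S`. A mean square bound already controls states, adjoint states
and the gradient uniformly in time, and Gronwall in `s` then bounds the parameters in sup norm
(`IsFlow.norm_le`).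

Comparison: the mean square deviation of the parameters inside the cells of the grid is initially
`O(1/L²)`. It stays so, because the gradient is Lipschitz in `t` up to the variation of `θ` itself
(`IsFlow.cellSum_le`). Hence left-endpoint quadrature errors are `O(1/L)`, and stability of the two
Volterra equations bounds the difference of the gradients at grid points by `c (Δ + 1/L)`, where `Δ`
is the distance of the parameters (`exists_grid_comparison`). Gronwall in `s`, starting from `Δ =
0`, gives a difference of losses of order `1/L` (`exists_flow_comparison`).

All this is deterministic. Probability enters only through the two admissibility events, each of
which fails with probability at most `η/2` (`IsLimitAdmissible.le_measureReal`). -/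

namespace DeepResNet

noncomputable section

set_option linter.unusedSectionVars false

/-! ### Volterra integral equations -/

section Volterra

variable {T : Type} [TopologicalSpace T] [CompactSpace T] [MeasurableSpace T] [BorelSpace T]
  {E : Type*} [NormedAddCommGroup E] [NormedSpace ℝ E]

theorem integrable_of_continuous {ν : Measure T} [IsFiniteMeasure ν] {w : T → E}
    (hw : Continuous w) : Integrable w ν :=
  hw.integrable_of_hasCompactSupport (HasCompactSupport.of_compactSpace w)

theorem exists_norm_le_of_continuous {w : T → E} (hw : Continuous w) :
    ∃ K, 0 < K ∧ ∀ t, ‖w t‖ ≤ K := by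
  obtain ⟨K, hK⟩ := isCompact_univ.exists_bound_of_continuousOn (f := w) hw.continuousOn
  exact ⟨max K 1, by positivity, fun t => (hK t trivial).trans (le_max_left _ _)⟩

/-- The family `B t` of pasts of `t` (or of futures, for backward equations) together with a clock
`τ` for which exponential weights make the operator `w ↦ ∫_{B t} w` a contraction. -/
structure IsVolterra (E : Type*) [NormedAddCommGroup E] [NormedSpace ℝ E]
    (ν : Measure T) (B : T → Set T) (τ : T → ℝ) : Prop where
  continuous_clock : Continuous τ
  clock_nonneg : ∀ t, 0 ≤ τ t
  clock_le_one : ∀ t, τ t ≤ 1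
  measurableSet : ∀ t, MeasurableSet (B t)
  weight : ∀ c, 0 < c → ∀ t, ∫ r in B t, Real.exp (c * τ r) ∂ν ≤ Real.exp (c * τ t) / c
  continuous_integral : ∀ w : T → E, Continuous w → Continuous fun t => ∫ r in B t, w r ∂ν

variable {ν : Measure T} [IsProbabilityMeasure ν] {B : T → Set T} {τ : T → ℝ}

theorem norm_integral_le_of_forall_le {w : T → E} {K : ℝ} (hw : ∀ t, ‖w t‖ ≤ K) :
    ‖∫ r, w r ∂ν‖ ≤ K := by
  simpa using norm_integral_le_of_norm_le_const (μ := ν) (f := w) (C := K)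
    (Eventually.of_forall hw)

theorem norm_setIntegral_le_of_forall_le {w : T → E} {K : ℝ} (hK : 0 ≤ K) (hw : ∀ t, ‖w t‖ ≤ K)
    (s : Set T) : ‖∫ r in s, w r ∂ν‖ ≤ K := by
  have h := norm_setIntegral_le_of_norm_le_const (μ := ν) (f := w) (s := s) (C := K)
    (measure_lt_top _ _) (fun t _ => hw t)
  exact h.trans (mul_le_of_le_one_right hK measureReal_le_one)

/-- Evaluate at a maximum `t₀` of `u e^{-2Kτ}`. With rate `2K` the weight condition bounds the
integral term at `t₀` by `u t₀ / 2`, which is absorbed on the left. The argument never uses whether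
`ν` has atoms, so it serves both time scales. -/
theorem IsVolterra.gronwall (hB : IsVolterra E ν B τ) {u : T → ℝ} (hu : Continuous u) {a K : ℝ}
    (ha : 0 ≤ a) (hK : 0 < K) (hle : ∀ t, u t ≤ a + K * ∫ r in B t, u r ∂ν) (t : T) :
    u t ≤ 2 * a * Real.exp (2 * K) := by
  have hcont : Continuous fun t => u t * Real.exp (-(2 * K * τ t)) := by
    have := hB.continuous_clock
    fun_prop
  obtain ⟨t₀, -, hmax⟩ := isCompact_univ.exists_isMaxOn ⟨t, trivial⟩ hcont.continuousOn
  set U := u t₀ * Real.exp (-(2 * K * τ t₀)) with hU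
  have hbd : ∀ r, u r ≤ U * Real.exp (2 * K * τ r) := fun r => by
    have h : u r * Real.exp (-(2 * K * τ r)) ≤ U := hmax (Set.mem_univ r)
    calc u r = u r * Real.exp (-(2 * K * τ r)) * Real.exp (2 * K * τ r) := by
          rw [mul_assoc, ← Real.exp_add]; simp
      _ ≤ _ := mul_le_mul_of_nonneg_right h (Real.exp_pos _).le
  have hut₀ : u t₀ = U * Real.exp (2 * K * τ t₀) := by
    rw [hU, mul_assoc, ← Real.exp_add]; simp
  have hexp : Real.exp (2 * K * τ t) ≤ Real.exp (2 * K) := by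
    apply Real.exp_le_exp.2
    nlinarith [hB.clock_le_one t]
  rcases le_or_gt U 0 with hU0 | hU0
  · exact ((hbd t).trans (mul_nonpos_of_nonpos_of_nonneg hU0 (Real.exp_pos _).le)).trans
      (by positivity)
  have hcexp : Continuous fun r => Real.exp (2 * K * τ r) := by
    have := hB.continuous_clock
    fun_prop
  have hint : ∫ r in B t₀, u r ∂ν ≤ U * (Real.exp (2 * K * τ t₀) / (2 * K)) := by
    calc ∫ r in B t₀, u r ∂ν ≤ ∫ r in B t₀, U * Real.exp (2 * K * τ r) ∂ν :=
          integral_mono (integrable_of_continuous hu).integrableOn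
            (integrable_of_continuous (hcexp.const_mul U)).integrableOn hbd
      _ = U * ∫ r in B t₀, Real.exp (2 * K * τ r) ∂ν := integral_const_mul _ _
      _ ≤ _ := mul_le_mul_of_nonneg_left (hB.weight _ (by positivity) t₀) hU0.le
  have h1 : u t₀ ≤ a + u t₀ / 2 := by
    refine (hle t₀).trans ?_
    have := mul_le_mul_of_nonneg_left hint hK.le
    have h2 : K * (U * (Real.exp (2 * K * τ t₀) / (2 * K))) = u t₀ / 2 := by
      rw [hut₀]; field_simp
    linarith
  have hU2 : U ≤ 2 * a := by
    have h3 : U ≤ u t₀ := by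
      rw [hut₀]
      have : 1 ≤ Real.exp (2 * K * τ t₀) :=
        Real.one_le_exp (by have := hB.clock_nonneg t₀; positivity)
      nlinarith
    linarith
  calc u t ≤ U * Real.exp (2 * K * τ t) := hbd t
    _ ≤ 2 * a * Real.exp (2 * K) := by gcongr

/-- Cauchy–Schwarz through the discriminant of `x ↦ ∫_s (κ - x u)²`; the factor with `κ` is then
enlarged to the whole space. -/
theorem integral_mul_sq_le {κ u : T → ℝ} (hκ : Continuous κ) (hu : Continuous u) (s : Set T) :
    (∫ r in s, κ r * u r ∂ν) ^ 2 ≤ (∫ r, κ r ^ 2 ∂ν) * ∫ r in s, u r ^ 2 ∂ν := by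
  have hκ2 : Integrable (fun r => κ r ^ 2) ν := integrable_of_continuous (hκ.pow 2)
  have hu2 : Integrable (fun r => u r ^ 2) ν := integrable_of_continuous (hu.pow 2)
  have hκu : Integrable (fun r => κ r * u r) ν := integrable_of_continuous (hκ.mul hu)
  have hquad : ∀ x : ℝ, 0 ≤ (∫ r in s, u r ^ 2 ∂ν) * (x * x) + (-2 * ∫ r in s, κ r * u r ∂ν) * x
      + ∫ r in s, κ r ^ 2 ∂ν := fun x => by
    have h : 0 ≤ ∫ r in s, (κ r - x * u r) ^ 2 ∂ν := integral_nonneg fun r => sq_nonneg _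
    have heq : ∀ r, (κ r - x * u r) ^ 2 = (κ r ^ 2 + (x * x) * u r ^ 2) - (2 * x) * (κ r * u r) :=
      fun r => by ring
    simp only [heq] at h
    have hi : IntegrableOn (fun r => κ r ^ 2 + (x * x) * u r ^ 2) s ν :=
      (hκ2.add (hu2.const_mul _)).integrableOn
    rw [integral_sub hi (hκu.integrableOn.const_mul _),
      integral_add hκ2.integrableOn (hu2.integrableOn.const_mul _),
      integral_const_mul, integral_const_mul] at h
    linarith
  have hd := discrim_le_zero hquad
  have hle : ∫ r in s, κ r ^ 2 ∂ν ≤ ∫ r, κ r ^ 2 ∂ν :=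
    setIntegral_le_integral hκ2 (Eventually.of_forall fun r => sq_nonneg _)
  have h0 : 0 ≤ ∫ r in s, u r ^ 2 ∂ν := integral_nonneg fun r => sq_nonneg _
  rw [discrim] at hd
  nlinarith

/-- For kernels that are controlled only in mean square: squaring and Cauchy–Schwarz reduce to
`IsVolterra.gronwall` for `u²`, with data `2a²` and rate `2K`. -/
theorem IsVolterra.gronwall_sq (hB : IsVolterra E ν B τ) {κ u : T → ℝ} (hκ : Continuous κ)
    (hu : Continuous u) {a K : ℝ} (ha : 0 ≤ a) (hK : 0 < K) (hu0 : ∀ t, 0 ≤ u t)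
    (hκK : ∫ r, κ r ^ 2 ∂ν ≤ K) (hle : ∀ t, u t ≤ a + ∫ r in B t, κ r * u r ∂ν) (t : T) :
    u t ≤ 2 * a * Real.exp (2 * K) := by
  have hsq : ∀ t, u t ^ 2 ≤ 2 * a ^ 2 + (2 * K) * ∫ r in B t, u r ^ 2 ∂ν := fun t => by
    have h1 := integral_mul_sq_le (ν := ν) hκ hu (B t)
    have h0 : 0 ≤ ∫ r in B t, u r ^ 2 ∂ν := integral_nonneg fun r => sq_nonneg _
    have h2 := pow_le_pow_left₀ (hu0 t) (hle t) 2
    have h3 := mul_le_mul_of_nonneg_right hκK h0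
    nlinarith [sq_nonneg (a - ∫ r in B t, κ r * u r ∂ν)]
  have h := hB.gronwall (hu.pow 2) (by positivity) (by positivity) hsq t
  refine le_of_sq_le_sq ?_ (by positivity)
  calc u t ^ 2 ≤ 2 * (2 * a ^ 2) * Real.exp (2 * (2 * K)) := h
    _ = (2 * a * Real.exp (2 * K)) ^ 2 := by
      rw [mul_pow, ← Real.exp_nat_mul]; push_cast; ring_nf

/-- Stability of Volterra equations under perturbation, the equations being solved up to `e`. -/
theorem IsVolterra.norm_sub_le (hB : IsVolterra E ν B τ) {φ φ' : T → E → E} {u u' : T → E}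
    (hu : Continuous u) (hu' : Continuous u')
    (hφ : Continuous fun r => φ r (u r)) (hφ' : Continuous fun r => φ' r (u' r))
    {e η K : ℝ} (he : 0 ≤ e) (hη : 0 ≤ η) (hK : 0 < K)
    (hlip : ∀ r, ‖φ r (u r) - φ r (u' r)‖ ≤ K * ‖u r - u' r‖)
    (hclose : ∀ r, ‖φ r (u' r) - φ' r (u' r)‖ ≤ η)
    (hres : ∀ t, ‖(u t - ∫ r in B t, φ r (u r) ∂ν) - (u' t - ∫ r in B t, φ' r (u' r) ∂ν)‖ ≤ e)
    (t : T) : ‖u t - u' t‖ ≤ 2 * (e + η) * Real.exp (2 * K) := by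
  refine hB.gronwall (u := fun t => ‖u t - u' t‖) (by fun_prop) (by positivity) hK (fun t => ?_) t
  have hi := (integrable_of_continuous (ν := ν) hφ).integrableOn (s := B t)
  have hi' := (integrable_of_continuous (ν := ν) hφ').integrableOn (s := B t)
  have hun : Continuous fun r => ‖u r - u' r‖ := by fun_prop
  have hd : ‖∫ r in B t, (φ r (u r) - φ' r (u' r)) ∂ν‖ ≤ η + K * ∫ r in B t, ‖u r - u' r‖ ∂ν := by
    calc ‖∫ r in B t, (φ r (u r) - φ' r (u' r)) ∂ν‖
        ≤ ∫ r in B t, ‖φ r (u r) - φ' r (u' r)‖ ∂ν := norm_integral_le_integral_norm _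
      _ ≤ ∫ r in B t, (η + K * ‖u r - u' r‖) ∂ν := by
          refine integral_mono (hi.sub hi').norm (integrable_of_continuous
            (continuous_const.add (hun.const_mul K))).integrableOn fun r => ?_
          calc ‖φ r (u r) - φ' r (u' r)‖
              = ‖(φ r (u' r) - φ' r (u' r)) + (φ r (u r) - φ r (u' r))‖ := by congr 1; abel
            _ ≤ _ := (norm_add_le _ _).trans (add_le_add (hclose r) (hlip r))
      _ = (∫ r in B t, η ∂ν) + K * ∫ r in B t, ‖u r - u' r‖ ∂ν := by
          rw [integral_add (integrable_const _)
            (integrable_of_continuous (hun.const_mul K)).integrableOn, integral_const_mul]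
      _ ≤ _ := by
          gcongr
          have := norm_setIntegral_le_of_forall_le (ν := ν) (w := fun _ : T => η) hη
            (fun _ => by rw [Real.norm_of_nonneg hη]) (B t)
          exact (le_abs_self _).trans this
  rw [integral_sub hi hi'] at hd
  calc ‖u t - u' t‖ = ‖((u t - ∫ r in B t, φ r (u r) ∂ν) - (u' t - ∫ r in B t, φ' r (u' r) ∂ν))
        + ((∫ r in B t, φ r (u r) ∂ν) - ∫ r in B t, φ' r (u' r) ∂ν)‖ := by congr 1; abel
    _ ≤ e + (η + K * ∫ r in B t, ‖u r - u' r‖ ∂ν) :=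
        (norm_add_le _ _).trans (add_le_add (hres t) hd)
    _ = _ := by ring

/-- Banach's fixed point theorem for the rescaled unknown `e^{-2Kτ} u`: at this rate the weight
condition gives the contraction constant `1/2` however large `K` is. -/
theorem IsVolterra.exists_solution [CompleteSpace E] (hB : IsVolterra E ν B τ) {φ : T → E → E}
    (hφ : ∀ u : T → E, Continuous u → Continuous fun r => φ r (u r)) {K : ℝ} (hK : 0 < K)
    (hlip : ∀ r x y, ‖φ r x - φ r y‖ ≤ K * ‖x - y‖) (x : E) :
    ∃ u : C(T, E), ∀ t, u t = x + ∫ r in B t, φ r (u r) ∂ν := by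
  have hτ := hB.continuous_clock
  have hsc : ∀ v : C(T, E), Continuous fun r => Real.exp (2 * K * τ r) • v r := fun v => by
    fun_prop
  let Ψ : C(T, E) → C(T, E) := fun v =>
    ⟨fun t => Real.exp (-(2 * K * τ t)) •
      (x + ∫ r in B t, φ r (Real.exp (2 * K * τ r) • v r) ∂ν), by
      have := hB.continuous_integral _ (hφ _ (hsc v))
      fun_prop⟩
  have hΨ : ContractingWith (1 / 2 : ℝ≥0) Ψ := by
    refine ⟨by rw [← NNReal.coe_lt_coe]; norm_num, LipschitzWith.of_dist_le_mul fun v v' => ?_⟩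
    rw [ContinuousMap.dist_le (by positivity)]
    intro t
    have hi := (integrable_of_continuous (ν := ν) (hφ _ (hsc v))).integrableOn (s := B t)
    have hi' := (integrable_of_continuous (ν := ν) (hφ _ (hsc v'))).integrableOn (s := B t)
    have hcexp : Continuous fun r => Real.exp (2 * K * τ r) := by fun_prop
    have h1 : ‖∫ r in B t, (φ r (Real.exp (2 * K * τ r) • v r)
        - φ r (Real.exp (2 * K * τ r) • v' r)) ∂ν‖
        ≤ (K * dist v v') * (Real.exp (2 * K * τ t) / (2 * K)) := by
      calc _ ≤ ∫ r in B t, ‖φ r (Real.exp (2 * K * τ r) • v r)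
            - φ r (Real.exp (2 * K * τ r) • v' r)‖ ∂ν := norm_integral_le_integral_norm _
        _ ≤ ∫ r in B t, (K * dist v v') * Real.exp (2 * K * τ r) ∂ν := by
            refine integral_mono (hi.sub hi').norm (integrable_of_continuous
              (hcexp.const_mul _)).integrableOn fun r => ?_
            refine (hlip _ _ _).trans ?_
            rw [← smul_sub, norm_smul, Real.norm_of_nonneg (Real.exp_pos _).le, ← dist_eq_norm]
            have := ContinuousMap.dist_apply_le_dist (f := v) (g := v') r
            calc K * (Real.exp (2 * K * τ r) * dist (v r) (v' r))
                ≤ K * (Real.exp (2 * K * τ r) * dist v v') := by gcongr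
              _ = _ := by ring
        _ = (K * dist v v') * ∫ r in B t, Real.exp (2 * K * τ r) ∂ν := integral_const_mul _ _
        _ ≤ _ := mul_le_mul_of_nonneg_left (hB.weight _ (by positivity) t) (by positivity)
    rw [integral_sub hi hi'] at h1
    rw [dist_eq_norm]
    change ‖Real.exp (-(2 * K * τ t)) • (x + ∫ r in B t, φ r (Real.exp (2 * K * τ r) • v r) ∂ν)
      - Real.exp (-(2 * K * τ t)) •
        (x + ∫ r in B t, φ r (Real.exp (2 * K * τ r) • v' r) ∂ν)‖ ≤ _
    rw [← smul_sub, norm_smul, Real.norm_of_nonneg (Real.exp_pos _).le, add_sub_add_left_eq_sub]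
    calc _ ≤ Real.exp (-(2 * K * τ t)) *
          ((K * dist v v') * (Real.exp (2 * K * τ t) / (2 * K))) := by gcongr
      _ = (Real.exp (-(2 * K * τ t)) * Real.exp (2 * K * τ t)) * (dist v v' / 2) := by
          field_simp
      _ = _ := by
          rw [← Real.exp_add]
          simp; ring
  obtain ⟨v, hv⟩ : ∃ v, Ψ v = v := ⟨_, hΨ.fixedPoint_isFixedPt⟩
  refine ⟨⟨_, hsc v⟩, fun t => ?_⟩
  have h : v t = Real.exp (-(2 * K * τ t)) •
      (x + ∫ r in B t, φ r (Real.exp (2 * K * τ r) • v r) ∂ν) := congrArg (fun w => w t) hv.symm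
  simp only [ContinuousMap.coe_mk]
  conv_lhs => rw [h, smul_smul, ← Real.exp_add]
  simp

end Volterra

/-! ### Activations and losses with quantitative derivative bounds -/

section Activation

variable {E : Type*} [NormedAddCommGroup E] [InnerProductSpace ℝ E]
  {W : Type*} [NormedAddCommGroup W] [InnerProductSpace ℝ W]

/-- An activation `F` with partial derivatives `A` in the state and `D` in the parameter, which
satisfy the growth and Lipschitz bounds of the standing assumption. -/
structure Activation (F : E → W → E) (A : E → W → E →L[ℝ] E) (D : E → W → W →L[ℝ] E)
    (C : ℝ) : Prop where
  one_le : 1 ≤ C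
  hasFDerivAt_state : ∀ x w, HasFDerivAt (fun x => F x w) (A x w) x
  hasFDerivAt_param : ∀ x w, HasFDerivAt (F x) (D x w) w
  norm_le : ∀ x w, ‖F x w‖ ≤ C * (‖x‖ + 1) * (‖w‖ + 1)
  norm_A_le : ∀ x w, ‖A x w‖ ≤ C * ‖w‖
  norm_D_le : ∀ x w, ‖D x w‖ ≤ C * (‖x‖ + 1)
  norm_A_sub_state : ∀ x x' w, ‖A x w - A x' w‖ ≤ C * ‖w‖ ^ 2 * ‖x - x'‖
  norm_A_sub_param : ∀ x w w', ‖A x w - A x w'‖ ≤ C * (‖w‖ + ‖w'‖) * (‖x‖ + 1) * ‖w - w'‖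
  norm_D_sub_state : ∀ x x' w,
    ‖D x w - D x' w‖ ≤ C * ‖w‖ * (‖x‖ + ‖x'‖ + 1) * ‖x - x'‖
  norm_D_sub_param : ∀ x w w', ‖D x w - D x w'‖ ≤ C * (‖x‖ + 1) ^ 2 * ‖w - w'‖

/-- A nonnegative loss `ℓ x z` at input `x` and output `z`, with gradient `b x z` in `z`, and with
bounds for inputs in the ball of radius `R`. -/
structure IsLoss (ℓ : E → E → ℝ) (b : E → E → E) (R C : ℝ) : Prop where
  radius_nonneg : 0 ≤ R
  continuous_loss : Continuous fun p : E × E => ℓ p.1 p.2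
  continuous_grad : Continuous fun p : E × E => b p.1 p.2
  nonneg : ∀ x z, 0 ≤ ℓ x z
  le : ∀ x z, ‖x‖ ≤ R → ℓ x z ≤ C * (1 + ‖z‖) ^ 2
  norm_grad_le : ∀ x z, ‖x‖ ≤ R → ‖b x z‖ ≤ C * (1 + ‖z‖)
  norm_grad_sub_le : ∀ x z z', ‖x‖ ≤ R → ‖b x z - b x z'‖ ≤ C * (1 + ‖z‖ + ‖z'‖) * ‖z - z'‖
  taylor : ∀ x z z', ‖x‖ ≤ R →
    |ℓ x z' - ℓ x z - inner ℝ (b x z) (z' - z)| ≤ C * (1 + ‖z‖ + ‖z'‖) * ‖z' - z‖ ^ 2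

theorem continuous_of_norm_sub_le {X Y G : Type*} [NormedAddCommGroup X] [NormedAddCommGroup Y]
    [NormedAddCommGroup G] {f : X → Y → G} {c : X → X → Y → ℝ} {c' : X → Y → Y → ℝ}
    (hc : Continuous fun p : X × X × Y => c p.1 p.2.1 p.2.2)
    (hc' : Continuous fun p : X × Y × Y => c' p.1 p.2.1 p.2.2)
    (h : ∀ x x' w, ‖f x w - f x' w‖ ≤ c x x' w * ‖x - x'‖)
    (h' : ∀ x w w', ‖f x w - f x w'‖ ≤ c' x w w' * ‖w - w'‖) :
    Continuous fun p : X × Y => f p.1 p.2 := by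
  rw [continuous_iff_continuousAt]
  rintro ⟨x, w⟩
  rw [ContinuousAt, tendsto_iff_norm_sub_tendsto_zero]
  have hlim : Tendsto (fun p : X × Y => c p.1 x p.2 * ‖p.1 - x‖ + c' x p.2 w * ‖p.2 - w‖)
      (𝓝 (x, w)) (𝓝 0) := by
    have h1 : Continuous fun p : X × Y => c p.1 x p.2 :=
      hc.comp (continuous_fst.prodMk (continuous_const.prodMk continuous_snd))
    have h2 : Continuous fun p : X × Y => c' x p.2 w :=
      hc'.comp (continuous_const.prodMk (continuous_snd.prodMk continuous_const))
    have : Continuous fun p : X × Y => c p.1 x p.2 * ‖p.1 - x‖ + c' x p.2 w * ‖p.2 - w‖ := by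
      fun_prop
    simpa using this.tendsto (x, w)
  refine squeeze_zero (fun _ => norm_nonneg _) (fun p => ?_) hlim
  calc ‖f p.1 p.2 - f x w‖ = ‖(f p.1 p.2 - f x p.2) + (f x p.2 - f x w)‖ := by congr 1; abel
    _ ≤ _ := (norm_add_le _ _).trans (add_le_add (h _ _ _) (h' _ _ _))

variable {F : E → W → E} {A : E → W → E →L[ℝ] E} {D : E → W → W →L[ℝ] E} {C : ℝ}

namespace Activation

theorem pos (hF : Activation F A D C) : 0 < C := one_pos.trans_le hF.one_le

theorem norm_sub_state (hF : Activation F A D C) (x x' : E) (w : W) :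
    ‖F x w - F x' w‖ ≤ C * ‖w‖ * ‖x - x'‖ :=
  convex_univ.norm_image_sub_le_of_norm_hasFDerivWithin_le
    (fun y _ => (hF.hasFDerivAt_state y w).hasFDerivWithinAt) (fun y _ => hF.norm_A_le y w)
    trivial trivial

theorem norm_sub_param (hF : Activation F A D C) (x : E) (w w' : W) :
    ‖F x w - F x w'‖ ≤ C * (‖x‖ + 1) * ‖w - w'‖ :=
  convex_univ.norm_image_sub_le_of_norm_hasFDerivWithin_le
    (fun y _ => (hF.hasFDerivAt_param x y).hasFDerivWithinAt) (fun y _ => hF.norm_D_le x y)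
    trivial trivial

theorem continuous (hF : Activation F A D C) : Continuous fun p : E × W => F p.1 p.2 :=
  continuous_of_norm_sub_le (c := fun _ _ w => C * ‖w‖) (c' := fun x _ _ => C * (‖x‖ + 1))
    (by fun_prop) (by fun_prop) hF.norm_sub_state hF.norm_sub_param

theorem continuous_A (hF : Activation F A D C) : Continuous fun p : E × W => A p.1 p.2 :=
  continuous_of_norm_sub_le (c := fun _ _ w => C * ‖w‖ ^ 2)
    (c' := fun x w w' => C * (‖w‖ + ‖w'‖) * (‖x‖ + 1))
    (by fun_prop) (by fun_prop) hF.norm_A_sub_state hF.norm_A_sub_param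

theorem continuous_D (hF : Activation F A D C) : Continuous fun p : E × W => D p.1 p.2 :=
  continuous_of_norm_sub_le (c := fun x x' w => C * ‖w‖ * (‖x‖ + ‖x'‖ + 1))
    (c' := fun x _ _ => C * (‖x‖ + 1) ^ 2)
    (by fun_prop) (by fun_prop) hF.norm_D_sub_state hF.norm_D_sub_param

/-- Move the state at the new parameter, replace `A x w'` by `A x w`, then move the parameter at the
old state. The three errors are the three terms of the expanded square. -/
theorem norm_taylor_le (hF : Activation F A D C) {x x' : E} {w w' : W} {B K : ℝ}
    (hx : ‖x‖ + 1 ≤ B) (hw : ‖w‖ ≤ K) (hw' : ‖w'‖ ≤ K) :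
    ‖F x' w' - F x w - A x w (x' - x) - D x w (w' - w)‖
      ≤ C * (K * ‖x' - x‖ + B * ‖w' - w‖) ^ 2 := by
  have hC := hF.pos
  have hK : 0 ≤ K := (norm_nonneg _).trans hw
  have hB : 0 ≤ B := by linarith [norm_nonneg x]
  have h1 : ‖F x' w' - F x w' - A x w' (x' - x)‖ ≤ (C * K ^ 2 * ‖x' - x‖) * ‖x' - x‖ := by
    refine (convex_closedBall x ‖x' - x‖).norm_image_sub_le_of_norm_hasFDerivWithin_le'
      (f := fun x => F x w') (f' := fun y => A y w')
      (fun y _ => (hF.hasFDerivAt_state y w').hasFDerivWithinAt) (fun y hy => ?_)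
      (Metric.mem_closedBall_self (norm_nonneg _)) (by simp [dist_eq_norm])
    have hy' : ‖y - x‖ ≤ ‖x' - x‖ := by simpa [dist_eq_norm] using hy
    exact (hF.norm_A_sub_state y x w').trans (by gcongr)
  have h2 : ‖(A x w' - A x w) (x' - x)‖ ≤ (C * (K + K) * B * ‖w' - w‖) * ‖x' - x‖ := by
    refine (ContinuousLinearMap.le_opNorm _ _).trans ?_
    gcongr
    exact (hF.norm_A_sub_param x w' w).trans (by gcongr)
  have h3 : ‖F x w' - F x w - D x w (w' - w)‖ ≤ (C * B ^ 2 * ‖w' - w‖) * ‖w' - w‖ := by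
    refine (convex_closedBall w ‖w' - w‖).norm_image_sub_le_of_norm_hasFDerivWithin_le'
      (f := F x) (f' := fun y => D x y)
      (fun y _ => (hF.hasFDerivAt_param x y).hasFDerivWithinAt) (fun y hy => ?_)
      (Metric.mem_closedBall_self (norm_nonneg _)) (by simp [dist_eq_norm])
    have hy' : ‖y - w‖ ≤ ‖w' - w‖ := by simpa [dist_eq_norm] using hy
    exact (hF.norm_D_sub_param x y w).trans (by gcongr)
  have heq : F x' w' - F x w - A x w (x' - x) - D x w (w' - w)
      = (F x' w' - F x w' - A x w' (x' - x)) + (A x w' - A x w) (x' - x)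
        + (F x w' - F x w - D x w (w' - w)) := by
    simp only [sub_apply]; abel
  rw [heq]
  refine (norm_add₃_le.trans (add_le_add_three h1 h2 h3)).trans (le_of_eq ?_)
  ring

variable [CompleteSpace E] [CompleteSpace W]

theorem norm_adjoint_D_sub_le (hF : Activation F A D C) {x x' q q' : E} {w w' : W} {B K Q : ℝ}
    (hx : ‖x‖ + 1 ≤ B) (hx' : ‖x'‖ + 1 ≤ B) (hw : ‖w‖ ≤ K) (hq : ‖q‖ ≤ Q) :
    ‖(D x w).adjoint q - (D x' w').adjoint q'‖
      ≤ C * K * (2 * B) * Q * ‖x - x'‖ + C * B ^ 2 * Q * ‖w - w'‖ + C * B * ‖q - q'‖ := by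
  have hC := hF.pos
  have hK : 0 ≤ K := (norm_nonneg _).trans hw
  have hB : 0 ≤ B := by linarith [norm_nonneg x]
  have hn : ∀ T : W →L[ℝ] E, ∀ v, ‖T.adjoint v‖ ≤ ‖T‖ * ‖v‖ := fun T v => by
    simpa using T.adjoint.le_opNorm v
  have h1 : ‖(D x w - D x' w).adjoint q‖ ≤ (C * K * (2 * B) * ‖x - x'‖) * Q := by
    refine (hn _ _).trans ?_
    gcongr
    exact (hF.norm_D_sub_state x x' w).trans (by gcongr; linarith)
  have h2 : ‖(D x' w - D x' w').adjoint q‖ ≤ (C * B ^ 2 * ‖w - w'‖) * Q := by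
    refine (hn _ _).trans ?_
    gcongr
    exact (hF.norm_D_sub_param x' w w').trans (by gcongr)
  have h3 : ‖(D x' w').adjoint (q - q')‖ ≤ (C * B) * ‖q - q'‖ := by
    refine (hn _ _).trans ?_
    gcongr
    exact (hF.norm_D_le x' w').trans (by gcongr)
  have heq : (D x w).adjoint q - (D x' w').adjoint q' = (D x w - D x' w).adjoint q
      + (D x' w - D x' w').adjoint q + (D x' w').adjoint (q - q') := by
    simp only [map_sub, sub_apply]; abel
  rw [heq]
  refine (norm_add₃_le.trans (add_le_add_three h1 h2 h3)).trans (le_of_eq ?_)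
  ring

theorem norm_A_sub_le (hF : Activation F A D C) {x x' : E} {w w' : W} {B K : ℝ}
    (hx' : ‖x'‖ + 1 ≤ B) (hw : ‖w‖ ≤ K) (hw' : ‖w'‖ ≤ K) :
    ‖A x w - A x' w'‖ ≤ C * K ^ 2 * ‖x - x'‖ + C * (2 * K) * B * ‖w - w'‖ := by
  have hC := hF.pos
  have hK : 0 ≤ K := (norm_nonneg _).trans hw
  rw [← sub_add_sub_cancel _ (A x' w)]
  refine (norm_add_le _ _).trans (add_le_add ?_ ?_)
  · exact (hF.norm_A_sub_state x x' w).trans (by gcongr)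
  · exact (hF.norm_A_sub_param x' w w').trans (by gcongr; linarith)

theorem norm_sub_le (hF : Activation F A D C) {x x' : E} {w w' : W} {B K : ℝ}
    (hx' : ‖x'‖ + 1 ≤ B) (hw : ‖w‖ ≤ K) :
    ‖F x w - F x' w'‖ ≤ C * K * ‖x - x'‖ + C * B * ‖w - w'‖ := by
  have hC := hF.pos
  rw [← sub_add_sub_cancel _ (F x' w)]
  refine (norm_add_le _ _).trans (add_le_add ?_ ?_)
  · exact (hF.norm_sub_state x x' w).trans (by gcongr)
  · exact (hF.norm_sub_param x' w w').trans (by gcongr)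

end Activation

end Activation

/-! ### Forward and adjoint states on a general time scale -/

section TimeScale

variable {T : Type} [TopologicalSpace T] [CompactSpace T] [LinearOrder T] [MeasurableSpace T]
  [BorelSpace T]

/-- A time scale: forward and backward Volterra equations with respect to `ν` are well posed. -/
structure IsTimeScale (E : Type*) [NormedAddCommGroup E] [NormedSpace ℝ E]
    (ν : Measure T) (τ : T → ℝ) : Prop where
  forward : IsVolterra E ν Set.Iio τ
  backward : IsVolterra E ν Set.Ioi fun t => 1 - τ t

variable {E : Type*} [NormedAddCommGroup E] [InnerProductSpace ℝ E] [CompleteSpace E]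
  {W : Type*} [NormedAddCommGroup W] [InnerProductSpace ℝ W] [CompleteSpace W]

/-- `z` is the forward state started at `x` with parameters `θ`. -/
def IsState (ν : Measure T) (F : E → W → E) (θ : C(T, W)) (x : E) (z : C(T, E)) : Prop :=
  ∀ t, z t = x + ∫ r in Set.Iio t, F (z r) (θ r) ∂ν

/-- The forward state. -/
def state (ν : Measure T) (F : E → W → E) (θ : C(T, W)) (x : E) : C(T, E) :=
  Classical.epsilon (IsState ν F θ x)

/-- The terminal value of the forward state. -/
def finalState (ν : Measure T) (F : E → W → E) (θ : C(T, W)) (x : E) : E :=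
  x + ∫ r, F (state ν F θ x r) (θ r) ∂ν

/-- `q` solves the adjoint equation along the state `z`, with terminal value `p`. -/
def IsAdjoint (ν : Measure T) (A : E → W → E →L[ℝ] E) (θ : C(T, W)) (z : C(T, E)) (p : E)
    (q : C(T, E)) : Prop :=
  ∀ t, q t = p + ∫ r in Set.Ioi t, (A (z r) (θ r)).adjoint (q r) ∂ν

/-- The adjoint state for the terminal value `b x (finalState x)`. -/
def adj (ν : Measure T) (F : E → W → E) (A : E → W → E →L[ℝ] E) (b : E → E → E) (θ : C(T, W))
    (x : E) : C(T, E) :=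
  Classical.epsilon (IsAdjoint ν A θ (state ν F θ x) (b x (finalState ν F θ x)))

variable {ν : Measure T} [IsProbabilityMeasure ν] {τ : T → ℝ} {F : E → W → E}
  {A : E → W → E →L[ℝ] E} {D : E → W → W →L[ℝ] E} {C : ℝ} {ℓ : E → E → ℝ} {b : E → E → E} {R : ℝ}

theorem norm_adjoint_apply_le (S : W →L[ℝ] E) (v : E) : ‖S.adjoint v‖ ≤ ‖S‖ * ‖v‖ := by
  simpa using S.adjoint.le_opNorm v

theorem isState_state (hT : IsTimeScale E ν τ) (hF : Activation F A D C) (θ : C(T, W)) (x : E) :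
    IsState ν F θ x (state ν F θ x) := by
  refine Classical.epsilon_spec (p := IsState ν F θ x) ?_
  obtain ⟨K, hK, hθ⟩ := exists_norm_le_of_continuous θ.continuous
  refine hT.forward.exists_solution (φ := fun r u => F u (θ r)) (fun u hu => ?_)
    (mul_pos hF.pos hK) (fun r u v => ?_) x
  · exact hF.continuous.comp (hu.prodMk θ.continuous)
  · refine (hF.norm_sub_state _ _ _).trans ?_
    have := hF.pos
    gcongr
    exact hθ r

theorem isAdjoint_adj (hT : IsTimeScale E ν τ) (hF : Activation F A D C) (θ : C(T, W)) (x : E) :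
    IsAdjoint ν A θ (state ν F θ x) (b x (finalState ν F θ x)) (adj ν F A b θ x) := by
  refine Classical.epsilon_spec
    (p := IsAdjoint ν A θ (state ν F θ x) (b x (finalState ν F θ x))) ?_
  obtain ⟨K, hK, hθ⟩ := exists_norm_le_of_continuous θ.continuous
  refine hT.backward.exists_solution
    (φ := fun r u => (A (state ν F θ x r) (θ r)).adjoint u) (fun u hu => ?_)
    (mul_pos hF.pos hK) (fun r u v => ?_) _
  · have h : Continuous fun r => A (state ν F θ x r) (θ r) :=
      hF.continuous_A.comp ((state ν F θ x).continuous.prodMk θ.continuous)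
    exact (ContinuousLinearMap.adjoint.continuous.comp h).clm_apply hu
  · rw [← map_sub]
    refine (norm_adjoint_apply_le _ _).trans ?_
    gcongr
    refine (hF.norm_A_le _ _).trans ?_
    have := hF.pos
    gcongr
    exact hθ r

theorem Activation.continuous_comp (hF : Activation F A D C) {z : T → E} (hz : Continuous z)
    (θ : C(T, W)) : Continuous fun r => F (z r) (θ r) :=
  hF.continuous.comp (hz.prodMk θ.continuous)

theorem Activation.continuous_A_comp (hF : Activation F A D C) {z : T → E} (hz : Continuous z)
    (θ : C(T, W)) : Continuous fun r => A (z r) (θ r) :=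
  hF.continuous_A.comp (hz.prodMk θ.continuous)

theorem Activation.continuous_adjoint_A_comp (hF : Activation F A D C) {z q : T → E}
    (hz : Continuous z) (hq : Continuous q) (θ : C(T, W)) :
    Continuous fun r => (A (z r) (θ r)).adjoint (q r) :=
  (ContinuousLinearMap.adjoint.continuous.comp (hF.continuous_A_comp hz θ)).clm_apply hq

theorem Activation.continuous_D_comp (hF : Activation F A D C) {z : T → E} (hz : Continuous z)
    (θ : C(T, W)) : Continuous fun r => D (z r) (θ r) :=
  hF.continuous_D.comp (hz.prodMk θ.continuous)

/-- A bound for states started in the ball of radius `R` with parameters of mean square `K`. -/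
def stateBound (C R K : ℝ) : ℝ :=
  (R + 1) + 2 * (R + 1) * Real.exp (2 * (2 * C ^ 2 * (K + 1))) * (1 + 2 * C ^ 2 * (K + 1))

/-- A bound for the corresponding adjoint states. -/
def adjBound (C R K : ℝ) : ℝ :=
  2 * (C * stateBound C R K) * Real.exp (2 * (2 * C ^ 2 * (K + 1)))

theorem le_stateBound (C : ℝ) {R K : ℝ} (hR : 0 ≤ R) (hK : 0 ≤ K) : R + 1 ≤ stateBound C R K := by
  have : 0 ≤ 2 * (R + 1) * Real.exp (2 * (2 * C ^ 2 * (K + 1))) * (1 + 2 * C ^ 2 * (K + 1)) := by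
    positivity
  unfold stateBound; linarith

theorem one_le_stateBound (C : ℝ) {R K : ℝ} (hR : 0 ≤ R) (hK : 0 ≤ K) : 1 ≤ stateBound C R K := by
  linarith [le_stateBound C hR hK]

theorem adjBound_nonneg {C R K : ℝ} (hC : 0 ≤ C) (hR : 0 ≤ R) (hK : 0 ≤ K) :
    0 ≤ adjBound C R K := by
  have := one_le_stateBound C hR hK
  unfold adjBound; positivity

theorem integral_sq_norm_add_one_le {K : ℝ} (hC : 0 < C) (θ : C(T, W))
    (hθ : ∫ r, ‖θ r‖ ^ 2 ∂ν ≤ K) :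
    ∫ r, (C * (‖θ r‖ + 1)) ^ 2 ∂ν ≤ 2 * C ^ 2 * (K + 1) := by
  have h2 : Continuous fun r => ‖θ r‖ ^ 2 := by fun_prop
  calc ∫ r, (C * (‖θ r‖ + 1)) ^ 2 ∂ν ≤ ∫ r, 2 * C ^ 2 * (‖θ r‖ ^ 2 + 1) ∂ν := by
        refine integral_mono (integrable_of_continuous (by fun_prop))
          (integrable_of_continuous (by fun_prop)) fun r => ?_
        have : (C * (‖θ r‖ + 1)) ^ 2 = C ^ 2 * (‖θ r‖ + 1) ^ 2 := by ring
        have h := mul_nonneg (sq_nonneg C) (sq_nonneg (‖θ r‖ - 1))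
        simp only [this]
        nlinarith
    _ = 2 * C ^ 2 * ((∫ r, ‖θ r‖ ^ 2 ∂ν) + 1) := by
        rw [integral_const_mul, integral_add (integrable_of_continuous h2) (integrable_const _)]
        simp
    _ ≤ _ := by gcongr

/-- Only the mean square of the parameters may enter, since this is what the energy controls along
the flow. Hence `gronwall_sq`, with kernel `C (‖θ‖ + 1)` acting on `‖z‖ + 1`. -/
theorem norm_state_le_aux (hT : IsTimeScale E ν τ) (hF : Activation F A D C) {θ : C(T, W)}
    {x : E} {K : ℝ} (hK : 0 ≤ K) (hx : ‖x‖ ≤ R) (hθ : ∫ r, ‖θ r‖ ^ 2 ∂ν ≤ K) (t : T) :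
    ‖state ν F θ x t‖ + 1 ≤ 2 * (R + 1) * Real.exp (2 * (2 * C ^ 2 * (K + 1))) := by
  have hC := hF.pos
  have hR : 0 ≤ R := (norm_nonneg _).trans hx
  set z := state ν F θ x
  refine hT.forward.gronwall_sq (κ := fun r => C * (‖θ r‖ + 1)) (u := fun r => ‖z r‖ + 1)
    (by fun_prop) (by fun_prop) (by positivity) (by positivity) (fun t => by positivity)
    (integral_sq_norm_add_one_le hC θ hθ) (fun t => ?_) t
  have hz := isState_state hT hF θ x t
  have hle : ‖∫ r in Set.Iio t, F (z r) (θ r) ∂ν‖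
      ≤ ∫ r in Set.Iio t, C * (‖θ r‖ + 1) * (‖z r‖ + 1) ∂ν := by
    refine norm_integral_le_of_norm_le
      (integrable_of_continuous (by fun_prop)).integrableOn (Eventually.of_forall fun r => ?_)
    exact (hF.norm_le _ _).trans (le_of_eq (by ring))
  have h := norm_add_le x (∫ r in Set.Iio t, F (z r) (θ r) ∂ν)
  rw [← hz] at h
  linarith

theorem norm_state_le (hT : IsTimeScale E ν τ) (hF : Activation F A D C) {θ : C(T, W)}
    {x : E} {K : ℝ} (hK : 0 ≤ K) (hx : ‖x‖ ≤ R) (hθ : ∫ r, ‖θ r‖ ^ 2 ∂ν ≤ K) (t : T) :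
    ‖state ν F θ x t‖ + 1 ≤ stateBound C R K := by
  have hC := hF.pos
  have hR : 0 ≤ R := (norm_nonneg _).trans hx
  refine (norm_state_le_aux hT hF hK hx hθ t).trans ?_
  have h1 : 0 ≤ 2 * (R + 1) * Real.exp (2 * (2 * C ^ 2 * (K + 1))) := by positivity
  have h2 : 0 ≤ 2 * C ^ 2 * (K + 1) := by positivity
  have := mul_nonneg h1 h2
  unfold stateBound
  linarith

/-- On a grid the terminal value is not a value of the state, so its integral is estimated directly;
`a ≤ 1 + a²` reduces it to the mean square. This accounts for the first summand and the last factor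
in `stateBound`. -/
theorem norm_finalState_le (hT : IsTimeScale E ν τ) (hF : Activation F A D C) {θ : C(T, W)}
    {x : E} {K : ℝ} (hK : 0 ≤ K) (hx : ‖x‖ ≤ R) (hθ : ∫ r, ‖θ r‖ ^ 2 ∂ν ≤ K) :
    ‖finalState ν F θ x‖ + 1 ≤ stateBound C R K := by
  have hC := hF.pos
  have hR : 0 ≤ R := (norm_nonneg _).trans hx
  set B₀ := 2 * (R + 1) * Real.exp (2 * (2 * C ^ 2 * (K + 1))) with hB₀
  have hB₀' : 0 ≤ B₀ := by positivity
  set z := state ν F θ x with hz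
  have hsq := integral_sq_norm_add_one_le hC θ hθ
  have hle : ‖∫ r, F (z r) (θ r) ∂ν‖ ≤ ∫ r, B₀ * (1 + (C * (‖θ r‖ + 1)) ^ 2) ∂ν := by
    refine norm_integral_le_of_norm_le
      (integrable_of_continuous (by fun_prop)) (Eventually.of_forall fun r => ?_)
    have h1 : ‖z r‖ + 1 ≤ B₀ := norm_state_le_aux hT hF hK hx hθ r
    have h2 : C * (‖θ r‖ + 1) ≤ 1 + (C * (‖θ r‖ + 1)) ^ 2 := by
      nlinarith [sq_nonneg (C * (‖θ r‖ + 1) - 1), sq_nonneg (C * (‖θ r‖ + 1))]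
    calc ‖F (z r) (θ r)‖ ≤ (‖z r‖ + 1) * (C * (‖θ r‖ + 1)) :=
          (hF.norm_le _ _).trans (le_of_eq (by ring))
      _ ≤ _ := by gcongr
  rw [integral_const_mul, integral_add (integrable_const _)
    (integrable_of_continuous (by fun_prop))] at hle
  simp only [integral_const, probReal_univ, smul_eq_mul, one_mul] at hle
  have h := norm_add_le x (∫ r, F (z r) (θ r) ∂ν)
  have h3 : B₀ * (1 + ∫ r, (C * (‖θ r‖ + 1)) ^ 2 ∂ν) ≤ B₀ * (1 + 2 * C ^ 2 * (K + 1)) := by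
    gcongr
  have h4 : finalState ν F θ x = x + ∫ r, F (z r) (θ r) ∂ν := rfl
  unfold stateBound
  rw [h4]
  linarith

theorem norm_adj_le (hT : IsTimeScale E ν τ) (hF : Activation F A D C) (hℓ : IsLoss ℓ b R C)
    {θ : C(T, W)} {x : E} {K : ℝ} (hK : 0 ≤ K) (hx : ‖x‖ ≤ R) (hθ : ∫ r, ‖θ r‖ ^ 2 ∂ν ≤ K)
    (t : T) : ‖adj ν F A b θ x t‖ ≤ adjBound C R K := by
  have hC := hF.pos
  have hB := one_le_stateBound C hℓ.radius_nonneg hK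
  set q := adj ν F A b θ x
  refine hT.backward.gronwall_sq (κ := fun r => C * (‖θ r‖ + 1)) (u := fun r => ‖q r‖)
    (by fun_prop) (by fun_prop) (by positivity) (by positivity) (fun t => by positivity)
    (integral_sq_norm_add_one_le hC θ hθ) (fun t => ?_) t
  have hq := isAdjoint_adj (b := b) hT hF θ x t
  have hle : ‖∫ r in Set.Ioi t, (A (state ν F θ x r) (θ r)).adjoint (q r) ∂ν‖
      ≤ ∫ r in Set.Ioi t, C * (‖θ r‖ + 1) * ‖q r‖ ∂ν := by
    refine norm_integral_le_of_norm_le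
      (integrable_of_continuous (by fun_prop)).integrableOn (Eventually.of_forall fun r => ?_)
    refine (norm_adjoint_apply_le _ _).trans ?_
    gcongr
    exact (hF.norm_A_le _ _).trans (by gcongr; linarith)
  have hb : ‖b x (finalState ν F θ x)‖ ≤ C * stateBound C R K := by
    refine (hℓ.norm_grad_le _ _ hx).trans ?_
    have := norm_finalState_le hT hF hK hx hθ
    gcongr
    linarith
  have h := norm_add_le (b x (finalState ν F θ x))
    (∫ r in Set.Ioi t, (A (state ν F θ x r) (θ r)).adjoint (q r) ∂ν)
  rw [← hq] at h
  exact h.trans (add_le_add hb hle)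

/-- Stability of the forward equation, the second one being solved up to `e`. -/
theorem norm_state_sub_le (hT : IsTimeScale E ν τ) (hF : Activation F A D C) {θ θ' : C(T, W)}
    {z z' : T → E} (hz : Continuous z) (hz' : Continuous z') {K B η e : ℝ} (hK : 0 < K)
    (hη : 0 ≤ η) (he : 0 ≤ e) (hB : 0 ≤ B) (hθ : ∀ t, ‖θ t‖ ≤ K) (hzB : ∀ t, ‖z' t‖ + 1 ≤ B)
    (hθη : ∀ t, ‖θ t - θ' t‖ ≤ η)
    (hres : ∀ t, ‖(z t - ∫ r in Set.Iio t, F (z r) (θ r) ∂ν)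
      - (z' t - ∫ r in Set.Iio t, F (z' r) (θ' r) ∂ν)‖ ≤ e) (t : T) :
    ‖z t - z' t‖ ≤ 2 * (e + C * B * η) * Real.exp (2 * (C * K)) := by
  have hC := hF.pos
  refine hT.forward.norm_sub_le (φ := fun r u => F u (θ r)) (φ' := fun r u => F u (θ' r)) hz hz'
    (hF.continuous_comp hz θ) (hF.continuous_comp hz' θ') he (by positivity) (by positivity)
    (fun r => ?_) (fun r => ?_) hres t
  · refine (hF.norm_sub_state _ _ _).trans ?_
    gcongr
    exact hθ r
  · refine (hF.norm_sub_param _ _ _).trans ?_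
    gcongr
    · exact hzB r
    · exact hθη r

theorem norm_integral_sub_le (hF : Activation F A D C) {θ θ' : C(T, W)}
    {z z' : T → E} (hz : Continuous z) (hz' : Continuous z') {K B η δ : ℝ}
    (hB : 0 ≤ B) (hθ : ∀ t, ‖θ t‖ ≤ K) (hzB : ∀ t, ‖z' t‖ + 1 ≤ B)
    (hθη : ∀ t, ‖θ t - θ' t‖ ≤ η) (hzδ : ∀ t, ‖z t - z' t‖ ≤ δ) :
    ‖(∫ r, F (z r) (θ r) ∂ν) - ∫ r, F (z' r) (θ' r) ∂ν‖ ≤ C * K * δ + C * B * η := by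
  have hC := hF.pos
  rw [← integral_sub (integrable_of_continuous (hF.continuous_comp hz θ))
    (integrable_of_continuous (hF.continuous_comp hz' θ'))]
  refine norm_integral_le_of_forall_le fun r => (hF.norm_sub_le (hzB r) (hθ r)).trans ?_
  have hK : 0 ≤ K := (norm_nonneg _).trans (hθ r)
  gcongr
  · exact hzδ r
  · exact hθη r

/-- Stability of the adjoint equation, the second one being solved up to `e`. -/
theorem norm_adj_sub_le (hT : IsTimeScale E ν τ) (hF : Activation F A D C) {θ θ' : C(T, W)}
    {z z' q q' : T → E} (hz : Continuous z) (hz' : Continuous z') (hq : Continuous q)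
    (hq' : Continuous q') {K B Q η δ e : ℝ} (hK : 0 < K) (hη : 0 ≤ η) (he : 0 ≤ e) (hB : 0 ≤ B)
    (hQ : 0 ≤ Q) (hδ : 0 ≤ δ)
    (hθ : ∀ t, ‖θ t‖ ≤ K) (hθ' : ∀ t, ‖θ' t‖ ≤ K) (hzB : ∀ t, ‖z' t‖ + 1 ≤ B)
    (hqQ : ∀ t, ‖q' t‖ ≤ Q) (hzδ : ∀ t, ‖z t - z' t‖ ≤ δ) (hθη : ∀ t, ‖θ t - θ' t‖ ≤ η)
    (hres : ∀ t, ‖(q t - ∫ r in Set.Ioi t, (A (z r) (θ r)).adjoint (q r) ∂ν)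
      - (q' t - ∫ r in Set.Ioi t, (A (z' r) (θ' r)).adjoint (q' r) ∂ν)‖ ≤ e) (t : T) :
    ‖q t - q' t‖ ≤ 2 * (e + (C * K ^ 2 * δ + C * (2 * K) * B * η) * Q)
      * Real.exp (2 * (C * K)) := by
  have hC := hF.pos
  refine hT.backward.norm_sub_le (φ := fun r u => (A (z r) (θ r)).adjoint u)
    (φ' := fun r u => (A (z' r) (θ' r)).adjoint u) hq hq'
    (hF.continuous_adjoint_A_comp hz hq θ) (hF.continuous_adjoint_A_comp hz' hq' θ') he
    (by positivity) (by positivity) (fun r => ?_) (fun r => ?_) hres t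
  · rw [← map_sub]
    refine (norm_adjoint_apply_le _ _).trans ?_
    gcongr
    refine (hF.norm_A_le _ _).trans ?_
    gcongr
    exact hθ r
  · have : (A (z r) (θ r)).adjoint (q' r) - (A (z' r) (θ' r)).adjoint (q' r)
        = (A (z r) (θ r) - A (z' r) (θ' r)).adjoint (q' r) := by
      simp only [map_sub, sub_apply]
    rw [this]
    refine (norm_adjoint_apply_le _ _).trans ?_
    gcongr
    · refine (hF.norm_A_sub_le (hzB r) (hθ r) (hθ' r)).trans ?_
      gcongr
      · exact hzδ r
      · exact hθη r
    · exact hqQ r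

/-- Stability with zero perturbation. It identifies concrete network trajectories with the choice
made by `Classical.epsilon` in `state`. -/
theorem eq_state (hT : IsTimeScale E ν τ) (hF : Activation F A D C) {θ : C(T, W)} {x : E}
    {z : C(T, E)} (hz : IsState ν F θ x z) : z = state ν F θ x := by
  obtain ⟨K, hK, hθ⟩ := exists_norm_le_of_continuous θ.continuous
  obtain ⟨B, hB, hzB⟩ := exists_norm_le_of_continuous (state ν F θ x).continuous
  ext1 t
  have h := norm_state_sub_le hT hF z.continuous (state ν F θ x).continuous hK le_rfl le_rfl
    (by positivity : 0 ≤ B + 1) hθ (fun t => by linarith [hzB t]) (θ' := θ) (fun t => by simp)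
    (fun t => by
      nth_rw 1 [hz t, isState_state hT hF θ x t]; simp) t
  simp only [mul_zero, add_zero, zero_mul] at h
  exact sub_eq_zero.1 (norm_le_zero_iff.1 h)

end TimeScale

/-! ### The loss and its gradient on a general time scale -/

section Gradient

variable {T : Type} [TopologicalSpace T] [CompactSpace T] [LinearOrder T] [MeasurableSpace T]
  [BorelSpace T]
  {E : Type*} [NormedAddCommGroup E] [InnerProductSpace ℝ E] [CompleteSpace E]
  {W : Type*} [NormedAddCommGroup W] [InnerProductSpace ℝ W] [CompleteSpace W]
  {ν : Measure T} [IsProbabilityMeasure ν] {τ : T → ℝ} {F : E → W → E}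
  {A : E → W → E →L[ℝ] E} {D : E → W → W →L[ℝ] E} {C : ℝ} {ℓ : E → E → ℝ} {b : E → E → E} {R : ℝ}

/-- The residuals of the two states are the inputs `x` and `x'`, so the residual bound of
`norm_state_sub_le` is `‖x - x'‖`. The same slot later receives quadrature errors. -/
theorem norm_state_sub_le_of_input (hT : IsTimeScale E ν τ) (hF : Activation F A D C) {θ : C(T, W)}
    {K : ℝ} (hK : 0 < K) (hθ : ∀ t, ‖θ t‖ ≤ K) (x x' : E) (t : T) :
    ‖state ν F θ x t - state ν F θ x' t‖ ≤ 2 * ‖x - x'‖ * Real.exp (2 * (C * K)) := by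
  obtain ⟨B, hB, hzB⟩ := exists_norm_le_of_continuous (state ν F θ x').continuous
  have h := norm_state_sub_le hT hF (state ν F θ x).continuous (state ν F θ x').continuous hK
    le_rfl (norm_nonneg (x - x')) (by positivity : 0 ≤ B + 1) hθ (fun t => by linarith [hzB t])
    (θ' := θ) (fun t => by simp) (fun t => by
      nth_rw 1 [isState_state hT hF θ x t, isState_state hT hF θ x' t]; simp) t
  simpa using h

theorem continuous_state (hT : IsTimeScale E ν τ) (hF : Activation F A D C) (θ : C(T, W)) :
    Continuous fun x => state ν F θ x := by
  obtain ⟨K, hK, hθ⟩ := exists_norm_le_of_continuous θ.continuous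
  refine (LipschitzWith.of_dist_le' (K := 2 * Real.exp (2 * (C * K))) fun x x' => ?_).continuous
  rw [ContinuousMap.dist_le (by positivity)]
  intro t
  rw [dist_eq_norm, dist_eq_norm]
  exact (norm_state_sub_le_of_input hT hF hK hθ x x' t).trans (le_of_eq (by ring))

theorem continuous_finalState (hT : IsTimeScale E ν τ) (hF : Activation F A D C) (θ : C(T, W)) :
    Continuous fun x => finalState ν F θ x := by
  obtain ⟨K, hK, hθ⟩ := exists_norm_le_of_continuous θ.continuous
  have hC := hF.pos
  refine (LipschitzWith.of_dist_le' (K := 1 + C * K * (2 * Real.exp (2 * (C * K))))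
    fun x x' => ?_).continuous
  obtain ⟨B, hB, hzB⟩ := exists_norm_le_of_continuous (state ν F θ x').continuous
  have h := norm_integral_sub_le (ν := ν) hF (state ν F θ x).continuous (state ν F θ x').continuous
    (by positivity : 0 ≤ B + 1) hθ (fun t => by linarith [hzB t]) (θ' := θ) (η := 0)
    (fun t => by simp) (norm_state_sub_le_of_input hT hF hK hθ x x')
  rw [dist_eq_norm, dist_eq_norm, finalState, finalState, add_sub_add_comm]
  exact ((norm_add_le _ _).trans (add_le_add le_rfl h)).trans (le_of_eq (by ring))

/-- The terminal value `b x (finalState x)` is only continuous in `x`, not Lipschitz. Continuity is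
therefore proved at one point `x'` at a time, with bounds `B` and `Q` that belong to `x'`. -/
theorem continuous_adj (hT : IsTimeScale E ν τ) (hF : Activation F A D C) (hℓ : IsLoss ℓ b R C)
    (θ : C(T, W)) : Continuous fun x => adj ν F A b θ x := by
  obtain ⟨K, hK, hθ⟩ := exists_norm_le_of_continuous θ.continuous
  have hC := hF.pos
  rw [continuous_iff_continuousAt]
  intro x'
  obtain ⟨B, hB, hzB⟩ := exists_norm_le_of_continuous (state ν F θ x').continuous
  obtain ⟨Q, hQ, hqQ⟩ := exists_norm_le_of_continuous (adj ν F A b θ x').continuous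
  have hb : Continuous fun x => b x (finalState ν F θ x) :=
    hℓ.continuous_grad.comp (continuous_id.prodMk (continuous_finalState hT hF θ))
  have hbd : ∀ x, dist (adj ν F A b θ x) (adj ν F A b θ x')
      ≤ 2 * (‖b x (finalState ν F θ x) - b x' (finalState ν F θ x')‖
        + (C * K ^ 2 * (2 * ‖x - x'‖ * Real.exp (2 * (C * K)))) * Q)
        * Real.exp (2 * (C * K)) := fun x => by
    rw [ContinuousMap.dist_le (by positivity)]
    intro t
    rw [dist_eq_norm]
    have h := norm_adj_sub_le hT hF (state ν F θ x).continuous (state ν F θ x').continuous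
      (adj ν F A b θ x).continuous (adj ν F A b θ x').continuous hK le_rfl
      (norm_nonneg (b x (finalState ν F θ x) - b x' (finalState ν F θ x')))
      (by positivity : 0 ≤ B + 1) hQ.le (by positivity) hθ hθ (fun t => by linarith [hzB t]) hqQ
      (norm_state_sub_le_of_input hT hF hK hθ x x') (fun t => by simp) (fun t => by
        nth_rw 1 [isAdjoint_adj hT hF θ x t, isAdjoint_adj hT hF θ x' t]; simp) t
    simpa using h
  rw [ContinuousAt, tendsto_iff_dist_tendsto_zero]
  refine squeeze_zero (fun _ => dist_nonneg) hbd ?_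
  have : Continuous fun x => 2 * (‖b x (finalState ν F θ x) - b x' (finalState ν F θ x')‖
        + (C * K ^ 2 * (2 * ‖x - x'‖ * Real.exp (2 * (C * K)))) * Q)
        * Real.exp (2 * (C * K)) :=
    (continuous_const.mul ((hb.sub continuous_const).norm.add (by fun_prop))).mul continuous_const
  simpa using this.tendsto x'

/-- The integrand of the gradient of the loss. -/
def gradIntegrand (ν : Measure T) (F : E → W → E) (A : E → W → E →L[ℝ] E) (D : E → W → W →L[ℝ] E)
    (b : E → E → E) (θ : C(T, W)) (x : E) (t : T) : W :=
  (D (state ν F θ x t) (θ t)).adjoint (adj ν F A b θ x t)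

theorem continuous_gradIntegrand (hT : IsTimeScale E ν τ) (hF : Activation F A D C)
    (hℓ : IsLoss ℓ b R C) (θ : C(T, W)) :
    Continuous fun p : E × T => gradIntegrand ν F A D b θ p.1 p.2 := by
  have hz : Continuous fun p : E × T => state ν F θ p.1 p.2 :=
    ((continuous_state hT hF θ).comp continuous_fst).eval continuous_snd
  have hq : Continuous fun p : E × T => adj ν F A b θ p.1 p.2 :=
    ((continuous_adj hT hF hℓ θ).comp continuous_fst).eval continuous_snd
  have hD : Continuous fun p : E × T => D (state ν F θ p.1 p.2) (θ p.2) :=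
    hF.continuous_D.comp (hz.prodMk (θ.continuous.comp continuous_snd))
  exact (ContinuousLinearMap.adjoint.continuous.comp hD).clm_apply hq

theorem norm_gradIntegrand_le (hT : IsTimeScale E ν τ) (hF : Activation F A D C)
    (hℓ : IsLoss ℓ b R C) {θ : C(T, W)} {x : E} {K : ℝ} (hK : 0 ≤ K) (hx : ‖x‖ ≤ R)
    (hθ : ∫ r, ‖θ r‖ ^ 2 ∂ν ≤ K) (t : T) :
    ‖gradIntegrand ν F A D b θ x t‖ ≤ C * stateBound C R K * adjBound C R K := by
  have hC := hF.pos
  have hB := one_le_stateBound C hℓ.radius_nonneg hK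
  refine (norm_adjoint_apply_le _ _).trans ?_
  gcongr
  · exact (hF.norm_D_le _ _).trans (by gcongr; exact norm_state_le hT hF hK hx hθ t)
  · exact norm_adj_le hT hF hℓ hK hx hθ t

theorem integral_sq_norm_le {K : ℝ} {θ : T → W} (hθ : ∀ t, ‖θ t‖ ≤ K) :
    ∫ r, ‖θ r‖ ^ 2 ∂ν ≤ K ^ 2 := by
  refine (Real.le_norm_self _).trans (norm_integral_le_of_forall_le (ν := ν) fun t => ?_)
  rw [Real.norm_of_nonneg (by positivity)]
  exact pow_le_pow_left₀ (norm_nonneg _) (hθ t) 2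

/-- States and adjoint states are Lipschitz functions of bounded parameters. -/
theorem exists_lipschitz (hT : IsTimeScale E ν τ) (hF : Activation F A D C) (hℓ : IsLoss ℓ b R C)
    {K : ℝ} (hK : 0 < K) : ∃ c, 0 ≤ c ∧ ∀ θ θ' : C(T, W), (∀ t, ‖θ t‖ ≤ K) → (∀ t, ‖θ' t‖ ≤ K) →
      ∀ x, ‖x‖ ≤ R → (∀ t, ‖state ν F θ x t - state ν F θ' x t‖ ≤ c * ‖θ - θ'‖) ∧
        ‖finalState ν F θ x - finalState ν F θ' x‖ ≤ c * ‖θ - θ'‖ ∧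
        ∀ t, ‖adj ν F A b θ x t - adj ν F A b θ' x t‖ ≤ c * ‖θ - θ'‖ := by
  have hC := hF.pos
  have hR := hℓ.radius_nonneg
  set B := stateBound C R (K ^ 2)
  have hB : 0 ≤ B := zero_le_one.trans (one_le_stateBound C hR (by positivity))
  set Q := adjBound C R (K ^ 2)
  have hQ : 0 ≤ Q := adjBound_nonneg hC.le hR (by positivity)
  set e := Real.exp (2 * (C * K))
  -- Lipschitz constants of the state, the terminal state and the adjoint state; each comes from the
  -- preceding ones through a stability estimate.
  set c₁ := 2 * (C * B) * e with hc₁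
  set c₂ := C * K * c₁ + C * B with hc₂
  set c₃ := 2 * (C * (2 * B) * c₂ + (C * K ^ 2 * c₁ + C * (2 * K) * B) * Q) * e with hc₃
  have h₁ : 0 ≤ c₁ := by positivity
  have h₂ : 0 ≤ c₂ := by positivity
  have h₃ : 0 ≤ c₃ := by positivity
  refine ⟨c₁ + c₂ + c₃, by positivity, fun θ θ' hθ hθ' x hx => ?_⟩
  set η := ‖θ - θ'‖ with hηdef
  have hη : 0 ≤ η := norm_nonneg _
  have hθη : ∀ t, ‖θ t - θ' t‖ ≤ η := fun t => (θ - θ').norm_coe_le_norm t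
  have hI := integral_sq_norm_le (ν := ν) hθ
  have hI' := integral_sq_norm_le (ν := ν) hθ'
  have hzB := norm_state_le hT hF (by positivity) hx hI'
  have hz : ∀ t, ‖state ν F θ x t - state ν F θ' x t‖ ≤ c₁ * η := fun t => by
    have h := norm_state_sub_le hT hF (state ν F θ x).continuous (state ν F θ' x).continuous hK
      hη le_rfl hB hθ hzB hθη (fun t => by
        nth_rw 1 [isState_state hT hF θ x t, isState_state hT hF θ' x t]; simp) t
    exact h.trans (le_of_eq (by rw [hc₁]; ring))
  have hf : ‖finalState ν F θ x - finalState ν F θ' x‖ ≤ c₂ * η := by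
    rw [finalState, finalState, add_sub_add_left_eq_sub]
    exact (norm_integral_sub_le hF (state ν F θ x).continuous (state ν F θ' x).continuous
      hB hθ hzB hθη hz).trans (le_of_eq (by rw [hc₂]; ring))
  have hb : ‖b x (finalState ν F θ x) - b x (finalState ν F θ' x)‖ ≤ C * (2 * B) * (c₂ * η) := by
    refine (hℓ.norm_grad_sub_le _ _ _ hx).trans ?_
    have h1 := norm_finalState_le hT hF (by positivity) hx hI
    have h2 := norm_finalState_le hT hF (by positivity) hx hI'
    gcongr
    linarith
  have hq : ∀ t, ‖adj ν F A b θ x t - adj ν F A b θ' x t‖ ≤ c₃ * η := fun t => by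
    have h := norm_adj_sub_le hT hF (state ν F θ x).continuous (state ν F θ' x).continuous
      (adj ν F A b θ x).continuous (adj ν F A b θ' x).continuous hK hη
      (by positivity : 0 ≤ C * (2 * B) * (c₂ * η)) hB hQ (by positivity) hθ hθ' hzB
      (norm_adj_le hT hF hℓ (by positivity) hx hI') hz hθη (fun t => by
        nth_rw 1 [isAdjoint_adj hT hF θ x t, isAdjoint_adj hT hF θ' x t]; simpa using hb) t
    exact h.trans (le_of_eq (by rw [hc₃]; ring))
  refine ⟨fun t => (hz t).trans ?_, hf.trans ?_, fun t => (hq t).trans ?_⟩ <;> gcongr <;> linarith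

variable [SecondCountableTopology T] [OrderClosedTopology T]

/-- Fubini on the triangle `{t < r}`. Both orders are strict, so the diagonal, which is charged by
the grid measure, enters neither side. This is the summation by parts behind the adjoint method. -/
theorem integral_inner_integral_Ioi {v w : T → E} (hv : Continuous v) (hw : Continuous w) :
    ∫ t, inner ℝ (∫ r in Set.Ioi t, v r ∂ν) (w t) ∂ν
      = ∫ r, inner ℝ (v r) (∫ t in Set.Iio r, w t ∂ν) ∂ν := by
  let f : T → T → ℝ := fun t r => if t < r then inner ℝ (v r) (w t) else 0
  have h1 : ∀ t, inner ℝ (∫ r in Set.Ioi t, v r ∂ν) (w t) = ∫ r, f t r ∂ν := fun t => by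
    rw [real_inner_comm, ← integral_inner (integrable_of_continuous hv).integrableOn,
      ← integral_indicator measurableSet_Ioi]
    refine integral_congr_ae (Eventually.of_forall fun r => ?_)
    simp only [Set.indicator_apply, Set.mem_Ioi, f, real_inner_comm]
  have h2 : ∀ r, inner ℝ (v r) (∫ t in Set.Iio r, w t ∂ν) = ∫ t, f t r ∂ν := fun r => by
    rw [← integral_inner (integrable_of_continuous hw).integrableOn,
      ← integral_indicator measurableSet_Iio]
    refine integral_congr_ae (Eventually.of_forall fun t => ?_)
    simp only [Set.indicator_apply, Set.mem_Iio, f]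
  simp only [h1, h2]
  refine integral_integral_swap ?_
  have hc : Continuous fun p : T × T => (inner ℝ (v p.2) (w p.1) : ℝ) := by fun_prop
  have hm : MeasurableSet {p : T × T | p.1 < p.2} := measurableSet_lt measurable_fst measurable_snd
  have := (integrable_of_continuous (ν := ν.prod ν) hc).indicator hm
  refine this.congr (Eventually.of_forall fun p => ?_)
  simp only [Set.indicator_apply, Set.mem_ofPred_eq, f, Function.uncurry]

/-- First order expansion of the loss at a fixed input, with quadratic remainder. -/
theorem exists_loss_taylor (hT : IsTimeScale E ν τ) (hF : Activation F A D C)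
    (hℓ : IsLoss ℓ b R C) {K : ℝ} (hK : 0 < K) :
    ∃ c, 0 ≤ c ∧ ∀ θ θ' : C(T, W), (∀ t, ‖θ t‖ ≤ K) → (∀ t, ‖θ' t‖ ≤ K) → ∀ x, ‖x‖ ≤ R →
      |ℓ x (finalState ν F θ' x) - ℓ x (finalState ν F θ x)
        - ∫ t, inner ℝ (gradIntegrand ν F A D b θ x t) ((θ' - θ) t) ∂ν| ≤ c * ‖θ' - θ‖ ^ 2 := by
  have hC := hF.pos
  have hR := hℓ.radius_nonneg
  obtain ⟨c, hc, hlip⟩ := exists_lipschitz (ν := ν) hT hF hℓ hK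
  set B := stateBound C R (K ^ 2)
  have hB : 0 ≤ B := zero_le_one.trans (one_le_stateBound C hR (by positivity))
  set Q := adjBound C R (K ^ 2)
  have hQ : 0 ≤ Q := adjBound_nonneg hC.le hR (by positivity)
  refine ⟨C * (2 * B) * c ^ 2 + Q * (C * (K * c + B) ^ 2), by positivity,
    fun θ θ' hθ hθ' x hx => ?_⟩
  obtain ⟨hz, hf, -⟩ := hlip θ' θ hθ' hθ x hx
  set η := ‖θ' - θ‖ with hηdef
  have hη : 0 ≤ η := norm_nonneg _
  have hI := integral_sq_norm_le (ν := ν) hθ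
  have hI' := integral_sq_norm_le (ν := ν) hθ'
  set z := state ν F θ x
  set z' := state ν F θ' x
  set q := adj ν F A b θ x
  set p := b x (finalState ν F θ x)
  let w : T → E := fun r => F (z' r) (θ' r) - F (z r) (θ r)
  have hw : Continuous w :=
    (hF.continuous_comp z'.continuous θ').sub (hF.continuous_comp z.continuous θ)
  have hδ : ∀ t, z' t - z t = ∫ r in Set.Iio t, w r ∂ν := fun t => by
    rw [integral_sub (integrable_of_continuous (hF.continuous_comp z'.continuous θ')).integrableOn
      (integrable_of_continuous (hF.continuous_comp z.continuous θ)).integrableOn,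
      isState_state hT hF θ x t, isState_state hT hF θ' x t]
    exact add_sub_add_left_eq_sub _ _ _
  have hδe : finalState ν F θ' x - finalState ν F θ x = ∫ r, w r ∂ν := by
    rw [integral_sub (integrable_of_continuous (hF.continuous_comp z'.continuous θ'))
      (integrable_of_continuous (hF.continuous_comp z.continuous θ))]
    exact add_sub_add_left_eq_sub _ _ _
  let v : T → E := fun r => (A (z r) (θ r)).adjoint (q r)
  have hv : Continuous v := hF.continuous_adjoint_A_comp z.continuous q.continuous θ
  -- Insert the adjoint equation for `q` and exchange the order of integration: the past integral of
  -- `w` is again `z' - z`.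
  have hdual : ∫ t, inner ℝ (q t) (w t) ∂ν
      = inner ℝ p (∫ r, w r ∂ν) + ∫ r, inner ℝ (q r) (A (z r) (θ r) (z' r - z r)) ∂ν := by
    have h1 : ∀ t, (inner ℝ (q t) (w t) : ℝ)
        = inner ℝ p (w t) + inner ℝ (∫ r in Set.Ioi t, v r ∂ν) (w t) := fun t => by
      rw [← inner_add_left]
      congr 1
      exact isAdjoint_adj hT hF θ x t
    have hcv : Continuous fun t => ∫ r in Set.Ioi t, v r ∂ν :=
      hT.backward.continuous_integral v hv
    simp only [h1]
    rw [integral_add (integrable_of_continuous (by fun_prop))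
      (integrable_of_continuous (by fun_prop)),
      integral_inner (integrable_of_continuous hw), integral_inner_integral_Ioi hv hw]
    congr 1
    refine integral_congr_ae (Eventually.of_forall fun r => ?_)
    simp only [v, ← hδ, ContinuousLinearMap.adjoint_inner_left]
  have hAc : Continuous fun r => A (z r) (θ r) (z' r - z r) :=
    (hF.continuous_A_comp z.continuous θ).clm_apply (by fun_prop)
  have hDc : Continuous fun r => D (z r) (θ r) (θ' r - θ r) :=
    (hF.continuous_D_comp z.continuous θ).clm_apply (by fun_prop)
  -- The remainder of the first order expansion of `F` along the two trajectories, quadratic in `η`.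
  let ρ : T → E := fun r => w r - A (z r) (θ r) (z' r - z r) - D (z r) (θ r) (θ' r - θ r)
  have hρ : ∀ r, ‖(inner ℝ (q r) (ρ r) : ℝ)‖ ≤ Q * (C * (K * c + B) ^ 2 * η ^ 2) := fun r => by
    refine (norm_inner_le_norm _ _).trans ?_
    have h1 : ‖ρ r‖ ≤ C * (K * c + B) ^ 2 * η ^ 2 := by
      refine (hF.norm_taylor_le (norm_state_le hT hF (by positivity) hx hI r) (hθ r)
        (hθ' r)).trans ?_
      calc C * (K * ‖z' r - z r‖ + B * ‖θ' r - θ r‖) ^ 2 ≤ C * (K * (c * η) + B * η) ^ 2 := by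
            gcongr
            · exact hz r
            · exact (θ' - θ).norm_coe_le_norm r
        _ = _ := by ring
    have h2 : ‖q r‖ ≤ Q := norm_adj_le hT hF hℓ (by positivity) hx hI r
    gcongr
  -- The terms with `A` cancel against those in `hdual`, so the unknown variation of the state
  -- disappears and only the parameter derivative `D` remains.
  have hmain : (inner ℝ p (finalState ν F θ' x - finalState ν F θ x) : ℝ)
      = (∫ t, inner ℝ (gradIntegrand ν F A D b θ x t) ((θ' - θ) t) ∂ν)
        + ∫ r, inner ℝ (q r) (ρ r) ∂ν := by
    have h1 : ∀ t, (inner ℝ (gradIntegrand ν F A D b θ x t) ((θ' - θ) t) : ℝ)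
        = inner ℝ (q t) (D (z t) (θ t) (θ' t - θ t)) := fun t => by
      rw [gradIntegrand, ContinuousLinearMap.adjoint_inner_left]; rfl
    have h2 : ∀ r, (inner ℝ (q r) (ρ r) : ℝ) = inner ℝ (q r) (w r)
        - inner ℝ (q r) (A (z r) (θ r) (z' r - z r))
        - inner ℝ (q r) (D (z r) (θ r) (θ' r - θ r)) := fun r => by
      simp only [ρ, inner_sub_right]
    simp only [h1, h2]
    have hqw : Continuous fun r => (inner ℝ (q r) (w r) : ℝ) := by fun_prop
    have hqA : Continuous fun r => (inner ℝ (q r) (A (z r) (θ r) (z' r - z r)) : ℝ) :=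
      q.continuous.inner hAc
    have hqD : Continuous fun r => (inner ℝ (q r) (D (z r) (θ r) (θ' r - θ r)) : ℝ) :=
      q.continuous.inner hDc
    have hi : Integrable (fun r => (inner ℝ (q r) (w r) : ℝ)
        - inner ℝ (q r) (A (z r) (θ r) (z' r - z r))) ν := integrable_of_continuous (hqw.sub hqA)
    rw [integral_sub hi (integrable_of_continuous hqD),
      integral_sub (integrable_of_continuous hqw) (integrable_of_continuous hqA), hdual, hδe]
    ring
  have ht := hℓ.taylor x (finalState ν F θ x) (finalState ν F θ' x) hx
  have hb1 := norm_finalState_le hT hF (by positivity) hx hI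
  have hb2 := norm_finalState_le hT hF (by positivity) hx hI'
  have ht' : |ℓ x (finalState ν F θ' x) - ℓ x (finalState ν F θ x)
      - inner ℝ p (finalState ν F θ' x - finalState ν F θ x)| ≤ C * (2 * B) * (c * η) ^ 2 := by
    refine ht.trans ?_
    gcongr
    linarith
  have hρ' : |∫ r, inner ℝ (q r) (ρ r) ∂ν| ≤ Q * (C * (K * c + B) ^ 2 * η ^ 2) :=
    norm_integral_le_of_forall_le hρ
  rw [hmain] at ht'
  rw [abs_le] at ht' hρ' ⊢
  constructor <;> nlinarith [ht'.1, ht'.2, hρ'.1, hρ'.2]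

end Gradient

/-! ### Gradient flows on a general time scale -/

/-- The flows are differentiable only for `s > 0`, so Gronwall is applied on `[a, s]` and `a` tends
to `0` by continuity. The condition `1 ≤ K` serves to replace `ε / K` by `ε`. -/
theorem norm_le_mul_exp_of_norm_deriv_le {V : Type*} [NormedAddCommGroup V] [NormedSpace ℝ V]
    {f f' : ℝ → V} {K ε S : ℝ} (hK : 1 ≤ K) (hε : 0 ≤ ε) (hf : ContinuousOn f (Set.Ici 0))
    (hf' : ∀ s, 0 < s → HasDerivAt f (f' s) s)
    (hle : ∀ s, 0 < s → s < S → ‖f' s‖ ≤ K * ‖f s‖ + ε) {s : ℝ} (hs : 0 ≤ s) (hsS : s < S) :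
    ‖f s‖ ≤ (‖f 0‖ + ε) * Real.exp (K * s) := by
  rcases hs.eq_or_lt with rfl | hs
  · simpa using hε
  have h1 : ∀ a ∈ Set.Ioo 0 s, ‖f s‖ ≤ (‖f a‖ + ε) * Real.exp (K * (s - a)) := fun a ha => by
    have h := norm_le_gronwallBound_of_norm_deriv_right_le (f := f) (f' := f') (δ := ‖f a‖) (K := K)
      (ε := ε) (a := a) (b := s) (hf.mono fun r hr => ha.1.le.trans hr.1)
      (fun r hr => (hf' r (ha.1.trans_le hr.1)).hasDerivWithinAt) le_rfl
      (fun r hr => hle r (ha.1.trans_le hr.1) (hr.2.trans hsS)) s ⟨ha.2.le, le_rfl⟩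
    rw [gronwallBound_of_K_ne_0 (by positivity)] at h
    refine h.trans ?_
    have h2 : 0 ≤ Real.exp (K * (s - a)) - 1 := by
      have := Real.add_one_le_exp (K * (s - a))
      have : 0 ≤ K * (s - a) := mul_nonneg (by linarith) (by linarith [ha.2])
      linarith
    have h3 : ε / K ≤ ε := div_le_self hε hK
    nlinarith [mul_le_mul_of_nonneg_right h3 h2]
  have hlim : Tendsto (fun a => (‖f a‖ + ε) * Real.exp (K * (s - a))) (𝓝[>] 0)
      (𝓝 ((‖f 0‖ + ε) * Real.exp (K * (s - 0)))) := by
    have hf0 : Tendsto f (𝓝[>] 0) (𝓝 (f 0)) :=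
      (hf 0 (Set.mem_Ici.2 le_rfl)).mono_left (nhdsWithin_mono _ Set.Ioi_subset_Ici_self)
    have he : Continuous fun a => Real.exp (K * (s - a)) := by fun_prop
    exact (hf0.norm.add_const ε).mul ((he.tendsto 0).mono_left nhdsWithin_le_nhds)
  rw [sub_zero] at hlim
  exact ge_of_tendsto hlim (Filter.mem_of_superset (Ioo_mem_nhdsGT hs) h1)

theorem continuous_of_continuous_prod_left {X Y Z : Type*} [TopologicalSpace X]
    [TopologicalSpace Y] [TopologicalSpace Z] {f : X → Y → Z}
    (hf : Continuous fun p : X × Y => f p.1 p.2) (y : Y) : Continuous fun x => f x y := by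
  fun_prop

theorem continuous_of_continuous_prod_right {X Y Z : Type*} [TopologicalSpace X]
    [TopologicalSpace Y] [TopologicalSpace Z] {f : X → Y → Z}
    (hf : Continuous fun p : X × Y => f p.1 p.2) (x : X) : Continuous fun y => f x y := by
  fun_prop

theorem hasDerivAt_bilinear_self {V : Type*} [NormedAddCommGroup V] [NormedSpace ℝ V]
    (L : V →L[ℝ] V →L[ℝ] ℝ) {θ : ℝ → V} {v : V} {s : ℝ} (h : HasDerivAt θ v s) :
    HasDerivAt (fun s => L (θ s) (θ s)) (L v (θ s) + L (θ s) v) s :=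
  (L.hasFDerivAt.comp_hasDerivAt s h).clm_apply h

section Flow

variable {T : Type} [TopologicalSpace T] [CompactSpace T] [LinearOrder T] [MeasurableSpace T]
  [BorelSpace T]
  {E : Type*} [NormedAddCommGroup E] [InnerProductSpace ℝ E] [CompleteSpace E]
  [MeasurableSpace E] [BorelSpace E] [SecondCountableTopology E]
  {W : Type*} [NormedAddCommGroup W] [InnerProductSpace ℝ W] [CompleteSpace W]
  {ν : Measure T} [IsProbabilityMeasure ν] {τ : T → ℝ} {F : E → W → E}
  {A : E → W → E →L[ℝ] E} {D : E → W → W →L[ℝ] E} {C : ℝ} {ℓ : E → E → ℝ} {b : E → E → E} {R : ℝ}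
  {μ : Measure E} [IsProbabilityMeasure μ]

/-- The mean value inequality for `r ↦ θ r t - r • v s t` has an error bound independent of `t`,
because `v` is continuous in sup norm. Pointwise derivatives thus upgrade to a derivative in `C(T,
W)`. -/
theorem hasDerivAt_continuousMap {θ v : ℝ → C(T, W)} (hv : ContinuousOn v (Set.Ioi 0))
    (hθ : ∀ s, 0 < s → ∀ t, HasDerivAt (fun s' => θ s' t) (v s t) s) {s : ℝ} (hs : 0 < s) :
    HasDerivAt θ (v s) s := by
  rw [hasDerivAt_iff_isLittleO, Asymptotics.isLittleO_iff]
  intro ε hε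
  have hvs : ContinuousAt v s := hv.continuousAt (Ioi_mem_nhds hs)
  obtain ⟨δ, hδ, hball⟩ := Metric.eventually_nhds_iff_ball.1
    ((Metric.tendsto_nhds.1 hvs ε hε).and (Ioi_mem_nhds hs))
  filter_upwards [Metric.ball_mem_nhds s hδ] with s' hs'
  rw [ContinuousMap.norm_le _ (by positivity)]
  intro t
  have h := (convex_ball s δ).norm_image_sub_le_of_norm_hasDerivWithin_le (C := ε)
    (f := fun r => θ r t - r • v s t) (f' := fun r => v r t - v s t)
    (fun r hr => ?_) (fun r hr => ?_) (Metric.mem_ball_self hδ) hs'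
  · refine le_trans (le_of_eq ?_) h
    congr 1
    simp only [ContinuousMap.sub_apply, ContinuousMap.smul_apply, sub_smul]
    abel
  · have := (hθ r (hball r hr).2 t).fun_sub ((hasDerivAt_id r).smul_const (v s t))
    simpa using this.hasDerivWithinAt
  · rw [← dist_eq_norm]
    exact (ContinuousMap.dist_apply_le_dist t).trans (hball r hr).1.le

/-- The `L²(ν)` inner product of continuous functions. -/
def pairing (ν : Measure T) [IsProbabilityMeasure ν] : C(T, W) →L[ℝ] C(T, W) →L[ℝ] ℝ :=
  LinearMap.mkContinuous₂
    (LinearMap.mk₂ ℝ (fun g h : C(T, W) => ∫ t, (inner ℝ (g t) (h t) : ℝ) ∂ν)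
      (fun g g' h => by
        simp only [ContinuousMap.add_apply, inner_add_left]
        exact integral_add (integrable_of_continuous (by fun_prop))
          (integrable_of_continuous (by fun_prop)))
      (fun c g h => by
        simp only [ContinuousMap.smul_apply, real_inner_smul_left, smul_eq_mul]
        exact integral_const_mul _ _)
      (fun g h h' => by
        simp only [ContinuousMap.add_apply, inner_add_right]
        exact integral_add (integrable_of_continuous (by fun_prop))
          (integrable_of_continuous (by fun_prop)))
      (fun c g h => by
        simp only [ContinuousMap.smul_apply, real_inner_smul_right, smul_eq_mul]
        exact integral_const_mul _ _)) 1
    (fun g h => by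
      rw [one_mul]
      refine norm_integral_le_of_forall_le fun t => (norm_inner_le_norm _ _).trans ?_
      gcongr
      · exact g.norm_coe_le_norm t
      · exact h.norm_coe_le_norm t)

theorem pairing_apply (g h : C(T, W)) : pairing ν g h = ∫ t, inner ℝ (g t) (h t) ∂ν := rfl

theorem pairing_self (g : C(T, W)) : pairing ν g g = ∫ t, ‖g t‖ ^ 2 ∂ν := by
  simp only [pairing_apply, real_inner_self_eq_norm_sq]

theorem pairing_self_nonneg (g : C(T, W)) : 0 ≤ pairing ν g g := by
  rw [pairing_self]; exact integral_nonneg fun t => by positivity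

theorem pairing_comm (g h : C(T, W)) : pairing ν g h = pairing ν h g := by
  simp only [pairing_apply, real_inner_comm]

/-- The expected loss. -/
def loss (ν : Measure T) (F : E → W → E) (ℓ : E → E → ℝ) (μ : Measure E) (θ : C(T, W)) : ℝ :=
  ∫ x, ℓ x (finalState ν F θ x) ∂μ

open Classical in
/-- The gradient of the expected loss, for the pairing by `ν`. -/
def grad (ν : Measure T) (F : E → W → E) (A : E → W → E →L[ℝ] E) (D : E → W → W →L[ℝ] E)
    (b : E → E → E) (μ : Measure E) (θ : C(T, W)) : C(T, W) :=
  if h : Continuous fun t => ∫ x, gradIntegrand ν F A D b θ x t ∂μ then ⟨_, h⟩ else 0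

theorem integrable_of_continuous_of_norm_le {G : Type*} [NormedAddCommGroup G]
    (hμ : ∀ᵐ x ∂μ, ‖x‖ ≤ R) {w : E → G} (hw : Continuous w) {K : ℝ}
    (hK : ∀ x, ‖x‖ ≤ R → ‖w x‖ ≤ K) : Integrable w μ :=
  Integrable.of_bound hw.aestronglyMeasurable K (hμ.mono hK)

theorem norm_integral_le_of_ball {G : Type*} [NormedAddCommGroup G] [NormedSpace ℝ G]
    (hμ : ∀ᵐ x ∂μ, ‖x‖ ≤ R) {w : E → G} {K : ℝ} (hK : ∀ x, ‖x‖ ≤ R → ‖w x‖ ≤ K) :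
    ‖∫ x, w x ∂μ‖ ≤ K := by
  simpa using norm_integral_le_of_norm_le_const (μ := μ) (hμ.mono hK)

theorem continuous_gradIntegrand_left (hT : IsTimeScale E ν τ) (hF : Activation F A D C)
    (hℓ : IsLoss ℓ b R C) (θ : C(T, W)) (t : T) :
    Continuous fun x => gradIntegrand ν F A D b θ x t := by
  exact continuous_of_continuous_prod_left (continuous_gradIntegrand hT hF hℓ θ) t

theorem continuous_gradIntegrand_right (hT : IsTimeScale E ν τ) (hF : Activation F A D C)
    (hℓ : IsLoss ℓ b R C) (θ : C(T, W)) (x : E) :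
    Continuous fun t => gradIntegrand ν F A D b θ x t := by
  exact continuous_of_continuous_prod_right (continuous_gradIntegrand hT hF hℓ θ) x

variable [SecondCountableTopology T] [OrderClosedTopology T]

/-- Dominated convergence proves the continuity required in the definition of `grad`, so under these
hypotheses its default value `0` does not occur. -/
theorem grad_apply (hT : IsTimeScale E ν τ) (hF : Activation F A D C) (hℓ : IsLoss ℓ b R C)
    (hμ : ∀ᵐ x ∂μ, ‖x‖ ≤ R) (θ : C(T, W)) (t : T) :
    grad ν F A D b μ θ t = ∫ x, gradIntegrand ν F A D b θ x t ∂μ := by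
  obtain ⟨K, hK, hθ⟩ := exists_norm_le_of_continuous θ.continuous
  have h : Continuous fun t => ∫ x, gradIntegrand ν F A D b θ x t ∂μ := by
    refine continuous_of_dominated
      (bound := fun _ => C * stateBound C R (K ^ 2) * adjBound C R (K ^ 2)) (fun t => ?_)
      (fun t => ?_) (integrable_const _) (Eventually.of_forall fun x => ?_)
    · exact (continuous_gradIntegrand_left hT hF hℓ θ t).aestronglyMeasurable
    · filter_upwards [hμ] with x hx
      exact norm_gradIntegrand_le hT hF hℓ (by positivity) hx (integral_sq_norm_le hθ) t
    · exact continuous_gradIntegrand_right hT hF hℓ θ x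
  rw [grad, dif_pos h]
  rfl

/-- A bound at every time from the mean square of the parameters alone; this gain from mean square
to sup norm is what makes `IsFlow.norm_le` possible. -/
theorem norm_grad_le (hT : IsTimeScale E ν τ) (hF : Activation F A D C) (hℓ : IsLoss ℓ b R C)
    (hμ : ∀ᵐ x ∂μ, ‖x‖ ≤ R) {θ : C(T, W)} {K : ℝ} (hK : 0 ≤ K) (hθ : ∫ r, ‖θ r‖ ^ 2 ∂ν ≤ K)
    (t : T) : ‖grad ν F A D b μ θ t‖ ≤ C * stateBound C R K * adjBound C R K := by
  rw [grad_apply hT hF hℓ hμ]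
  exact norm_integral_le_of_ball hμ fun x hx => norm_gradIntegrand_le hT hF hℓ hK hx hθ t

theorem integrable_gradIntegrand (hT : IsTimeScale E ν τ) (hF : Activation F A D C)
    (hℓ : IsLoss ℓ b R C) (hμ : ∀ᵐ x ∂μ, ‖x‖ ≤ R) (θ : C(T, W)) (t : T) :
    Integrable (fun x => gradIntegrand ν F A D b θ x t) μ := by
  obtain ⟨K, hK, hθ⟩ := exists_norm_le_of_continuous θ.continuous
  exact integrable_of_continuous_of_norm_le hμ
    (continuous_gradIntegrand_left hT hF hℓ θ t) fun x hx =>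
      norm_gradIntegrand_le hT hF hℓ (by positivity) hx (integral_sq_norm_le hθ) t

/-- The gradient is Lipschitz on the unit ball around each `θ`. Continuity in sup norm is what
`hasDerivAt_continuousMap` needs of the velocity. -/
theorem continuous_grad (hT : IsTimeScale E ν τ) (hF : Activation F A D C) (hℓ : IsLoss ℓ b R C)
    (hμ : ∀ᵐ x ∂μ, ‖x‖ ≤ R) : Continuous (grad ν F A D b μ : C(T, W) → C(T, W)) := by
  rw [continuous_iff_continuousAt]
  intro θ
  have hC := hF.pos
  have hR := hℓ.radius_nonneg
  set K := ‖θ‖ + 1 with hKdef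
  have hK : 0 < K := by positivity
  obtain ⟨c, hc, hlip⟩ := exists_lipschitz (ν := ν) hT hF hℓ hK
  set B := stateBound C R (K ^ 2)
  have hB : 0 ≤ B := zero_le_one.trans (one_le_stateBound C hR (by positivity))
  set Q := adjBound C R (K ^ 2)
  have hQ : 0 ≤ Q := adjBound_nonneg hC.le hR (by positivity)
  have hθ : ∀ t, ‖θ t‖ ≤ K := fun t => (θ.norm_coe_le_norm t).trans (by simp [hKdef])
  set c' := C * K * (2 * B) * Q * c + C * B ^ 2 * Q + C * B * c with hc'
  rw [ContinuousAt, tendsto_iff_dist_tendsto_zero]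
  have hlim : Tendsto (fun θ' => c' * ‖θ' - θ‖) (𝓝 θ) (𝓝 0) := by
    have : Continuous fun θ' => c' * ‖θ' - θ‖ := by fun_prop
    simpa using this.tendsto θ
  refine squeeze_zero' (Eventually.of_forall fun _ => dist_nonneg) ?_ hlim
  filter_upwards [Metric.ball_mem_nhds θ one_pos] with θ' hθ'1
  have hθ' : ∀ t, ‖θ' t‖ ≤ K := fun t => by
    refine (θ'.norm_coe_le_norm t).trans ?_
    have h1 : ‖θ' - θ‖ < 1 := by simpa [dist_eq_norm] using hθ'1
    have h2 := norm_le_insert' θ' θ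
    linarith
  rw [ContinuousMap.dist_le (by positivity)]
  intro t
  rw [dist_eq_norm, grad_apply hT hF hℓ hμ, grad_apply hT hF hℓ hμ,
    ← integral_sub (integrable_gradIntegrand hT hF hℓ hμ θ' t)
      (integrable_gradIntegrand hT hF hℓ hμ θ t)]
  refine norm_integral_le_of_ball hμ fun x hx => ?_
  obtain ⟨hz, -, hq⟩ := hlip θ' θ hθ' hθ x hx
  refine (hF.norm_adjoint_D_sub_le
    (norm_state_le hT hF (by positivity) hx (integral_sq_norm_le hθ') t)
    (norm_state_le hT hF (by positivity) hx (integral_sq_norm_le hθ) t) (hθ' t)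
    (norm_adj_le hT hF hℓ (by positivity) hx (integral_sq_norm_le hθ') t)).trans ?_
  calc _ ≤ C * K * (2 * B) * Q * (c * ‖θ' - θ‖) + C * B ^ 2 * Q * ‖θ' - θ‖
        + C * B * (c * ‖θ' - θ‖) := by
        gcongr
        · exact hz t
        · exact (θ' - θ).norm_coe_le_norm t
        · exact hq t
    _ = _ := by rw [hc']; ring

theorem continuous_loss_finalState (hT : IsTimeScale E ν τ) (hF : Activation F A D C)
    (hℓ : IsLoss ℓ b R C) (θ : C(T, W)) : Continuous fun x => ℓ x (finalState ν F θ x) :=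
  hℓ.continuous_loss.comp (continuous_id.prodMk (continuous_finalState hT hF θ))

theorem loss_finalState_le (hT : IsTimeScale E ν τ) (hF : Activation F A D C)
    (hℓ : IsLoss ℓ b R C) {θ : C(T, W)} {K : ℝ} (hK : 0 ≤ K) (hθ : ∫ r, ‖θ r‖ ^ 2 ∂ν ≤ K)
    {x : E} (hx : ‖x‖ ≤ R) : ‖ℓ x (finalState ν F θ x)‖ ≤ C * stateBound C R K ^ 2 := by
  rw [Real.norm_of_nonneg (hℓ.nonneg _ _)]
  refine (hℓ.le _ _ hx).trans ?_
  have := hF.pos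
  have := norm_finalState_le hT hF hK hx hθ
  gcongr
  linarith

theorem integrable_loss (hT : IsTimeScale E ν τ) (hF : Activation F A D C)
    (hℓ : IsLoss ℓ b R C) (hμ : ∀ᵐ x ∂μ, ‖x‖ ≤ R) (θ : C(T, W)) :
    Integrable (fun x => ℓ x (finalState ν F θ x)) μ := by
  obtain ⟨K, hK, hθ⟩ := exists_norm_le_of_continuous θ.continuous
  exact integrable_of_continuous_of_norm_le hμ (continuous_loss_finalState hT hF hℓ θ)
    fun x hx => loss_finalState_le hT hF hℓ (by positivity) (integral_sq_norm_le hθ) hx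

theorem loss_nonneg (hℓ : IsLoss ℓ b R C) (θ : C(T, W)) : 0 ≤ loss ν F ℓ μ θ :=
  integral_nonneg fun _ => hℓ.nonneg _ _

theorem loss_le (hT : IsTimeScale E ν τ) (hF : Activation F A D C)
    (hℓ : IsLoss ℓ b R C) (hμ : ∀ᵐ x ∂μ, ‖x‖ ≤ R) {θ : C(T, W)} {K : ℝ} (hK : 0 ≤ K)
    (hθ : ∫ r, ‖θ r‖ ^ 2 ∂ν ≤ K) : loss ν F ℓ μ θ ≤ C * stateBound C R K ^ 2 :=
  (Real.le_norm_self _).trans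
    (norm_integral_le_of_ball hμ fun _ hx => loss_finalState_le hT hF hℓ hK hθ hx)

/-- The expansion at a fixed input has a quadratic remainder uniform over the support of `μ`, so it
can be integrated. Fubini in `(x, t)` identifies the linear term with the `L²(ν)` pairing, although
the space itself carries the sup norm. -/
theorem hasFDerivAt_loss (hT : IsTimeScale E ν τ) (hF : Activation F A D C)
    (hℓ : IsLoss ℓ b R C) (hμ : ∀ᵐ x ∂μ, ‖x‖ ≤ R) (θ : C(T, W)) :
    HasFDerivAt (loss ν F ℓ μ) (pairing ν (grad ν F A D b μ θ)) θ := by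
  set K := ‖θ‖ + 1 with hKdef
  have hK : 0 < K := by positivity
  obtain ⟨c, hc, htaylor⟩ := exists_loss_taylor (ν := ν) hT hF hℓ hK
  have hθ : ∀ t, ‖θ t‖ ≤ K := fun t => (θ.norm_coe_le_norm t).trans (by simp [hKdef])
  have hprod : ∀ h : C(T, W), Integrable (fun p : E × T =>
      (inner ℝ (gradIntegrand ν F A D b θ p.1 p.2) (h p.2) : ℝ)) (μ.prod ν) := fun h => by
    have hcont : Continuous fun p : E × T =>
        (inner ℝ (gradIntegrand ν F A D b θ p.1 p.2) (h p.2) : ℝ) :=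
      (continuous_gradIntegrand hT hF hℓ θ).inner (h.continuous.comp continuous_snd)
    refine Integrable.of_bound hcont.aestronglyMeasurable
      (C * stateBound C R (K ^ 2) * adjBound C R (K ^ 2) * ‖h‖) ?_
    filter_upwards [Measure.quasiMeasurePreserving_fst.ae hμ] with p hp
    exact (norm_inner_le_norm _ _).trans (mul_le_mul
      (norm_gradIntegrand_le hT hF hℓ (by positivity) hp (integral_sq_norm_le hθ) p.2)
      (h.norm_coe_le_norm _) (norm_nonneg _) (mul_nonneg (mul_nonneg hF.pos.le
        (zero_le_one.trans (one_le_stateBound C hℓ.radius_nonneg (by positivity))))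
        (adjBound_nonneg hF.pos.le hℓ.radius_nonneg (by positivity))))
  have hpair : ∀ h : C(T, W), pairing ν (grad ν F A D b μ θ) h
      = ∫ x, ∫ t, inner ℝ (gradIntegrand ν F A D b θ x t) (h t) ∂ν ∂μ := fun h => by
    rw [pairing_apply]
    have h1 : ∀ t, (inner ℝ (grad ν F A D b μ θ t) (h t) : ℝ)
        = ∫ x, inner ℝ (gradIntegrand ν F A D b θ x t) (h t) ∂μ := fun t => by
      rw [grad_apply hT hF hℓ hμ, real_inner_comm,
        ← integral_inner (integrable_gradIntegrand hT hF hℓ hμ θ t)]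
      simp only [real_inner_comm]
    simp only [h1]
    exact (integral_integral_swap (hprod h)).symm
  have hint : ∀ h : C(T, W),
      Integrable (fun x => ∫ t, inner ℝ (gradIntegrand ν F A D b θ x t) (h t) ∂ν) μ := fun h =>
    (hprod h).integral_prod_left
  have hbig : (fun θ' => loss ν F ℓ μ θ' - loss ν F ℓ μ θ
      - pairing ν (grad ν F A D b μ θ) (θ' - θ)) =O[𝓝 θ] fun θ' => ‖θ' - θ‖ ^ 2 := by
    refine Asymptotics.IsBigO.of_bound c ?_
    filter_upwards [Metric.ball_mem_nhds θ one_pos] with θ' hθ'1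
    have hθ' : ∀ t, ‖θ' t‖ ≤ K := fun t => by
      refine (θ'.norm_coe_le_norm t).trans ?_
      have h1 : ‖θ' - θ‖ < 1 := by simpa [dist_eq_norm] using hθ'1
      have h2 := norm_le_insert' θ' θ
      linarith
    have hi : Integrable (fun x => ℓ x (finalState ν F θ' x) - ℓ x (finalState ν F θ x)) μ :=
      (integrable_loss hT hF hℓ hμ θ').sub (integrable_loss hT hF hℓ hμ θ)
    rw [hpair, loss, loss, ← integral_sub (integrable_loss hT hF hℓ hμ θ')
      (integrable_loss hT hF hℓ hμ θ), ← integral_sub hi (hint _), norm_pow, norm_norm]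
    exact norm_integral_le_of_ball hμ fun x hx => htaylor θ θ' hθ hθ' x hx
  refine hasFDerivAt_iff_isLittleO.2 (hbig.trans_isLittleO ?_)
  have hlim : Tendsto (fun θ' => θ' - θ) (𝓝 θ) (𝓝 0) := by
    have : Continuous fun θ' => θ' - θ := by fun_prop
    simpa using this.tendsto θ
  exact (Asymptotics.isLittleO_norm_pow_id one_lt_two).comp_tendsto hlim

/-- The regularized gradient flow with gradient `G`. -/
structure IsFlow (G : C(T, W) → C(T, W)) (θ : ℝ → C(T, W)) : Prop where
  continuousOn : ContinuousOn θ (Set.Ici 0)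
  hasDerivAt : ∀ s, 0 < s → ∀ t,
    HasDerivAt (fun s' => θ s' t) (-(G (θ s) t) - (2 * Real.exp (-s)) • θ s t) s

/-- The velocity of the regularized gradient flow. -/
def flowVelocity (G : C(T, W) → C(T, W)) (θ : ℝ → C(T, W)) (s : ℝ) : C(T, W) :=
  -(G (θ s)) - (2 * Real.exp (-s)) • θ s

theorem IsFlow.hasDerivAt_path {G : C(T, W) → C(T, W)} (hG : Continuous G) {θ : ℝ → C(T, W)}
    (hθ : IsFlow G θ) {s : ℝ} (hs : 0 < s) : HasDerivAt θ (flowVelocity G θ s) s := by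
  refine hasDerivAt_continuousMap (v := flowVelocity G θ) ?_ hθ.hasDerivAt hs
  have h1 := hθ.continuousOn.mono Set.Ioi_subset_Ici_self
  have h2 : Continuous fun s : ℝ => 2 * Real.exp (-s) := by fun_prop
  exact (hG.comp_continuousOn h1).neg.sub (h2.continuousOn.smul h1)

theorem hasDerivAt_pairing_self {θ : ℝ → C(T, W)} {v : C(T, W)} {s : ℝ} (h : HasDerivAt θ v s) :
    HasDerivAt (fun s => pairing ν (θ s) (θ s)) (2 * pairing ν (θ s) v) s := by
  refine (hasDerivAt_bilinear_self (pairing ν) h).congr_deriv ?_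
  rw [pairing_comm v (θ s)]
  ring

/-- The loss contributes `⟨grad, v⟩ = -⟨v, v⟩ - 2 e^{-s} ⟨θ, v⟩`, and the weighted mean square
contributes `2 e^{-s} ⟨θ, v⟩ - e^{-s} ⟨θ, θ⟩`. The cross terms cancel; the regularization is made
for this. -/
theorem IsFlow.hasDerivAt_energy (hT : IsTimeScale E ν τ) (hF : Activation F A D C)
    (hℓ : IsLoss ℓ b R C) (hμ : ∀ᵐ x ∂μ, ‖x‖ ≤ R) {θ : ℝ → C(T, W)}
    (hθ : IsFlow (grad ν F A D b μ) θ) {s : ℝ} (hs : 0 < s) :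
    HasDerivAt (fun s => loss ν F ℓ μ (θ s) + Real.exp (-s) * pairing ν (θ s) (θ s))
      (-(pairing ν (flowVelocity (grad ν F A D b μ) θ s) (flowVelocity (grad ν F A D b μ) θ s))
        - Real.exp (-s) * pairing ν (θ s) (θ s)) s := by
  have hd := hθ.hasDerivAt_path (continuous_grad hT hF hℓ hμ) hs
  set v := flowVelocity (grad ν F A D b μ) θ s with hv
  have h1 : HasDerivAt (fun s => loss ν F ℓ μ (θ s)) (pairing ν (grad ν F A D b μ (θ s)) v) s :=
    (hasFDerivAt_loss (ν := ν) hT hF hℓ hμ (θ s)).comp_hasDerivAt s hd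
  have h2 : HasDerivAt (fun s => Real.exp (-s)) (-Real.exp (-s)) s := by
    simpa using (hasDerivAt_neg s).exp
  refine (h1.add (h2.mul (hasDerivAt_pairing_self hd))).congr_deriv ?_
  have h4 : grad ν F A D b μ (θ s) = -v - (2 * Real.exp (-s)) • θ s := by
    rw [hv, flowVelocity]; abel
  have h5 : pairing ν (grad ν F A D b μ (θ s)) v
      = -(pairing ν v v) - 2 * Real.exp (-s) * pairing ν (θ s) v := by
    rw [h4, map_sub, map_neg, map_smul]
    rfl
  rw [h5]
  ring

theorem IsFlow.energy_le (hT : IsTimeScale E ν τ) (hF : Activation F A D C)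
    (hℓ : IsLoss ℓ b R C) (hμ : ∀ᵐ x ∂μ, ‖x‖ ≤ R) {θ : ℝ → C(T, W)}
    (hθ : IsFlow (grad ν F A D b μ) θ) {s : ℝ} (hs : 0 ≤ s) :
    loss ν F ℓ μ (θ s) + Real.exp (-s) * ∫ t, ‖θ s t‖ ^ 2 ∂ν
      ≤ loss ν F ℓ μ (θ 0) + ∫ t, ‖θ 0 t‖ ^ 2 ∂ν := by
  let J : ℝ → ℝ := fun s => loss ν F ℓ μ (θ s) + Real.exp (-s) * pairing ν (θ s) (θ s)
  have hJ := fun s hs => hθ.hasDerivAt_energy hT hF hℓ hμ (s := s) hs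
  have hanti : AntitoneOn J (Set.Ici 0) := by
    refine antitoneOn_of_deriv_nonpos (convex_Ici 0) ?_ ?_ ?_
    · have hl : Continuous (loss ν F ℓ μ : C(T, W) → ℝ) := continuous_iff_continuousAt.2 fun θ =>
        (hasFDerivAt_loss hT hF hℓ hμ θ).continuousAt
      have he : Continuous fun s : ℝ => Real.exp (-s) := by fun_prop
      exact (hl.comp_continuousOn hθ.continuousOn).add (he.continuousOn.mul
        (((pairing ν).continuous.comp_continuousOn hθ.continuousOn).clm_apply hθ.continuousOn))
    · rw [interior_Ici]
      exact fun s hs => (hJ s hs).differentiableAt.differentiableWithinAt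
    · rw [interior_Ici]
      intro s hs
      rw [(hJ s hs).deriv]
      have h1 := pairing_self_nonneg (ν := ν) (flowVelocity (grad ν F A D b μ) θ s)
      have h2 := mul_nonneg (Real.exp_pos (-s)).le (pairing_self_nonneg (ν := ν) (θ s))
      linarith
  have := hanti (Set.mem_Ici.2 le_rfl) hs hs
  simpa [J, pairing_self] using this

/-- A bound for the mean square of the parameters along the flow up to time `S`. -/
def meanSquareBound (C R K S : ℝ) : ℝ :=
  Real.exp S * (C * stateBound C R (K ^ 2) ^ 2 + K ^ 2)

/-- A uniform bound for the parameters along the flow up to time `S`. -/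
def flowBound (C R K S : ℝ) : ℝ :=
  (K + C * stateBound C R (meanSquareBound C R K S) * adjBound C R (meanSquareBound C R K S))
    * Real.exp (2 * S)

theorem meanSquareBound_nonneg {C R K S : ℝ} (hC : 0 ≤ C) : 0 ≤ meanSquareBound C R K S := by
  unfold meanSquareBound; positivity

/-- Energy decay bounds the mean square, hence the gradient at every time. At fixed `t` the flow is
then a linear differential inequality with bounded forcing. -/
theorem IsFlow.norm_le (hT : IsTimeScale E ν τ) (hF : Activation F A D C)
    (hℓ : IsLoss ℓ b R C) (hμ : ∀ᵐ x ∂μ, ‖x‖ ≤ R) {θ : ℝ → C(T, W)}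
    (hθ : IsFlow (grad ν F A D b μ) θ) {K S : ℝ} (hK : 0 ≤ K) (hθK : ∀ t, ‖θ 0 t‖ ≤ K) {s : ℝ}
    (hs : 0 ≤ s) (hsS : s < S) (t : T) : ‖θ s t‖ ≤ flowBound C R K S := by
  have hC := hF.pos
  set K₂ := meanSquareBound C R K S with hK₂
  have hK₂0 : 0 ≤ K₂ := meanSquareBound_nonneg hC.le
  have hms : ∀ s, 0 ≤ s → s < S → ∫ t, ‖θ s t‖ ^ 2 ∂ν ≤ K₂ := fun s hs hsS => by
    have h1 := hθ.energy_le hT hF hℓ hμ hs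
    have h2 := loss_nonneg (ν := ν) (F := F) (μ := μ) hℓ (θ s)
    have hI := integral_sq_norm_le (ν := ν) hθK
    have h3 := loss_le hT hF hℓ hμ (by positivity) hI
    have h4 : Real.exp (-s) * ∫ t, ‖θ s t‖ ^ 2 ∂ν ≤ C * stateBound C R (K ^ 2) ^ 2 + K ^ 2 := by
      linarith
    calc ∫ t, ‖θ s t‖ ^ 2 ∂ν = Real.exp s * (Real.exp (-s) * ∫ t, ‖θ s t‖ ^ 2 ∂ν) := by
          rw [← mul_assoc, ← Real.exp_add]; simp
      _ ≤ Real.exp S * (C * stateBound C R (K ^ 2) ^ 2 + K ^ 2) := by gcongr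
  set G₀ := C * stateBound C R K₂ * adjBound C R K₂ with hG₀
  have hG₀0 : 0 ≤ G₀ := by
    have h1 := one_le_stateBound C hℓ.radius_nonneg hK₂0
    have h2 := adjBound_nonneg hC.le hℓ.radius_nonneg hK₂0
    positivity
  -- The rate `2` bounds `2 e^{-s}`, and the forcing `G₀` bounds the gradient.
  have h := norm_le_mul_exp_of_norm_deriv_le (f := fun s => θ s t)
    (f' := fun s => -(grad ν F A D b μ (θ s) t) - (2 * Real.exp (-s)) • θ s t) (K := 2) (ε := G₀)
    (S := S) one_le_two hG₀0
    ((ContinuousEvalConst.continuous_eval_const t).comp_continuousOn hθ.continuousOn)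
    (fun s hs => hθ.hasDerivAt s hs t) (fun s hs hsS => ?_) hs hsS
  · refine h.trans ?_
    rw [flowBound]
    gcongr
    exact hθK t
  · have h1 := norm_grad_le hT hF hℓ hμ hK₂0 (hms s hs.le hsS) t
    have h2 : ‖(2 * Real.exp (-s)) • θ s t‖ ≤ 2 * ‖θ s t‖ := by
      rw [norm_smul, Real.norm_of_nonneg (by positivity)]
      have : Real.exp (-s) ≤ 1 := Real.exp_le_one_iff.2 (by linarith)
      gcongr
      linarith
    refine (norm_sub_le _ _).trans ?_
    rw [norm_neg]
    linarith

end Flow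

/-! ### The unit interval and the uniform grid as time scales -/

section Instances

variable {E : Type*} [NormedAddCommGroup E] [NormedSpace ℝ E] [CompleteSpace E]

theorem toI_coe (t : I) : toI t = t := Set.projIcc_val _ t

theorem coe_toI {t : ℝ} (h0 : 0 ≤ t) (h1 : t ≤ 1) : (toI t : ℝ) = t := by
  rw [toI, Set.projIcc_of_mem _ ⟨h0, h1⟩]

theorem continuous_toI : Continuous toI := by
  unfold toI
  exact continuous_projIcc

theorem setIntegral_unitInterval (w : I → E) (s : Set ℝ) (hs : MeasurableSet s) :
    ∫ r in ((↑) : I → ℝ) ⁻¹' s, w r = ∫ r in s ∩ Set.Icc 0 1, w (toI r) := by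
  have h := unitInterval.measurePreserving_coe.setIntegral_preimage_emb
    unitInterval.measurableEmbedding_coe (fun r => w (toI r)) s
  simp only [toI_coe] at h
  rw [h, Measure.restrict_restrict hs]

theorem integral_Iio_unitInterval (w : I → E) (t : I) :
    ∫ r in Set.Iio t, w r = ∫ r in (0 : ℝ)..t, w (toI r) := by
  have h1 : Set.Iio t = ((↑) : I → ℝ) ⁻¹' Set.Iio (t : ℝ) := rfl
  have h2 : Set.Iio (t : ℝ) ∩ Set.Icc 0 1 = Set.Ico 0 (t : ℝ) := by
    ext r
    simp only [Set.mem_inter_iff, Set.mem_Iio, Set.mem_Icc, Set.mem_Ico]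
    exact ⟨fun h => ⟨h.2.1, h.1⟩, fun h => ⟨h.2, h.1, h.2.le.trans t.2.2⟩⟩
  rw [h1, setIntegral_unitInterval _ _ measurableSet_Iio, h2,
    intervalIntegral.integral_of_le t.2.1, integral_Ico_eq_integral_Ioo,
    integral_Ioc_eq_integral_Ioo]

theorem integral_Ioi_unitInterval (w : I → E) (t : I) :
    ∫ r in Set.Ioi t, w r = ∫ r in (t : ℝ)..1, w (toI r) := by
  have h1 : Set.Ioi t = ((↑) : I → ℝ) ⁻¹' Set.Ioi (t : ℝ) := rfl
  have h2 : Set.Ioi (t : ℝ) ∩ Set.Icc 0 1 = Set.Ioc (t : ℝ) 1 := by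
    ext r
    simp only [Set.mem_inter_iff, Set.mem_Ioi, Set.mem_Icc, Set.mem_Ioc]
    exact ⟨fun h => ⟨h.1, h.2.2⟩, fun h => ⟨h.1, t.2.1.trans h.1.le, h.2⟩⟩
  rw [h1, setIntegral_unitInterval _ _ measurableSet_Ioi, h2,
    intervalIntegral.integral_of_le t.2.2]

theorem integral_unitInterval (w : I → E) : ∫ r : I, w r = ∫ r in (0 : ℝ)..1, w (toI r) := by
  have h := setIntegral_unitInterval w Set.univ MeasurableSet.univ
  rw [Set.preimage_univ, setIntegral_univ, Set.univ_inter] at h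
  rw [h, intervalIntegral.integral_of_le zero_le_one, integral_Icc_eq_integral_Ioc]

theorem isTimeScale_unitInterval :
    IsTimeScale E (volume : Measure I) fun t => (t : ℝ) := by
  have hint : ∀ w : I → E, Continuous w → ∀ a b : ℝ,
      IntervalIntegrable (fun r => w (toI r)) volume a b := fun w hw a b =>
    (hw.comp continuous_toI).intervalIntegrable a b
  refine ⟨⟨by fun_prop, fun t => t.2.1, fun t => t.2.2, fun t => measurableSet_Iio,
    fun c hc t => ?_, fun w hw => ?_⟩, ⟨by fun_prop, fun t => by linarith [t.2.2],
    fun t => by linarith [t.2.1], fun t => measurableSet_Ioi, fun c hc t => ?_, fun w hw => ?_⟩⟩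
  · rw [integral_Iio_unitInterval]
    have h1 : ∫ r in (0 : ℝ)..t, Real.exp (c * (toI r : ℝ)) = ∫ r in (0 : ℝ)..t, Real.exp (c * r) :=
      intervalIntegral.integral_congr fun r hr => by
        rw [Set.uIcc_of_le t.2.1] at hr
        simp only [coe_toI hr.1 (hr.2.trans t.2.2)]
    have h2 : ∀ r : ℝ, HasDerivAt (fun r => Real.exp (c * r) / c) (Real.exp (c * r)) r := fun r => by
      refine ((((hasDerivAt_id r).const_mul c).exp).div_const c).congr_deriv ?_
      simp only [id, mul_one]
      field_simp
    rw [h1, intervalIntegral.integral_eq_sub_of_hasDerivAt (fun r _ => h2 r)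
      ((by fun_prop : Continuous fun r => Real.exp (c * r)).intervalIntegrable _ _)]
    have : 0 < Real.exp (c * 0) / c := by positivity
    linarith
  · simp only [integral_Iio_unitInterval]
    exact (intervalIntegral.continuous_primitive (hint w hw) 0).comp continuous_subtype_val
  · rw [integral_Ioi_unitInterval]
    have h1 : ∫ r in (t : ℝ)..1, Real.exp (c * (1 - (toI r : ℝ)))
        = ∫ r in (t : ℝ)..1, Real.exp (c * (1 - r)) :=
      intervalIntegral.integral_congr fun r hr => by
        rw [Set.uIcc_of_le t.2.2] at hr
        simp only [coe_toI (t.2.1.trans hr.1) hr.2]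
    have h2 : ∀ r : ℝ, HasDerivAt (fun r => -(Real.exp (c * (1 - r)) / c))
        (Real.exp (c * (1 - r))) r := fun r => by
      refine ((((((hasDerivAt_id r).const_sub 1).const_mul c).exp).div_const c).neg).congr_deriv ?_
      simp only [id]
      field_simp
    rw [h1, intervalIntegral.integral_eq_sub_of_hasDerivAt (fun r _ => h2 r)
      ((by fun_prop : Continuous fun r => Real.exp (c * (1 - r))).intervalIntegrable _ _)]
    have : 0 < Real.exp (c * (1 - 1)) / c := by positivity
    linarith
  · have h1 : ∀ t : I, ∫ r in Set.Ioi t, w r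
        = (∫ r in (0 : ℝ)..1, w (toI r)) - ∫ r in (0 : ℝ)..t, w (toI r) := fun t => by
      rw [integral_Ioi_unitInterval, intervalIntegral.integral_interval_sub_left (hint w hw _ _)
        (hint w hw _ _)]
    simp only [h1]
    exact continuous_const.sub
      ((intervalIntegral.continuous_primitive (hint w hw) 0).comp continuous_subtype_val)

/-- The uniform probability measure on the layers. -/
def gridMeasure (L : ℕ) : Measure (Fin L) := (L : ℝ≥0∞)⁻¹ • Measure.count

instance isProbabilityMeasure_gridMeasure (L : ℕ) [NeZero L] :
    IsProbabilityMeasure (gridMeasure L) := by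
  refine ⟨?_⟩
  rw [gridMeasure, Measure.smul_apply, Measure.count_univ]
  simp only [ENat.card_eq_coe_fintype_card, Fintype.card_fin, smul_eq_mul]
  exact ENNReal.inv_mul_cancel (by simpa using NeZero.ne L) (by simp)

theorem setIntegral_gridMeasure {L : ℕ} (w : Fin L → E) (s : Set (Fin L)) [DecidablePred (· ∈ s)] :
    ∫ j in s, w j ∂gridMeasure L = (L : ℝ)⁻¹ • ∑ j, if j ∈ s then w j else 0 := by
  rw [← integral_indicator (Set.toFinite s).measurableSet, gridMeasure, integral_smul_measure,
    integral_count]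
  simp [Set.indicator_apply]

theorem integral_gridMeasure {L : ℕ} (w : Fin L → E) :
    ∫ j, w j ∂gridMeasure L = (L : ℝ)⁻¹ • ∑ j, w j := by
  classical
  have := setIntegral_gridMeasure w Set.univ
  simpa using this

theorem integral_gridMeasure_nat {L : ℕ} (ψ : ℕ → E) :
    ∫ j : Fin L, ψ j ∂gridMeasure L = (L : ℝ)⁻¹ • ∑ j ∈ Finset.range L, ψ j := by
  rw [integral_gridMeasure, Fin.sum_univ_eq_sum_range]

theorem integral_Iio_gridMeasure {L : ℕ} (ψ : ℕ → E) (l : Fin L) :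
    ∫ j : Fin L in Set.Iio l, ψ j ∂gridMeasure L
      = (L : ℝ)⁻¹ • ∑ j ∈ Finset.range l, ψ j := by
  classical
  rw [setIntegral_gridMeasure (fun j : Fin L => ψ j)]
  congr 1
  have := Fin.sum_univ_eq_sum_range (fun j => if j < (l : ℕ) then ψ j else 0) L
  simp only [Set.mem_Iio, Fin.lt_def, this, ← Finset.sum_filter]
  congr 1
  ext j
  simp only [Finset.mem_filter, Finset.mem_range]
  have := l.2
  omega

theorem integral_Ioi_gridMeasure {L : ℕ} (ψ : ℕ → E) (l : Fin L) :
    ∫ j : Fin L in Set.Ioi l, ψ j ∂gridMeasure L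
      = (L : ℝ)⁻¹ • ∑ j ∈ Finset.Ico ((l : ℕ) + 1) L, ψ j := by
  classical
  rw [setIntegral_gridMeasure (fun j : Fin L => ψ j)]
  congr 1
  have := Fin.sum_univ_eq_sum_range (fun j => if (l : ℕ) < j then ψ j else 0) L
  simp only [Set.mem_Ioi, Fin.lt_def, this, ← Finset.sum_filter]
  congr 1
  ext j
  simp only [Finset.mem_filter, Finset.mem_range, Finset.mem_Ico]
  omega

/-- The sums in the weight condition are lower Riemann sums of exponentials. The induction step is
`1/c + 1/L ≤ e^{c/L}/c`, that is `1 + x ≤ e^x`. -/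
theorem isTimeScale_gridMeasure (L : ℕ) [NeZero L] :
    IsTimeScale E (gridMeasure L) fun l => (l : ℕ) / (L : ℝ) := by
  have hL : (0 : ℝ) < L := by exact_mod_cast Nat.pos_of_ne_zero (NeZero.ne L)
  have hle : ∀ l : Fin L, ((l : ℕ) : ℝ) / L ≤ 1 := fun l => by
    rw [div_le_one hL]; exact_mod_cast l.2.le
  have h0 : ∀ l : Fin L, (0 : ℝ) ≤ ((l : ℕ) : ℝ) / L := fun l => by positivity
  have hstep : ∀ c : ℝ, 0 < c → 1 / c + (L : ℝ)⁻¹ ≤ Real.exp (c / L) / c := fun c hc => by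
    have h := Real.add_one_le_exp (c / L)
    have : 1 / c + (L : ℝ)⁻¹ = (c / L + 1) / c := by field_simp; ring
    rw [this]
    gcongr
  refine ⟨⟨continuous_of_discreteTopology, h0, hle, fun t => measurableSet_Iio,
    fun c hc l => ?_, fun w _ => continuous_of_discreteTopology⟩,
    ⟨continuous_of_discreteTopology, fun l => by linarith [hle l], fun l => by linarith [h0 l],
    fun t => measurableSet_Ioi, fun c hc l => ?_, fun w _ => continuous_of_discreteTopology⟩⟩
  · rw [integral_Iio_gridMeasure (fun j => Real.exp (c * ((j : ℝ) / L))) l]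
    have h : ∀ n : ℕ, (L : ℝ)⁻¹ • ∑ j ∈ Finset.range n, Real.exp (c * ((j : ℝ) / L))
        ≤ Real.exp (c * ((n : ℝ) / L)) / c := fun n => by
      induction n with
      | zero => simp only [Finset.range_zero, Finset.sum_empty, smul_zero]; positivity
      | succ n ih =>
        rw [Finset.sum_range_succ, smul_add]
        have h1 : Real.exp (c * (((n + 1 : ℕ) : ℝ) / L))
            = Real.exp (c * ((n : ℝ) / L)) * Real.exp (c / L) := by
          rw [← Real.exp_add]; congr 1; push_cast; ring
        have h2 := mul_le_mul_of_nonneg_left (hstep c hc) (Real.exp_pos (c * ((n : ℝ) / L))).le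
        rw [h1, mul_div_assoc]
        simp only [smul_eq_mul] at ih ⊢
        rw [mul_add, mul_one_div] at h2
        linarith
    exact h l
  · rw [integral_Ioi_gridMeasure (fun j => Real.exp (c * (1 - (j : ℝ) / L))) l]
    -- Induction on the number `n` of layers counted from the last one. The subtracted term makes
    -- the empty sum an equality; with `n = L - (l + 1)` the exponent is the clock `1 - l/L`.
    have h : ∀ n : ℕ, n ≤ L → (L : ℝ)⁻¹ • ∑ j ∈ Finset.Ico (L - n) L, Real.exp (c * (1 - (j : ℝ) / L))
        ≤ Real.exp (c * (((n : ℝ) + 1) / L)) / c - Real.exp (c / L) / c := fun n hn => by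
      induction n with
      | zero => simp [div_eq_mul_inv]
      | succ n ih =>
        have h3 : L - (n + 1) + 1 = L - n := by omega
        rw [Finset.sum_eq_sum_Ico_succ_bot (by omega), h3, smul_add]
        have h1 : Real.exp (c * (((n + 1 : ℕ) + 1 : ℝ) / L))
            = Real.exp (c * (((n : ℝ) + 1) / L)) * Real.exp (c / L) := by
          rw [← Real.exp_add]; congr 1; push_cast; ring
        have h2 := mul_le_mul_of_nonneg_left (hstep c hc) (Real.exp_pos (c * (((n : ℝ) + 1) / L))).le
        have h4 : c * (1 - ((L - (n + 1) : ℕ) : ℝ) / L) = c * (((n : ℝ) + 1) / L) := by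
          rw [Nat.cast_sub hn]; push_cast; field_simp; ring
        rw [h1, h4, mul_div_assoc]
        have ih' := ih (by omega)
        simp only [smul_eq_mul] at ih' ⊢
        rw [mul_add, mul_one_div] at h2
        linarith
    have hn := h (L - ((l : ℕ) + 1)) (by omega)
    have h3 : L - (L - ((l : ℕ) + 1)) = (l : ℕ) + 1 := by have := l.2; omega
    rw [h3] at hn
    refine hn.trans ?_
    have h5 : (((L - ((l : ℕ) + 1) : ℕ) : ℝ) + 1) / L = 1 - ((l : ℕ) : ℝ) / L := by
      rw [Nat.cast_sub l.2]; push_cast; field_simp; ring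
    rw [h5]
    have : 0 < Real.exp (c / L) / c := by positivity
    linarith

/-- The grid point `l / L`. -/
def gridPoint (L l : ℕ) : I := toI ((l : ℝ) / L)

theorem coe_gridPoint {L l : ℕ} (hl : l ≤ L) : (gridPoint L l : ℝ) = (l : ℝ) / L := by
  refine coe_toI (by positivity) (div_le_one_of_le₀ ?_ (by positivity))
  exact_mod_cast hl

/-- The total deviation of `ψ` from its values at the left end points of the cells. -/
def cellSum (L : ℕ) (ψ : I → I → ℝ) : ℝ :=
  ∑ j ∈ Finset.range L, ∫ t in ((j : ℝ) / L)..(((j + 1 : ℕ) : ℝ) / L), ψ (toI t) (gridPoint L j)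

/-- Left-endpoint quadrature: the error on each cell is at most the integrated deviation from the
left end. Summing over all cells makes the bound independent of `a` and `c`. -/
theorem norm_integral_sub_sum_le {L : ℕ} (hL : 0 < L) {φ : I → E} (hφ : Continuous φ) {a c : ℕ}
    (hac : a ≤ c) (hc : c ≤ L) :
    ‖(∫ t in ((a : ℝ) / L)..((c : ℝ) / L), φ (toI t))
      - (L : ℝ)⁻¹ • ∑ j ∈ Finset.Ico a c, φ (gridPoint L j)‖
      ≤ cellSum L fun t r => ‖φ t - φ r‖ := by
  have hL' : (0 : ℝ) < L := by exact_mod_cast hL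
  have hcont : Continuous fun t => φ (toI t) := hφ.comp continuous_toI
  have hmono : ∀ j : ℕ, (j : ℝ) / L ≤ ((j + 1 : ℕ) : ℝ) / L := fun j => by
    gcongr; omega
  rw [← intervalIntegral.sum_integral_adjacent_intervals_Ico (a := fun j : ℕ => (j : ℝ) / L) hac
    (fun j _ => hcont.intervalIntegrable _ _), Finset.smul_sum, ← Finset.sum_sub_distrib]
  have hterm : ∀ j : ℕ, ‖(∫ t in ((j : ℝ) / L)..(((j + 1 : ℕ) : ℝ) / L), φ (toI t))
      - (L : ℝ)⁻¹ • φ (gridPoint L j)‖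
      ≤ ∫ t in ((j : ℝ) / L)..(((j + 1 : ℕ) : ℝ) / L), ‖φ (toI t) - φ (gridPoint L j)‖ :=
    fun j => by
    have h1 : (L : ℝ)⁻¹ • φ (gridPoint L j)
        = ∫ t in ((j : ℝ) / L)..(((j + 1 : ℕ) : ℝ) / L), φ (gridPoint L j) := by
      rw [intervalIntegral.integral_const]
      congr 1
      push_cast
      field_simp
      ring
    rw [h1, ← intervalIntegral.integral_sub (hcont.intervalIntegrable _ _)
      intervalIntegrable_const]
    exact intervalIntegral.norm_integral_le_integral_norm (hmono j)
  refine (norm_sum_le _ _).trans ((Finset.sum_le_sum fun j _ => hterm j).trans ?_)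
  refine Finset.sum_le_sum_of_subset_of_nonneg (fun j hj => ?_) fun j _ _ => ?_
  · simp only [Finset.mem_Ico, Finset.mem_range] at hj ⊢
    omega
  · exact intervalIntegral.integral_nonneg (hmono j) fun t _ => norm_nonneg _

theorem cellSum_le {L : ℕ} (hL : 0 < L) {ψ ψ' : I → I → ℝ} (hψ : ∀ r, Continuous fun t => ψ t r)
    (hψ' : ∀ r, Continuous fun t => ψ' t r)
    (h : ∀ t r : I, |(t : ℝ) - r| ≤ 1 / L → ψ t r ≤ ψ' t r) : cellSum L ψ ≤ cellSum L ψ' := by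
  have hL' : (0 : ℝ) < L := by exact_mod_cast hL
  refine Finset.sum_le_sum fun j hj => ?_
  have hj' : j + 1 ≤ L := by simpa using hj
  have hj1 : ((j + 1 : ℕ) : ℝ) / L ≤ 1 := by rw [div_le_one hL']; exact_mod_cast hj'
  refine intervalIntegral.integral_mono_on (by gcongr; omega)
    (((hψ _).comp continuous_toI).intervalIntegrable _ _)
    (((hψ' _).comp continuous_toI).intervalIntegrable _ _) fun t ht => h _ _ ?_
  rw [coe_toI ((by positivity : (0 : ℝ) ≤ (j : ℝ) / L).trans ht.1) (ht.2.trans hj1),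
    coe_gridPoint (by omega), abs_of_nonneg (by linarith [ht.1])]
  have : ((j + 1 : ℕ) : ℝ) / L = (j : ℝ) / L + 1 / L := by push_cast; ring
  linarith [ht.2]

theorem cellSum_const_add_mul {L : ℕ} (hL : 0 < L) {ψ : I → I → ℝ}
    (hψ : ∀ r, Continuous fun t => ψ t r) (a c : ℝ) :
    cellSum L (fun t r => a + c * ψ t r) = a + c * cellSum L ψ := by
  have hL' : (0 : ℝ) < L := by exact_mod_cast hL
  have h : ∀ j : ℕ, ∫ t in ((j : ℝ) / L)..(((j + 1 : ℕ) : ℝ) / L),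
      (a + c * ψ (toI t) (gridPoint L j)) = a / L
        + c * ∫ t in ((j : ℝ) / L)..(((j + 1 : ℕ) : ℝ) / L), ψ (toI t) (gridPoint L j) := fun j => by
    have hc : Continuous fun t => c * ψ (toI t) (gridPoint L j) :=
      ((hψ _).comp continuous_toI).const_mul c
    rw [intervalIntegral.integral_add intervalIntegrable_const (hc.intervalIntegrable _ _),
      intervalIntegral.integral_const, intervalIntegral.integral_const_mul]
    congr 1
    push_cast
    rw [smul_eq_mul]
    field_simp
    ring
  rw [cellSum, cellSum, Finset.mul_sum]
  simp only [h, Finset.sum_add_distrib, Finset.sum_const, Finset.card_range, nsmul_eq_mul]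
  congr 1
  field_simp

end Instances

/-! ### Comparison of continuous and finite depth -/

section Comparison

variable {E : Type*} [NormedAddCommGroup E] [InnerProductSpace ℝ E] [CompleteSpace E]
  [MeasurableSpace E] [BorelSpace E] [SecondCountableTopology E]
  {W : Type*} [NormedAddCommGroup W] [InnerProductSpace ℝ W] [CompleteSpace W]
  {F : E → W → E}
  {A : E → W → E →L[ℝ] E} {D : E → W → W →L[ℝ] E} {C : ℝ} {ℓ : E → E → ℝ} {b : E → E → E} {R : ℝ}
  {μ : Measure E} [IsProbabilityMeasure μ]

theorem norm_integral_Iio_sub_le {w : I → E} (hw : Continuous w) {K : ℝ} (hK : ∀ t, ‖w t‖ ≤ K)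
    (t r : I) : ‖(∫ u in Set.Iio t, w u) - ∫ u in Set.Iio r, w u‖ ≤ K * |(t : ℝ) - r| := by
  have hc : Continuous fun r => w (toI r) := hw.comp continuous_toI
  rw [integral_Iio_unitInterval, integral_Iio_unitInterval,
    intervalIntegral.integral_interval_sub_left (hc.intervalIntegrable _ _)
      (hc.intervalIntegrable _ _)]
  exact intervalIntegral.norm_integral_le_of_norm_le_const fun u _ => hK _

theorem norm_integral_Ioi_sub_le {w : I → E} (hw : Continuous w) {K : ℝ} (hK : ∀ t, ‖w t‖ ≤ K)
    (t r : I) : ‖(∫ u in Set.Ioi t, w u) - ∫ u in Set.Ioi r, w u‖ ≤ K * |(t : ℝ) - r| := by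
  have hc : Continuous fun r => w (toI r) := hw.comp continuous_toI
  rw [integral_Ioi_unitInterval, integral_Ioi_unitInterval,
    ← intervalIntegral.integral_add_adjacent_intervals (hc.intervalIntegrable (t : ℝ) r)
      (hc.intervalIntegrable (r : ℝ) 1), add_sub_cancel_right, abs_sub_comm]
  exact intervalIntegral.norm_integral_le_of_norm_le_const fun u _ => hK _

theorem norm_state_sub_time_le (hF : Activation F A D C) {θ : C(I, W)} {x : E} {K : ℝ}
    (hx : ‖x‖ ≤ R) (hθ : ∀ t, ‖θ t‖ ≤ K) (t r : I) :
    ‖state volume F θ x t - state volume F θ x r‖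
      ≤ C * stateBound C R (K ^ 2) * (K + 1) * |(t : ℝ) - r| := by
  have hT := isTimeScale_unitInterval (E := E)
  have hC := hF.pos
  have hz := norm_state_le hT hF (sq_nonneg K) hx (integral_sq_norm_le hθ)
  rw [isState_state hT hF θ x t, isState_state hT hF θ x r, add_sub_add_left_eq_sub]
  have hB := one_le_stateBound C ((norm_nonneg x).trans hx) (sq_nonneg K)
  refine norm_integral_Iio_sub_le (hF.continuous_comp (state volume F θ x).continuous θ)
    (fun u => ?_) t r
  refine (hF.norm_le _ _).trans ?_
  have := hz u
  have := hθ u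
  gcongr

theorem norm_adj_sub_time_le (hF : Activation F A D C) (hℓ : IsLoss ℓ b R C) {θ : C(I, W)} {x : E}
    {K : ℝ} (hx : ‖x‖ ≤ R) (hθ : ∀ t, ‖θ t‖ ≤ K) (t r : I) :
    ‖adj volume F A b θ x t - adj volume F A b θ x r‖
      ≤ C * K * adjBound C R (K ^ 2) * |(t : ℝ) - r| := by
  have hT := isTimeScale_unitInterval (E := E)
  have hC := hF.pos
  have hq := norm_adj_le hT hF hℓ (sq_nonneg K) hx (integral_sq_norm_le hθ)
  rw [isAdjoint_adj hT hF θ x t, isAdjoint_adj hT hF θ x r, add_sub_add_left_eq_sub]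
  refine norm_integral_Ioi_sub_le (hF.continuous_adjoint_A_comp (state volume F θ x).continuous
    (adj volume F A b θ x).continuous θ) (fun u => ?_) t r
  refine (norm_adjoint_apply_le _ _).trans ?_
  have := hF.norm_A_le (state volume F θ x u) (θ u)
  have := hθ u
  have := hq u
  calc _ ≤ (C * ‖θ u‖) * adjBound C R (K ^ 2) := by gcongr
    _ ≤ _ := by
      have := adjBound_nonneg (K := K ^ 2) hC.le hℓ.radius_nonneg (sq_nonneg K)
      gcongr

/-- A Lipschitz constant in time of the gradient, modulo the parameters. -/
def timeLip (C R K : ℝ) : ℝ :=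
  C * K * (2 * stateBound C R (K ^ 2)) * adjBound C R (K ^ 2)
      * (C * stateBound C R (K ^ 2) * (K + 1))
    + C * stateBound C R (K ^ 2) ^ 2 * adjBound C R (K ^ 2)
    + C * stateBound C R (K ^ 2) * (C * K * adjBound C R (K ^ 2))

theorem timeLip_nonneg {C R K : ℝ} (hC : 0 ≤ C) (hR : 0 ≤ R) (hK : 0 ≤ K) :
    0 ≤ timeLip C R K := by
  have h1 := zero_le_one.trans (one_le_stateBound C hR (sq_nonneg K))
  have h2 := adjBound_nonneg hC hR (sq_nonneg K)
  unfold timeLip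
  positivity

/-- The gradient depends on `t` through the state and the adjoint state, which are Lipschitz in
time, and through `θ t`, for which no modulus of continuity is available. Its variation therefore
stays in the bound. -/
theorem norm_grad_sub_time_le (hF : Activation F A D C) (hℓ : IsLoss ℓ b R C)
    (hμ : ∀ᵐ x ∂μ, ‖x‖ ≤ R) {θ : C(I, W)} {K : ℝ}
    (hK : 0 ≤ K) (hθ : ∀ t, ‖θ t‖ ≤ K) (t r : I) :
    ‖grad volume F A D b μ θ t - grad volume F A D b μ θ r‖
      ≤ timeLip C R K * (‖θ t - θ r‖ + |(t : ℝ) - r|) := by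
  have hT := isTimeScale_unitInterval (E := E)
  have hC := hF.pos
  have hR := hℓ.radius_nonneg
  have hB0 := zero_le_one.trans (one_le_stateBound C hR (sq_nonneg K))
  have hQ0 := adjBound_nonneg hC.le hR (sq_nonneg K)
  have hI := integral_sq_norm_le (ν := (volume : Measure I)) hθ
  rw [grad_apply hT hF hℓ hμ, grad_apply hT hF hℓ hμ,
    ← integral_sub (integrable_gradIntegrand hT hF hℓ hμ θ t)
      (integrable_gradIntegrand hT hF hℓ hμ θ r)]
  refine norm_integral_le_of_ball hμ fun x hx => ?_
  have hz := norm_state_le hT hF (sq_nonneg K) hx hI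
  refine (hF.norm_adjoint_D_sub_le (hz t) (hz r) (hθ t)
    (norm_adj_le hT hF hℓ (sq_nonneg K) hx hI t)).trans ?_
  have h1 := norm_state_sub_time_le hF hx hθ t r
  have h2 := norm_adj_sub_time_le hF hℓ hx hθ t r
  set B := stateBound C R (K ^ 2)
  set Q := adjBound C R (K ^ 2)
  set δ := |(t : ℝ) - r|
  set η := ‖θ t - θ r‖
  have hδ : 0 ≤ δ := abs_nonneg _
  have hη : 0 ≤ η := norm_nonneg _
  calc _ ≤ C * K * (2 * B) * Q * (C * B * (K + 1) * δ) + C * B ^ 2 * Q * η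
        + C * B * (C * K * Q * δ) := by gcongr
    _ ≤ C * K * (2 * B) * Q * (C * B * (K + 1) * (η + δ)) + C * B ^ 2 * Q * (η + δ)
        + C * B * (C * K * Q * (η + δ)) := by
        gcongr <;> linarith
    _ = _ := by rw [timeLip]; ring

/-- The restriction of a path to the grid. -/
def gridRestrict (L : ℕ) (θ : C(I, W)) : C(Fin L, W) :=
  ⟨fun l => θ (gridPoint L l), continuous_of_discreteTopology⟩

/-- Turns the mean square bound `V/L²` into a first order bound `O(1/L)`, through `a ≤ 1/L + L a²`,
whose two terms balance at this scale. -/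
theorem cellSum_le_of_le {L : ℕ} (hL : 0 < L) {θ : C(I, W)} {V a c : ℝ} (hc : 0 ≤ c)
    (hV : cellSum L (fun t r => ‖θ t - θ r‖ ^ 2) ≤ V / (L : ℝ) ^ 2) {ψ : I → I → ℝ}
    (hψ : ∀ r, Continuous fun t => ψ t r)
    (h : ∀ t r : I, |(t : ℝ) - r| ≤ 1 / L → ψ t r ≤ a * (1 / L) + c * ‖θ t - θ r‖) :
    cellSum L ψ ≤ (a + c * (V + 1)) * (1 / L) := by
  have hL' : (0 : ℝ) < L := by exact_mod_cast hL
  have hcont : ∀ r, Continuous fun t => ‖θ t - θ r‖ ^ 2 := fun r => by fun_prop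
  calc cellSum L ψ
      ≤ cellSum L fun t r => (a * (1 / L) + c * (1 / L)) + (c * L) * ‖θ t - θ r‖ ^ 2 := by
        refine cellSum_le hL hψ (fun r => by fun_prop) fun t r htr => (h t r htr).trans ?_
        have h1 : ‖θ t - θ r‖ ≤ 1 / L + L * ‖θ t - θ r‖ ^ 2 := by
          have h2 : 0 ≤ (1 / L : ℝ) * ((L * ‖θ t - θ r‖ - 1) ^ 2 + L * ‖θ t - θ r‖) := by positivity
          have h3 : (1 / L : ℝ) * ((L * ‖θ t - θ r‖ - 1) ^ 2 + L * ‖θ t - θ r‖)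
              = 1 / L + L * ‖θ t - θ r‖ ^ 2 - ‖θ t - θ r‖ := by field_simp; ring
          linarith
        nlinarith [mul_le_mul_of_nonneg_left h1 hc]
    _ = (a * (1 / L) + c * (1 / L)) + (c * L) * cellSum L fun t r => ‖θ t - θ r‖ ^ 2 :=
        cellSum_const_add_mul hL hcont _ _
    _ ≤ (a * (1 / L) + c * (1 / L)) + (c * L) * (V / (L : ℝ) ^ 2) := by gcongr
    _ = _ := by field_simp; ring

set_option maxHeartbeats 1000000 in
/-- Nearby parameters at continuous and at finite depth have nearby states and gradients. -/
theorem exists_grid_comparison (hC : 1 ≤ C) (hℓ : IsLoss ℓ b R C) (hμ : ∀ᵐ x ∂μ, ‖x‖ ≤ R)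
    {K V : ℝ} (hK : 0 < K) (hV : 0 ≤ V) :
    ∃ c, 0 ≤ c ∧ ∀ {W : Type} [NormedAddCommGroup W] [InnerProductSpace ℝ W] [CompleteSpace W]
      {F : E → W → E} {A : E → W → E →L[ℝ] E} {D : E → W → W →L[ℝ] E} (_ : Activation F A D C)
      (L : ℕ) [NeZero L] (θ : C(I, W)) (θ' : C(Fin L, W)) (Δ : ℝ), (∀ t, ‖θ t‖ ≤ K) →
      (∀ l, ‖θ' l‖ ≤ K) → cellSum L (fun t r => ‖θ t - θ r‖ ^ 2) ≤ V / (L : ℝ) ^ 2 → 0 ≤ Δ →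
      (∀ l : Fin L, ‖θ (gridPoint L l) - θ' l‖ ≤ Δ) →
      (∀ x, ‖x‖ ≤ R → ‖finalState volume F θ x - finalState (gridMeasure L) F θ' x‖
        ≤ c * (Δ + 1 / L)) ∧
      ∀ l : Fin L, ‖grad volume F A D b μ θ (gridPoint L l)
        - grad (gridMeasure L) F A D b μ θ' l‖ ≤ c * (Δ + 1 / L) := by
  have hC0 : 0 < C := one_pos.trans_le hC
  have hR := hℓ.radius_nonneg
  set B := stateBound C R (K ^ 2)
  have hB : 0 ≤ B := zero_le_one.trans (one_le_stateBound C hR (sq_nonneg K))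
  set Q := adjBound C R (K ^ 2)
  have hQ : 0 ≤ Q := adjBound_nonneg hC0.le hR (sq_nonneg K)
  set e := Real.exp (2 * (C * K))
  -- Constants in order of use: `c₀` and `c₃` for the quadrature errors of the forward and adjoint
  -- fields; `c₁`, `c₂`, `c₄`, `c₅` for the differences of states, terminal states, adjoint states
  -- and gradients. They are fixed before `W`, `F` and `L`, so they depend on neither the depth nor
  -- the number of particles.
  set c₀ := C * K * (C * B * (K + 1)) + C * B * (V + 1) with hc₀
  set c₁ := 2 * (c₀ + C * B) * e with hc₁
  set c₂ := c₀ + (C * K * c₁ + C * B) with hc₂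
  set c₃ := ((C * K ^ 2 * (C * B * (K + 1))) * Q + C * K * (C * K * Q))
    + (C * (2 * K) * B) * Q * (V + 1) with hc₃
  set c₄ := 2 * ((C * (2 * B) * c₂ + (c₃ + C * K * Q))
    + (C * K ^ 2 * c₁ + C * (2 * K) * B) * Q) * e with hc₄
  set c₅ := C * K * (2 * B) * Q * c₁ + C * B ^ 2 * Q + C * B * c₄ with hc₅
  have h₀ : 0 ≤ c₀ := by positivity
  have h₁ : 0 ≤ c₁ := by positivity
  have h₂ : 0 ≤ c₂ := by positivity
  have h₃ : 0 ≤ c₃ := by positivity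
  have h₄ : 0 ≤ c₄ := by positivity
  have h₅ : 0 ≤ c₅ := by positivity
  refine ⟨c₂ + c₅, by positivity, fun {W} _ _ _ {F A D} hF L _ θ θ' Δ hθ hθ' hcell hΔ hθΔ => ?_⟩
  have hL : 0 < L := Nat.pos_of_ne_zero (NeZero.ne L)
  have hL' : (0 : ℝ) < L := by exact_mod_cast hL
  have hT := isTimeScale_unitInterval (E := E)
  have hG := isTimeScale_gridMeasure (E := E) L
  set κ := Δ + 1 / (L : ℝ) with hκ
  have hκL : 1 / (L : ℝ) ≤ κ := by simp [hκ, hΔ]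
  have hκΔ : Δ ≤ κ := by rw [hκ]; have : 0 ≤ 1 / (L : ℝ) := by positivity
                         linarith
  have hκ0 : 0 ≤ κ := hΔ.trans hκΔ
  have hI := integral_sq_norm_le (ν := (volume : Measure I)) hθ
  have hI' := integral_sq_norm_le (ν := gridMeasure L) hθ'
  have hLL : ((L : ℕ) : ℝ) / L = 1 := div_self hL'.ne'
  have key : ∀ x, ‖x‖ ≤ R →
      (∀ l : Fin L, ‖state volume F θ x (gridPoint L l) - state (gridMeasure L) F θ' x l‖ ≤ c₁ * κ)
      ∧ ‖finalState volume F θ x - finalState (gridMeasure L) F θ' x‖ ≤ c₂ * κ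
      ∧ ∀ l : Fin L, ‖adj volume F A b θ x (gridPoint L l) - adj (gridMeasure L) F A b θ' x l‖
        ≤ c₄ * κ := by
    intro x hx
    set z := state volume F θ x with hz
    set z' := state (gridMeasure L) F θ' x with hz'
    set q := adj volume F A b θ x with hq
    set q' := adj (gridMeasure L) F A b θ' x with hq'
    have hzB : ∀ t, ‖z t‖ + 1 ≤ B := norm_state_le hT hF (sq_nonneg K) hx hI
    have hzB' : ∀ t, ‖z' t‖ + 1 ≤ B := norm_state_le hG hF (sq_nonneg K) hx hI'
    have hqQ : ∀ t, ‖q t‖ ≤ Q := norm_adj_le hT hF hℓ (sq_nonneg K) hx hI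
    have hqQ' : ∀ t, ‖q' t‖ ≤ Q := norm_adj_le hG hF hℓ (sq_nonneg K) hx hI'
    have hzt : ∀ t r : I, |(t : ℝ) - r| ≤ 1 / L → ‖z t - z r‖ ≤ C * B * (K + 1) * (1 / L) :=
      fun t r htr => (norm_state_sub_time_le hF hx hθ t r).trans (by gcongr)
    have hqt : ∀ t r : I, |(t : ℝ) - r| ≤ 1 / L → ‖q t - q r‖ ≤ C * K * Q * (1 / L) :=
      fun t r htr => (norm_adj_sub_time_le hF hℓ hx hθ t r).trans (by gcongr)
    let φ : I → E := fun t => F (z t) (θ t)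
    have hφ : Continuous φ := hF.continuous_comp z.continuous θ
    have hcφ : cellSum L (fun t r => ‖φ t - φ r‖) ≤ c₀ * κ := by
      refine (cellSum_le_of_le (a := C * K * (C * B * (K + 1))) (c := C * B) hL (by positivity)
        hcell (fun r => by fun_prop) fun t r htr => ?_).trans (by rw [hc₀]; gcongr)
      refine (hF.norm_sub_le (hzB r) (hθ t)).trans ?_
      have := hzt t r htr
      rw [mul_assoc (C * K)]
      gcongr
    let v : I → E := fun t => (A (z t) (θ t)).adjoint (q t)
    have hv : Continuous v := hF.continuous_adjoint_A_comp z.continuous q.continuous θ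
    have hvb : ∀ t, ‖v t‖ ≤ C * K * Q := fun t => by
      refine (norm_adjoint_apply_le _ _).trans ?_
      have := hF.norm_A_le (z t) (θ t)
      have := hθ t
      have := hqQ t
      calc _ ≤ (C * ‖θ t‖) * Q := by gcongr
        _ ≤ _ := by gcongr
    have hcv : cellSum L (fun t r => ‖v t - v r‖) ≤ c₃ * κ := by
      refine (cellSum_le_of_le (a := (C * K ^ 2 * (C * B * (K + 1))) * Q + C * K * (C * K * Q))
        (c := (C * (2 * K) * B) * Q) hL (by positivity) hcell (fun r => by fun_prop)
        fun t r htr => ?_).trans (by rw [hc₃]; gcongr)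
      have h1 : v t - v r = (A (z t) (θ t) - A (z r) (θ r)).adjoint (q r)
          + (A (z t) (θ t)).adjoint (q t - q r) := by
        simp only [v, map_sub, sub_apply]; abel
      have h2 := hF.norm_A_sub_le (x := z t) (hzB r) (hθ t) (hθ r)
      have h3 : ‖A (z t) (θ t)‖ ≤ C * K := (hF.norm_A_le _ _).trans (by gcongr; exact hθ t)
      have h4 := hzt t r htr
      rw [h1]
      calc _ ≤ ‖A (z t) (θ t) - A (z r) (θ r)‖ * ‖q r‖ + ‖A (z t) (θ t)‖ * ‖q t - q r‖ :=
            (norm_add_le _ _).trans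
              (add_le_add (norm_adjoint_apply_le _ _) (norm_adjoint_apply_le _ _))
        _ ≤ (C * K ^ 2 * (C * B * (K + 1) * (1 / L)) + C * (2 * K) * B * ‖θ t - θ r‖) * Q
            + (C * K) * (C * K * Q * (1 / L)) := by
            gcongr
            · exact h2.trans (by gcongr)
            · exact hqQ r
            · exact hqt t r htr
        _ = _ := by ring
    have hΔ' : ∀ l : Fin L, ‖gridRestrict L θ l - θ' l‖ ≤ Δ := hθΔ
    have hθg : ∀ l : Fin L, ‖gridRestrict L θ l‖ ≤ K := fun l => hθ _
    have hcz : Continuous fun l : Fin L => z (gridPoint L l) := continuous_of_discreteTopology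
    have hcq : Continuous fun l : Fin L => q (gridPoint L l) := continuous_of_discreteTopology
    -- The sampled continuous state solves the grid equation with the sampled parameters up to the
    -- quadrature error `c₀ κ`. Stability on the grid compares it with the true grid state.
    have hstate : ∀ l : Fin L, ‖z (gridPoint L l) - z' l‖ ≤ c₁ * κ := fun l => by
      refine (norm_state_sub_le hG hF (θ := gridRestrict L θ) (θ' := θ')
        (z := fun l : Fin L => z (gridPoint L l)) hcz z'.continuous
        hK hΔ (by positivity : 0 ≤ c₀ * κ) hB hθg hzB' hΔ' (fun l => ?_) l).trans ?_
      · have h1 : z (gridPoint L l) = x + ∫ t in (0 : ℝ)..((l : ℕ) / L), φ (toI t) := by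
          rw [hz, isState_state hT hF θ x, integral_Iio_unitInterval, coe_gridPoint l.2.le]
        have h2 : ∫ j : Fin L in Set.Iio l, F (z (gridPoint L j)) (gridRestrict L θ j) ∂gridMeasure L
            = (L : ℝ)⁻¹ • ∑ j ∈ Finset.Ico 0 (l : ℕ), φ (gridPoint L j) := by
          rw [← Finset.range_eq_Ico]
          exact integral_Iio_gridMeasure (fun j => φ (gridPoint L j)) l
        have h3 : z' l - ∫ j in Set.Iio l, F (z' j) (θ' j) ∂gridMeasure L = x := by
          rw [hz']; nth_rw 1 [isState_state hG hF θ' x l]; simp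
        have h4 := norm_integral_sub_sum_le hL hφ (Nat.zero_le (l : ℕ)) l.2.le
        simp only [Nat.cast_zero, zero_div] at h4
        rw [h3, h2, h1]
        refine le_trans (le_of_eq ?_) (h4.trans hcφ)
        congr 1; abel
      · calc _ ≤ 2 * (c₀ * κ + C * B * κ) * e := by gcongr
          _ = _ := by rw [hc₁]; ring
    have hfinal : ‖finalState volume F θ x - finalState (gridMeasure L) F θ' x‖ ≤ c₂ * κ := by
      have h1 : finalState volume F θ x = x + ∫ t in (0 : ℝ)..1, φ (toI t) := by
        rw [finalState, integral_unitInterval]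
      have h2 : ∫ j : Fin L, F (z (gridPoint L j)) (gridRestrict L θ j) ∂gridMeasure L
          = (L : ℝ)⁻¹ • ∑ j ∈ Finset.Ico 0 L, φ (gridPoint L j) := by
        rw [← Finset.range_eq_Ico]
        exact integral_gridMeasure_nat fun j => φ (gridPoint L j)
      have h4 := norm_integral_sub_sum_le hL hφ (Nat.zero_le L) le_rfl
      simp only [Nat.cast_zero, zero_div, hLL] at h4
      rw [← h2] at h4
      have h5 := norm_integral_sub_le (ν := gridMeasure L) hF (θ := gridRestrict L θ) (θ' := θ')
        (z := fun l : Fin L => z (gridPoint L l)) hcz z'.continuous hB hθg hzB' hΔ' hstate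
      rw [h1, finalState, add_sub_add_left_eq_sub, ← sub_add_sub_cancel]
      refine (norm_add_le _ _).trans ((add_le_add (h4.trans hcφ) h5).trans ?_)
      calc _ ≤ c₀ * κ + (C * K * (c₁ * κ) + C * B * κ) := by gcongr
        _ = _ := by rw [hc₂]; ring
    refine ⟨hstate, hfinal, fun l => ?_⟩
    set p := b x (finalState volume F θ x)
    set p' := b x (finalState (gridMeasure L) F θ' x)
    have hp : ‖p - p'‖ ≤ C * (2 * B) * (c₂ * κ) := by
      refine (hℓ.norm_grad_sub_le _ _ _ hx).trans ?_
      have h1 := norm_finalState_le hT hF (sq_nonneg K) hx hI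
      have h2 := norm_finalState_le hG hF (sq_nonneg K) hx hI'
      gcongr
      linarith
    refine (norm_adj_sub_le hG hF (θ := gridRestrict L θ) (θ' := θ')
      (z := fun l : Fin L => z (gridPoint L l)) (q := fun l : Fin L => q (gridPoint L l)) hcz
      z'.continuous hcq q'.continuous hK hΔ
      (by positivity : 0 ≤ C * (2 * B) * (c₂ * κ) + (c₃ * κ + C * K * Q * κ)) hB hQ
      (by positivity : 0 ≤ c₁ * κ) hθg hθ' hzB' hqQ' hstate hΔ' (fun l => ?_) l).trans ?_
    · have h1 : q (gridPoint L l) = p + ∫ t in ((l : ℕ) / L : ℝ)..1, v (toI t) := by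
        rw [hq, isAdjoint_adj hT hF θ x, integral_Ioi_unitInterval, coe_gridPoint l.2.le]
      have h2 : ∫ j : Fin L in Set.Ioi l, (A (z (gridPoint L j)) (gridRestrict L θ j)).adjoint
            (q (gridPoint L j)) ∂gridMeasure L
          = (L : ℝ)⁻¹ • ∑ j ∈ Finset.Ico ((l : ℕ) + 1) L, v (gridPoint L j) :=
        integral_Ioi_gridMeasure (fun j => v (gridPoint L j)) l
      have h3 : q' l - ∫ j in Set.Ioi l, (A (z' j) (θ' j)).adjoint (q' j) ∂gridMeasure L = p' :=
        sub_eq_iff_eq_add.2 (isAdjoint_adj hG hF θ' x l)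
      have h4 := norm_integral_sub_sum_le hL hv l.2.le le_rfl
      -- Quadrature of the integral from `l/L` to `1` uses the node `l`, which the strict future in
      -- the grid adjoint equation omits. The extra term has norm at most `C K Q / L`.
      rw [Finset.sum_eq_sum_Ico_succ_bot l.2, smul_add, hLL] at h4
      rw [h3, h2, h1]
      have h5 : ‖(L : ℝ)⁻¹ • v (gridPoint L l)‖ ≤ C * K * Q * κ := by
        rw [norm_smul, Real.norm_of_nonneg (by positivity), mul_comm]
        have := hvb (gridPoint L l)
        rw [one_div] at hκL
        gcongr
      set s₁ := ∫ t in ((l : ℕ) / L : ℝ)..1, v (toI t)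
      set s₂ := (L : ℝ)⁻¹ • v (gridPoint L l)
      set s₃ := (L : ℝ)⁻¹ • ∑ j ∈ Finset.Ico ((l : ℕ) + 1) L, v (gridPoint L j)
      have h6 : p + s₁ - s₃ - p' = (p - p') + ((s₁ - (s₂ + s₃)) + s₂) := by abel
      rw [h6]
      exact (norm_add_le _ _).trans (add_le_add hp
        ((norm_add_le _ _).trans (add_le_add (h4.trans hcv) h5)))
    · calc _ ≤ 2 * (C * (2 * B) * (c₂ * κ) + (c₃ * κ + C * K * Q * κ)
            + (C * K ^ 2 * (c₁ * κ) + C * (2 * K) * B * κ) * Q) * e := by gcongr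
        _ = _ := by rw [hc₄]; ring
  refine ⟨fun x hx => (key x hx).2.1.trans (by gcongr; linarith), fun l => ?_⟩
  rw [grad_apply hT hF hℓ hμ, grad_apply hG hF hℓ hμ,
    ← integral_sub (integrable_gradIntegrand hT hF hℓ hμ θ _)
      (integrable_gradIntegrand hG hF hℓ hμ θ' l)]
  refine norm_integral_le_of_ball hμ fun x hx => ?_
  obtain ⟨hz, -, hq⟩ := key x hx
  refine (hF.norm_adjoint_D_sub_le (norm_state_le hT hF (sq_nonneg K) hx hI _)
    (norm_state_le hG hF (sq_nonneg K) hx hI' l) (hθ _)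
    (norm_adj_le hT hF hℓ (sq_nonneg K) hx hI _)).trans ?_
  calc _ ≤ C * K * (2 * B) * Q * (c₁ * κ) + C * B ^ 2 * Q * κ + C * B * (c₄ * κ) := by
        gcongr
        · exact hz l
        · exact (hθΔ l).trans hκΔ
        · exact hq l
    _ = c₅ * κ := by rw [hc₅]; ring
    _ ≤ _ := by gcongr; linarith

end Comparison

/-! ### Gronwall in the training time `s`: comparison of the two flows. -/

section FlowComparison

variable {E : Type*} [NormedAddCommGroup E] [InnerProductSpace ℝ E] [CompleteSpace E]
  [MeasurableSpace E] [BorelSpace E] [SecondCountableTopology E]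
  {C : ℝ} {ℓ : E → E → ℝ} {b : E → E → E} {R : ℝ} {μ : Measure E} [IsProbabilityMeasure μ]

theorem norm_two_mul_exp_neg_smul_le {V : Type*} [NormedAddCommGroup V] [NormedSpace ℝ V] {s : ℝ}
    (hs : 0 ≤ s) (v : V) : ‖(2 * Real.exp (-s)) • v‖ ≤ 2 * ‖v‖ := by
  rw [norm_smul, Real.norm_of_nonneg (by positivity)]
  have : Real.exp (-s) ≤ 1 := Real.exp_le_one_iff.2 (by linarith)
  gcongr
  linarith

theorem IsLoss.abs_sub_le (hℓ : IsLoss ℓ b R C) (hC : 0 ≤ C) {B : ℝ} {x z z' : E} (hx : ‖x‖ ≤ R)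
    (hz : ‖z‖ + 1 ≤ B) (hz' : ‖z'‖ + 1 ≤ B) :
    |ℓ x z' - ℓ x z| ≤ (C * (2 * B) * (2 * B) + C * B) * ‖z' - z‖ := by
  have hB : 0 ≤ B := by linarith [norm_nonneg z]
  have h1 := hℓ.taylor x z z' hx
  have h2 : |inner ℝ (b x z) (z' - z)| ≤ C * B * ‖z' - z‖ := by
    refine (abs_real_inner_le_norm _ _).trans ?_
    gcongr
    exact (hℓ.norm_grad_le x z hx).trans (by gcongr; linarith)
  have h3 : C * (1 + ‖z‖ + ‖z'‖) * ‖z' - z‖ ^ 2 ≤ C * (2 * B) * (2 * B) * ‖z' - z‖ := by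
    have h4 : ‖z' - z‖ ≤ 2 * B := (norm_sub_le _ _).trans (by linarith)
    have h5 : 1 + ‖z‖ + ‖z'‖ ≤ 2 * B := by linarith
    calc _ = C * (1 + ‖z‖ + ‖z'‖) * ‖z' - z‖ * ‖z' - z‖ := by ring
      _ ≤ _ := by gcongr
  have h6 : ℓ x z' - ℓ x z
      = (ℓ x z' - ℓ x z - inner ℝ (b x z) (z' - z)) + inner ℝ (b x z) (z' - z) := by ring
  rw [h6]
  refine (abs_add_le _ _).trans ((add_le_add (h1.trans h3) h2).trans (le_of_eq (by ring)))

/-- Deviations within the cells of the grid propagate along the continuous flow. -/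
theorem IsFlow.cellSum_le {W : Type*} [NormedAddCommGroup W] [InnerProductSpace ℝ W]
    [CompleteSpace W] {F : E → W → E} {A : E → W → E →L[ℝ] E} {D : E → W → W →L[ℝ] E}
    (hF : Activation F A D C) (hℓ : IsLoss ℓ b R C) (hμ : ∀ᵐ x ∂μ, ‖x‖ ≤ R)
    {θ : ℝ → C(I, W)} (hθ : IsFlow (grad volume F A D b μ) θ) {K S V : ℝ} (hK : 0 ≤ K)
    (hθK : ∀ s, 0 ≤ s → s < S → ∀ t, ‖θ s t‖ ≤ K) {L : ℕ} (hL : 0 < L)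
    (hV : cellSum L (fun t r => ‖θ 0 t - θ 0 r‖ ^ 2) ≤ V / (L : ℝ) ^ 2) {s : ℝ} (hs : 0 ≤ s)
    (hsS : s < S) :
    cellSum L (fun t r => ‖θ s t - θ s r‖ ^ 2) ≤ (2 * Real.exp ((timeLip C R K + 2) * S) ^ 2
      * ((timeLip C R K + 2) ^ 2 + V)) / (L : ℝ) ^ 2 := by
  have hL' : (0 : ℝ) < L := by exact_mod_cast hL
  have ht0 := timeLip_nonneg hF.pos.le hℓ.radius_nonneg hK
  set c := timeLip C R K + 2 with hc
  set M := Real.exp (c * S) with hM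
  have hM0 : 0 < M := Real.exp_pos _
  -- Gronwall in `s` for the difference of the parameters at two fixed times, with forcing `c |t -
  -- r|` supplied by `norm_grad_sub_time_le`.
  have hpt : ∀ t r : I, ‖θ s t - θ s r‖ ≤ (‖θ 0 t - θ 0 r‖ + c * |(t : ℝ) - r|) * M := fun t r => by
    have hce : ∀ t : I, ContinuousOn (fun s => θ s t) (Set.Ici 0) := fun t =>
      (ContinuousEvalConst.continuous_eval_const t).comp_continuousOn hθ.continuousOn
    refine (norm_le_mul_exp_of_norm_deriv_le (f := fun s => θ s t - θ s r) (K := c)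
      (ε := c * |(t : ℝ) - r|) (S := S) (by linarith) (by positivity) ((hce t).sub (hce r))
      (fun s hs => (hθ.hasDerivAt s hs t).fun_sub (hθ.hasDerivAt s hs r)) (fun s hs hsS => ?_)
      hs hsS).trans ?_
    · have h1 := norm_grad_sub_time_le hF hℓ hμ hK (hθK s hs.le hsS) t r
      have h2 := norm_two_mul_exp_neg_smul_le hs.le (θ s t - θ s r)
      set G := grad volume F A D b μ (θ s)
      have h3 : -(G t) - (2 * Real.exp (-s)) • θ s t - (-(G r) - (2 * Real.exp (-s)) • θ s r)
          = -(G t - G r) - (2 * Real.exp (-s)) • (θ s t - θ s r) := by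
        rw [smul_sub]; abel
      rw [h3]
      refine (norm_sub_le _ _).trans ?_
      rw [norm_neg]
      have h4 : 0 ≤ |(t : ℝ) - r| := abs_nonneg _
      rw [hc]
      nlinarith
    · rw [hM]; gcongr
  calc cellSum L (fun t r => ‖θ s t - θ s r‖ ^ 2)
      ≤ cellSum L fun t r => 2 * M ^ 2 * (c * (1 / L)) ^ 2 + 2 * M ^ 2 * ‖θ 0 t - θ 0 r‖ ^ 2 := by
        refine DeepResNet.cellSum_le hL (fun r => by fun_prop) (fun r => by fun_prop) fun t r htr => ?_
        calc ‖θ s t - θ s r‖ ^ 2 ≤ ((‖θ 0 t - θ 0 r‖ + c * (1 / L)) * M) ^ 2 := by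
              gcongr
              exact (hpt t r).trans (by gcongr)
          _ ≤ _ := by
              have := mul_nonneg (sq_nonneg M) (sq_nonneg (‖θ 0 t - θ 0 r‖ - c * (1 / L)))
              nlinarith
    _ = 2 * M ^ 2 * (c * (1 / L)) ^ 2
        + 2 * M ^ 2 * cellSum L fun t r => ‖θ 0 t - θ 0 r‖ ^ 2 :=
        cellSum_const_add_mul hL (fun r => by fun_prop) _ _
    _ ≤ 2 * M ^ 2 * (c * (1 / L)) ^ 2 + 2 * M ^ 2 * (V / (L : ℝ) ^ 2) := by gcongr
    _ = _ := by field_simp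

/-- The losses along the flows at continuous and at finite depth differ by `O(1/L)`. -/
theorem exists_flow_comparison (hC : 1 ≤ C) (hℓ : IsLoss ℓ b R C) (hμ : ∀ᵐ x ∂μ, ‖x‖ ≤ R)
    {K₀ V₀ S : ℝ} (hK₀ : 0 ≤ K₀) (hV₀ : 0 ≤ V₀) :
    ∃ c, 0 ≤ c ∧ ∀ {W : Type} [NormedAddCommGroup W] [InnerProductSpace ℝ W] [CompleteSpace W]
      {F : E → W → E} {A : E → W → E →L[ℝ] E} {D : E → W → W →L[ℝ] E} (_ : Activation F A D C)
      (L : ℕ) [NeZero L] (θ : ℝ → C(I, W)) (θ' : ℝ → C(Fin L, W)),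
      IsFlow (grad volume F A D b μ) θ → IsFlow (grad (gridMeasure L) F A D b μ) θ' →
      (∀ l : Fin L, θ' 0 l = θ 0 (gridPoint L l)) → (∀ t, ‖θ 0 t‖ ≤ K₀) →
      cellSum L (fun t r => ‖θ 0 t - θ 0 r‖ ^ 2) ≤ V₀ / (L : ℝ) ^ 2 →
      ∀ s, 0 ≤ s → s < S →
        |loss volume F ℓ μ (θ s) - loss (gridMeasure L) F ℓ μ (θ' s)| ≤ c * (1 / L) := by
  have hC0 : 0 < C := one_pos.trans_le hC
  have hR := hℓ.radius_nonneg
  set K := max (flowBound C R K₀ S) 1 with hKdef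
  have hK : 0 < K := lt_max_of_lt_right one_pos
  set V := 2 * Real.exp ((timeLip C R K + 2) * S) ^ 2 * ((timeLip C R K + 2) ^ 2 + V₀) with hV
  have hV0 : 0 ≤ V := by positivity
  obtain ⟨c, hc, hcomp⟩ := exists_grid_comparison hC hℓ hμ hK hV0
  set B := stateBound C R (K ^ 2)
  have hB : 0 ≤ B := zero_le_one.trans (one_le_stateBound C hR (sq_nonneg K))
  set M := Real.exp ((c + 2) * S) with hM
  refine ⟨(C * (2 * B) * (2 * B) + C * B) * (c * (c * M + 1)), by positivity,
    fun {W} _ _ _ {F A D} hF L _ θ θ' hθ hθ' h0 hθK hcell => ?_⟩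
  have hL : 0 < L := Nat.pos_of_ne_zero (NeZero.ne L)
  have hL' : (0 : ℝ) < L := by exact_mod_cast hL
  have hT := isTimeScale_unitInterval (E := E)
  have hG := isTimeScale_gridMeasure (E := E) L
  have hbd : ∀ s, 0 ≤ s → s < S → ∀ t, ‖θ s t‖ ≤ K := fun s hs hsS t =>
    (hθ.norm_le hT hF hℓ hμ hK₀ hθK hs hsS t).trans (le_max_left _ _)
  have hbd' : ∀ s, 0 ≤ s → s < S → ∀ t, ‖θ' s t‖ ≤ K := fun s hs hsS t =>
    (hθ'.norm_le hG hF hℓ hμ hK₀ (fun l => by rw [h0]; exact hθK _) hs hsS t).trans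
      (le_max_left _ _)
  have hcells : ∀ s, 0 ≤ s → s < S →
      cellSum L (fun t r => ‖θ s t - θ s r‖ ^ 2) ≤ V / (L : ℝ) ^ 2 := fun s hs hsS =>
    hθ.cellSum_le hF hℓ hμ hK.le hbd hL hcell hs hsS
  -- The parameter difference at the grid points, in sup norm over the layers. It vanishes at `s =
  -- 0`, so only the forcing `c / L` survives in Gronwall.
  let g : ℝ → Fin L → W := fun s l => θ s (gridPoint L l) - θ' s l
  have hgl : ∀ s (l : Fin L), ‖θ s (gridPoint L l) - θ' s l‖ ≤ ‖g s‖ := fun s l =>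
    norm_le_pi_norm (g s) l
  have hg : ∀ s, 0 ≤ s → s < S → ‖g s‖ ≤ c * M * (1 / L) := fun s hs hsS => by
    have h := norm_le_mul_exp_of_norm_deriv_le (f := g)
      (f' := fun s l => (-(grad volume F A D b μ (θ s) (gridPoint L l))
        - (2 * Real.exp (-s)) • θ s (gridPoint L l))
        - (-(grad (gridMeasure L) F A D b μ (θ' s) l) - (2 * Real.exp (-s)) • θ' s l))
      (K := c + 2) (ε := c * (1 / L)) (S := S) (by linarith) (by positivity)
      (continuousOn_pi.2 fun l =>
        ((ContinuousEvalConst.continuous_eval_const (gridPoint L l)).comp_continuousOn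
          hθ.continuousOn).sub
        ((ContinuousEvalConst.continuous_eval_const l).comp_continuousOn hθ'.continuousOn))
      (fun s hs => hasDerivAt_pi.2 fun l =>
        (hθ.hasDerivAt s hs (gridPoint L l)).fun_sub (hθ'.hasDerivAt s hs l))
      (fun s hs hsS => (pi_norm_le_iff_of_nonneg (by positivity)).2 fun l => ?_) hs hsS
    · have hg0 : ‖g 0‖ = 0 := by
        rw [norm_eq_zero]
        funext l
        simp only [g, h0, sub_self, Pi.zero_apply]
      rw [hg0, zero_add] at h
      calc ‖g s‖ ≤ c * (1 / L) * Real.exp ((c + 2) * s) := h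
        _ ≤ c * (1 / L) * M := by rw [hM]; gcongr
        _ = _ := by ring
    -- Taking `Δ = ‖g s‖` closes the differential inequality.
    · have h1 := (hcomp hF L (θ s) (θ' s) ‖g s‖ (hbd s hs.le hsS) (hbd' s hs.le hsS)
        (hcells s hs.le hsS) (norm_nonneg _) (hgl s)).2 l
      have h2 := norm_two_mul_exp_neg_smul_le hs.le (θ s (gridPoint L l) - θ' s l)
      have h3 := hgl s l
      set G := grad volume F A D b μ (θ s) (gridPoint L l)
      set G' := grad (gridMeasure L) F A D b μ (θ' s) l
      have h4 : -G - (2 * Real.exp (-s)) • θ s (gridPoint L l)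
          - (-G' - (2 * Real.exp (-s)) • θ' s l)
          = -(G - G') - (2 * Real.exp (-s)) • (θ s (gridPoint L l) - θ' s l) := by
        rw [smul_sub]; abel
      rw [h4]
      refine (norm_sub_le _ _).trans ?_
      rw [norm_neg]
      linarith
  intro s hs hsS
  have h1 := (hcomp hF L (θ s) (θ' s) ‖g s‖ (hbd s hs hsS) (hbd' s hs hsS)
    (hcells s hs hsS) (norm_nonneg _) (hgl s)).1
  rw [loss, loss, ← integral_sub (integrable_loss hT hF hℓ hμ (θ s))
    (integrable_loss hG hF hℓ hμ (θ' s)), ← Real.norm_eq_abs]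
  refine norm_integral_le_of_ball hμ fun x hx => ?_
  rw [Real.norm_eq_abs]
  have hz := norm_finalState_le hT hF (sq_nonneg K) hx (integral_sq_norm_le (hbd s hs hsS))
  have hz' := norm_finalState_le hG hF (sq_nonneg K) hx (integral_sq_norm_le (hbd' s hs hsS))
  refine (hℓ.abs_sub_le hC0.le hx hz' hz).trans ?_
  have h2 := hg s hs hsS
  calc _ ≤ (C * (2 * B) * (2 * B) + C * B) * (c * (c * M * (1 / L) + 1 / L)) := by
        gcongr
        exact (h1 x hx).trans (by gcongr)
    _ = _ := by ring

end FlowComparison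

/-! ### Activations and losses under the standing assumption -/

section StandingAssumption

section Single

variable {E : Type*} [NormedAddCommGroup E] [InnerProductSpace ℝ E]
  {V : Type*} [NormedAddCommGroup V] [InnerProductSpace ℝ V]

theorem iteratedFDeriv_one_eq_comp (h : V → E) : iteratedFDeriv ℝ 1 h
    = fun v => (continuousMultilinearCurryFin1 ℝ V E).symm (fderiv ℝ h v) := by
  funext v
  ext m
  rw [iteratedFDeriv_one_apply, continuousMultilinearCurryFin1_symm_apply]

theorem norm_fderiv_fderiv_eq (h : V → E) (v : V) :
    ‖fderiv ℝ (fderiv ℝ h) v‖ = ‖iteratedFDeriv ℝ 2 h v‖ := by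
  rw [← norm_iteratedFDeriv_fderiv (n := 1), norm_iteratedFDeriv_one]

/-- An activation satisfying the growth bounds of the standing assumption. -/
theorem exists_activation {f : E → V → E} (hf : ContDiff ℝ 2 fun q : E × V => f q.1 q.2) {C₁ : ℝ}
    (hb : ∀ i j : ℕ, 0 < i + j → i + j ≤ 2 → ∀ x θ,
      ‖iteratedFDeriv ℝ i (fun x' => iteratedFDeriv ℝ j (f x') θ) x‖
        ≤ C₁ * ‖θ‖ ^ i * (‖x‖ + 1) ^ j) :
    ∃ C, Activation f (fun x θ => fderiv ℝ (fun x' => f x' θ) x) (fun x θ => fderiv ℝ (f x) θ)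
      C := by
  have hfx : ∀ x, ContDiff ℝ 2 (f x) := fun x =>
    hf.comp (contDiff_const.prodMk contDiff_id)
  have hfθ : ∀ θ, ContDiff ℝ 2 fun x' => f x' θ := fun θ =>
    hf.comp (contDiff_id.prodMk contDiff_const)
  have hdD : ∀ θ, Differentiable ℝ fun x => fderiv ℝ (f x) θ := fun θ =>
    (ContDiff.fderiv (m := 2) (n := 1) (f := f) (g := fun _ => θ) hf contDiff_const
      (by norm_num)).differentiable one_ne_zero
  set c := max C₁ 0 with hc
  have hc0 : 0 ≤ c := le_max_right _ _
  have hC₁ : C₁ ≤ c := le_max_left _ _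
  -- Each `bij` rewrites the assumption of order `(i, j)` for Fréchet derivatives; the currying maps
  -- involved are linear isometries.
  have b10 : ∀ x θ, ‖fderiv ℝ (fun x' => f x' θ) x‖ ≤ c * ‖θ‖ := fun x θ => by
    have h := hb 1 0 (by norm_num) (by norm_num) x θ
    simp only [iteratedFDeriv_zero_eq_comp, Function.comp_apply] at h
    have h' := (continuousMultilinearCurryFin0 ℝ V E).symm.norm_iteratedFDeriv_comp_left
      (fun x' => f x' θ) x 1
    rw [Function.comp_def] at h'
    rw [h', norm_iteratedFDeriv_one] at h
    refine h.trans ?_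
    simp only [pow_one, pow_zero, mul_one]
    gcongr
  have b20 : ∀ x θ, ‖fderiv ℝ (fderiv ℝ fun x' => f x' θ) x‖ ≤ c * ‖θ‖ ^ 2 := fun x θ => by
    have h := hb 2 0 (by norm_num) (by norm_num) x θ
    simp only [iteratedFDeriv_zero_eq_comp, Function.comp_apply] at h
    have h' := (continuousMultilinearCurryFin0 ℝ V E).symm.norm_iteratedFDeriv_comp_left
      (fun x' => f x' θ) x 2
    rw [Function.comp_def] at h'
    rw [h', ← norm_fderiv_fderiv_eq] at h
    refine h.trans ?_
    simp only [pow_zero, mul_one]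
    gcongr
  have b01 : ∀ x θ, ‖fderiv ℝ (f x) θ‖ ≤ c * (‖x‖ + 1) := fun x θ => by
    have h := hb 0 1 (by norm_num) (by norm_num) x θ
    rw [norm_iteratedFDeriv_zero, norm_iteratedFDeriv_one] at h
    refine h.trans ?_
    simp only [pow_one, pow_zero, mul_one]
    gcongr
  have b02 : ∀ x θ, ‖fderiv ℝ (fderiv ℝ (f x)) θ‖ ≤ c * (‖x‖ + 1) ^ 2 := fun x θ => by
    have h := hb 0 2 (by norm_num) (by norm_num) x θ
    rw [norm_iteratedFDeriv_zero, ← norm_fderiv_fderiv_eq] at h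
    refine h.trans ?_
    simp only [pow_zero, mul_one]
    gcongr
  have b11 : ∀ x θ, ‖fderiv ℝ (fun x' => fderiv ℝ (f x') θ) x‖ ≤ c * ‖θ‖ * (‖x‖ + 1) :=
    fun x θ => by
    have h := hb 1 1 (by norm_num) (by norm_num) x θ
    simp only [iteratedFDeriv_one_eq_comp (f _)] at h
    have h' := (continuousMultilinearCurryFin1 ℝ V E).symm.norm_iteratedFDeriv_comp_left
      (fun x' => fderiv ℝ (f x') θ) x 1
    rw [Function.comp_def] at h'
    rw [h', norm_iteratedFDeriv_one] at h
    refine h.trans ?_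
    simp only [pow_one]
    gcongr
  have hA : ∀ x θ, HasFDerivAt (fun x' => f x' θ) (fderiv ℝ (fun x' => f x' θ) x) x := fun x θ =>
    ((hfθ θ).differentiable two_ne_zero x).hasFDerivAt
  have hD : ∀ x θ, HasFDerivAt (f x) (fderiv ℝ (f x) θ) θ := fun x θ =>
    ((hfx x).differentiable two_ne_zero θ).hasFDerivAt
  have d2 : ∀ x x' θ, ‖fderiv ℝ (f x) θ - fderiv ℝ (f x') θ‖
      ≤ c * ‖θ‖ * (max ‖x‖ ‖x'‖ + 1) * ‖x - x'‖ := fun x x' θ => by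
    refine (convex_closedBall (0 : E) (max ‖x‖ ‖x'‖)).norm_image_sub_le_of_norm_fderiv_le
      (f := fun x => fderiv ℝ (f x) θ) (𝕜 := ℝ) (fun y _ => hdD θ y) (fun y hy => ?_)
      (by simp) (by simp)
    have hy' : ‖y‖ ≤ max ‖x‖ ‖x'‖ := by simpa [-le_sup_iff] using hy
    exact (b11 y θ).trans (by gcongr)
  -- `2c` absorbs `‖x‖ + 2 ≤ 2 (‖x‖ + 1)` in the mixed bound, `‖f 0 0‖` the growth bound, and `1`
  -- gives `one_le`.
  set C := 2 * c + ‖f 0 0‖ + 1 with hCdef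
  have hC0 : 0 ≤ C := by positivity
  have hcC : c ≤ C := by rw [hCdef]; linarith [norm_nonneg (f 0 0)]
  refine ⟨C, by rw [hCdef]; linarith [norm_nonneg (f 0 0)], hA, hD, fun x θ => ?_,
    fun x θ => (b10 x θ).trans (by gcongr), fun x θ => (b01 x θ).trans (by gcongr),
    fun x x' θ => ?_, fun x θ θ' => ?_, fun x x' θ => (d2 x x' θ).trans ?_, fun x θ θ' => ?_⟩
  · have h1 : ‖f x θ - f x 0‖ ≤ c * (‖x‖ + 1) * ‖θ - 0‖ :=
      convex_univ.norm_image_sub_le_of_norm_hasFDerivWithin_le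
        (fun y _ => (hD x y).hasFDerivWithinAt) (fun y _ => b01 x y) trivial trivial
    -- The state derivative vanishes at `θ = 0`, so `f x 0` does not depend on `x`.
    have h2 : ‖f x 0 - f 0 0‖ ≤ c * ‖(0 : V)‖ * ‖x - 0‖ :=
      convex_univ.norm_image_sub_le_of_norm_hasFDerivWithin_le (f := fun x => f x 0)
        (fun y _ => (hA y 0).hasFDerivWithinAt) (fun y _ => b10 y 0) trivial trivial
    rw [sub_zero] at h1
    rw [norm_zero, mul_zero, zero_mul] at h2
    have h3 : f x θ = (f x θ - f x 0) + (f x 0 - f 0 0) + f 0 0 := by abel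
    have h4 : ‖f x θ‖ ≤ c * (‖x‖ + 1) * ‖θ‖ + 0 + ‖f 0 0‖ := by
      rw [h3]; exact norm_add₃_le.trans (by gcongr)
    have h5 : c * (‖x‖ + 1) * ‖θ‖ ≤ C * (‖x‖ + 1) * ‖θ‖ := by gcongr
    have h6 : ‖f 0 0‖ ≤ C * (‖x‖ + 1) := by
      have : 0 ≤ C * ‖x‖ := by positivity
      rw [hCdef] at this ⊢; linarith
    linarith
  · refine (convex_univ.norm_image_sub_le_of_norm_fderiv_le (𝕜 := ℝ)
      (f := fderiv ℝ fun x' => f x' θ) (fun y _ => ?_) (fun y _ => b20 y θ) trivial trivial).trans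
      (by gcongr)
    exact (((hfθ θ).fderiv_right (m := 1) (by norm_num)).differentiable one_ne_zero) y
  -- The assumption bounds the mixed derivative only in the order parameter first, state second. To
  -- avoid exchanging derivatives, the mixed second difference of `f` is estimated through `D` for
  -- `u` near `x`, and this local Lipschitz bound in `u` passes to the derivative at `x`.
  · refine ((hA x θ).fun_sub (hA x θ')).le_of_lip' (by positivity) ?_
    filter_upwards [Metric.ball_mem_nhds x one_pos] with u hu
    have hu' : max ‖u‖ ‖x‖ ≤ ‖x‖ + 1 := by
      have h1 : ‖u - x‖ < 1 := by simpa [dist_eq_norm] using hu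
      have h2 := norm_le_insert' u x
      exact max_le (by linarith) (by linarith)
    have h : ‖(f u θ - f x θ) - (f u θ' - f x θ')‖
        ≤ (c * (‖θ‖ + ‖θ'‖) * (‖x‖ + 1 + 1) * ‖u - x‖) * ‖θ - θ'‖ := by
      refine (convex_closedBall (0 : V) (‖θ‖ + ‖θ'‖)).norm_image_sub_le_of_norm_hasFDerivWithin_le
        (f := fun θ => f u θ - f x θ)
        (fun v _ => ((hD u v).fun_sub (hD x v)).hasFDerivWithinAt) (fun v hv => ?_)
        (by simp) (by simp)
      have hv' : ‖v‖ ≤ ‖θ‖ + ‖θ'‖ := by simpa using hv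
      exact (d2 u x v).trans (by gcongr)
    calc _ = ‖(f u θ - f x θ) - (f u θ' - f x θ')‖ := by congr 1; abel
      _ ≤ _ := h
      _ = (c * (‖x‖ + 2)) * (‖θ‖ + ‖θ'‖) * ‖θ - θ'‖ * ‖u - x‖ := by ring
      _ ≤ (C * (‖x‖ + 1)) * (‖θ‖ + ‖θ'‖) * ‖θ - θ'‖ * ‖u - x‖ := by
          have h1 : 2 * c * (‖x‖ + 1) ≤ C * (‖x‖ + 1) := by
            gcongr; rw [hCdef]; linarith [norm_nonneg (f 0 0)]
          have h2 : 0 ≤ c * ‖x‖ := by positivity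
          have h3 : c * (‖x‖ + 2) ≤ C * (‖x‖ + 1) := by linarith
          gcongr ?_ * _ * _ * _
      _ = _ := by ring
  · have : max ‖x‖ ‖x'‖ ≤ ‖x‖ + ‖x'‖ :=
      max_le (by linarith [norm_nonneg x']) (by linarith [norm_nonneg x])
    gcongr
  · refine (convex_univ.norm_image_sub_le_of_norm_fderiv_le (𝕜 := ℝ)
      (f := fderiv ℝ (f x)) (fun y _ => ?_) (fun y _ => b02 x y) trivial trivial).trans
      (by gcongr)
    exact (((hfx x).fderiv_right (m := 1) (by norm_num)).differentiable one_ne_zero) y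

theorem Activation.mono {F : E → V → E} {A : E → V → E →L[ℝ] E} {D : E → V → V →L[ℝ] E} {C C' : ℝ}
    (hF : Activation F A D C) (h : C ≤ C') : Activation F A D C' where
  one_le := hF.one_le.trans h
  hasFDerivAt_state := hF.hasFDerivAt_state
  hasFDerivAt_param := hF.hasFDerivAt_param
  norm_le x w := (hF.norm_le x w).trans (by gcongr)
  norm_A_le x w := (hF.norm_A_le x w).trans (by gcongr)
  norm_D_le x w := (hF.norm_D_le x w).trans (by gcongr)
  norm_A_sub_state x x' w := (hF.norm_A_sub_state x x' w).trans (by gcongr)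
  norm_A_sub_param x w w' := (hF.norm_A_sub_param x w w').trans (by gcongr)
  norm_D_sub_state x x' w := (hF.norm_D_sub_state x x' w).trans (by gcongr)
  norm_D_sub_param x w w' := (hF.norm_D_sub_param x w w').trans (by gcongr)

theorem IsLoss.mono {ℓ : E → E → ℝ} {b : E → E → E} {R C C' : ℝ} (hℓ : IsLoss ℓ b R C)
    (h : C ≤ C') : IsLoss ℓ b R C' where
  radius_nonneg := hℓ.radius_nonneg
  continuous_loss := hℓ.continuous_loss
  continuous_grad := hℓ.continuous_grad
  nonneg := hℓ.nonneg
  le x z hx := (hℓ.le x z hx).trans (by gcongr)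
  norm_grad_le x z hx := (hℓ.norm_grad_le x z hx).trans (by gcongr)
  norm_grad_sub_le x z z' hx := (hℓ.norm_grad_sub_le x z z' hx).trans (by gcongr)
  taylor x z z' hx := (hℓ.taylor x z z' hx).trans (by gcongr)

/-- The quadratic loss of a Lipschitz measuring function with Lipschitz gradient. -/
theorem exists_isLoss [CompleteSpace E] {g y : E → ℝ} (hg : Differentiable ℝ g)
    (hy : Continuous y) {K₁ K₂ : ℝ≥0} (hK₁ : LipschitzWith K₁ g)
    (hK₂ : LipschitzWith K₂ (gradient g)) {R Y : ℝ} (hR : 0 ≤ R) (hY : ∀ x, ‖x‖ ≤ R → |y x| ≤ Y) :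
    ∃ C, IsLoss (fun x z => (1 / 2 : ℝ) * (g z - y x) ^ 2) (fun x z => (g z - y x) • gradient g z)
      R C := by
  have hY0 : 0 ≤ Y := (abs_nonneg _).trans (hY 0 (by simpa using hR))
  -- Chosen so that `|g z - y x| ≤ c (1 + ‖z‖)` on the ball.
  set c := |g 0| + Y + K₁ with hc
  have hc0 : 0 ≤ c := by positivity
  have ha : ∀ x z, ‖x‖ ≤ R → |g z - y x| ≤ c * (1 + ‖z‖) := fun x z hx => by
    have h1 := hK₁.norm_sub_le z 0
    rw [sub_zero, Real.norm_eq_abs] at h1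
    have h2 : g z - y x = (g z - g 0) + g 0 - y x := by ring
    have h3 : |g z - y x| ≤ K₁ * ‖z‖ + |g 0| + Y := by
      rw [h2]
      refine (abs_sub _ _).trans (add_le_add ((abs_add_le _ _).trans ?_) (hY x hx))
      gcongr
    have h4 : 0 ≤ (|g 0| + Y) * ‖z‖ := by positivity
    have h5 : (0 : ℝ) ≤ K₁ := K₁.2
    rw [hc]; linarith
  have hgrad : ∀ z, HasGradientAt g (gradient g z) z := fun z => (hg z).hasGradientAt
  have hn : ∀ z, ‖gradient g z‖ ≤ K₁ := fun z => by
    have h := norm_fderiv_le_of_lipschitz ℝ (x₀ := z) hK₁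
    rw [gradient, LinearIsometryEquiv.norm_map]
    exact h
  have htay : ∀ z z', |g z' - g z - inner ℝ (gradient g z) (z' - z)| ≤ K₂ * ‖z' - z‖ * ‖z' - z‖ :=
    fun z z' => by
    have h := (convex_closedBall z ‖z' - z‖).norm_image_sub_le_of_norm_hasFDerivWithin_le'
      (f := g) (f' := fun w => InnerProductSpace.toDual ℝ E (gradient g w))
      (φ := InnerProductSpace.toDual ℝ E (gradient g z)) (C := K₂ * ‖z' - z‖)
      (fun w _ => (hgrad w).hasFDerivAt.hasFDerivWithinAt) (fun w hw => ?_)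
      (Metric.mem_closedBall_self (norm_nonneg _)) (y := z') (by simp [dist_eq_norm])
    · simpa using h
    · have hw' : ‖w - z‖ ≤ ‖z' - z‖ := by simpa [dist_eq_norm] using hw
      rw [← map_sub, LinearIsometryEquiv.norm_map]
      exact (hK₂.norm_sub_le w z).trans (by gcongr)
  have hK₁0 : (0 : ℝ) ≤ K₁ := K₁.2
  have hK₂0 : (0 : ℝ) ≤ K₂ := K₂.2
  have hgc : Continuous g := hK₁.continuous
  have hgg : Continuous (gradient g) := hK₂.continuous
  refine ⟨c ^ 2 + c * K₁ + K₁ ^ 2 + c * K₂, hR, by fun_prop, by fun_prop,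
    fun x z => by positivity, fun x z hx => ?_, fun x z hx => ?_, fun x z z' hx => ?_,
    fun x z z' hx => ?_⟩
  · have h1 : (g z - y x) ^ 2 ≤ (c * (1 + ‖z‖)) ^ 2 := sq_le_sq' (by
      linarith [neg_abs_le (g z - y x), ha x z hx]) ((le_abs_self _).trans (ha x z hx))
    have h2 : 0 ≤ (c * K₁ + (K₁ : ℝ) ^ 2 + c * K₂) * (1 + ‖z‖) ^ 2 := by positivity
    nlinarith [sq_nonneg (c * (1 + ‖z‖))]
  · rw [norm_smul, Real.norm_eq_abs]
    calc |g z - y x| * ‖gradient g z‖ ≤ (c * (1 + ‖z‖)) * K₁ := by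
          gcongr
          · exact ha x z hx
          · exact hn z
      _ = (c * K₁) * (1 + ‖z‖) := by ring
      _ ≤ _ := by gcongr; nlinarith [sq_nonneg c, sq_nonneg (K₁ : ℝ), mul_nonneg hc0 hK₂0]
  · have h1 : (g z - y x) • gradient g z - (g z' - y x) • gradient g z'
        = (g z - g z') • gradient g z + (g z' - y x) • (gradient g z - gradient g z') := by
      rw [sub_smul, sub_smul, sub_smul, smul_sub, sub_smul, sub_smul]; abel
    rw [h1]
    refine (norm_add_le _ _).trans ?_
    rw [norm_smul, norm_smul]
    have h2 := hK₁.norm_sub_le z z'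
    have h3 := hK₂.norm_sub_le z z'
    have h4 := ha x z' hx
    rw [← Real.norm_eq_abs] at h4
    have h5 := hn z
    calc _ ≤ (K₁ * ‖z - z'‖) * K₁ + (c * (1 + ‖z'‖)) * (K₂ * ‖z - z'‖) := by gcongr
      _ = ((K₁ : ℝ) ^ 2 * 1 + c * K₂ * (1 + ‖z'‖)) * ‖z - z'‖ := by ring
      _ ≤ ((K₁ : ℝ) ^ 2 * (1 + ‖z‖ + ‖z'‖) + c * K₂ * (1 + ‖z‖ + ‖z'‖)) * ‖z - z'‖ := by
          have e1 : 1 ≤ 1 + ‖z‖ + ‖z'‖ := by linarith [norm_nonneg z, norm_nonneg z']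
          have e2 : 1 + ‖z'‖ ≤ 1 + ‖z‖ + ‖z'‖ := by linarith [norm_nonneg z]
          gcongr (_ * ?_ + _ * ?_) * _
      _ = ((K₁ : ℝ) ^ 2 + c * K₂) * (1 + ‖z‖ + ‖z'‖) * ‖z - z'‖ := by ring
      _ ≤ _ := by gcongr; nlinarith [sq_nonneg c, mul_nonneg hc0 hK₁0]
  · have h2 : |g z' - g z| ≤ K₁ * ‖z' - z‖ := hK₁.norm_sub_le z' z
    have h3 := htay z z'
    have h4 := ha x z hx
    -- Exact identity: the remainder of the quadratic loss is half the squared increment of `g` plus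
    -- the Taylor remainder of `g` times the mismatch `g z - y x`.
    have h6 : (1 / 2 : ℝ) * (g z' - y x) ^ 2 - 1 / 2 * (g z - y x) ^ 2
          - inner ℝ ((g z - y x) • gradient g z) (z' - z)
        = 1 / 2 * (g z' - g z) ^ 2
          + (g z - y x) * (g z' - g z - inner ℝ (gradient g z) (z' - z)) := by
      rw [real_inner_smul_left]; ring
    have h7 : |(1 / 2 : ℝ) * (g z' - g z) ^ 2| ≤ (K₁ : ℝ) ^ 2 * ‖z' - z‖ ^ 2 := by
      rw [abs_of_nonneg (by positivity), ← mul_pow, ← sq_abs]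
      have := pow_le_pow_left₀ (abs_nonneg _) h2 2
      nlinarith [sq_nonneg (|g z' - g z|)]
    rw [h6]
    refine (abs_add_le _ _).trans ?_
    rw [abs_mul (g z - y x)]
    calc _ ≤ (K₁ : ℝ) ^ 2 * ‖z' - z‖ ^ 2 + (c * (1 + ‖z‖)) * (K₂ * ‖z' - z‖ * ‖z' - z‖) := by
          gcongr
      _ = ((K₁ : ℝ) ^ 2 * 1 + c * K₂ * (1 + ‖z‖)) * ‖z' - z‖ ^ 2 := by ring
      _ ≤ ((K₁ : ℝ) ^ 2 * (1 + ‖z‖ + ‖z'‖) + c * K₂ * (1 + ‖z‖ + ‖z'‖)) * ‖z' - z‖ ^ 2 := by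
          have e1 : 1 ≤ 1 + ‖z‖ + ‖z'‖ := by linarith [norm_nonneg z, norm_nonneg z']
          have e2 : 1 + ‖z‖ ≤ 1 + ‖z‖ + ‖z'‖ := by linarith [norm_nonneg z']
          gcongr (_ * ?_ + _ * ?_) * _
      _ = ((K₁ : ℝ) ^ 2 + c * K₂) * (1 + ‖z‖ + ‖z'‖) * ‖z' - z‖ ^ 2 := by ring
      _ ≤ _ := by gcongr; nlinarith [sq_nonneg c, mul_nonneg hc0 hK₁0]

end Single

end StandingAssumption

/-! ### Mean-field activations -/

section MeanField

variable {E : Type*} [NormedAddCommGroup E] [InnerProductSpace ℝ E]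
  {V : Type*} [NormedAddCommGroup V] [InnerProductSpace ℝ V] {M : ℕ}

/-- Lists of `M` particles, with the Euclidean norm. -/
abbrev Population (M : ℕ) (V : Type*) : Type _ := PiLp 2 fun _ : Fin M => V

/-- The `m`-th particle, in the scaling in which the norm is the root mean square. -/
def particle (V : Type*) [NormedAddCommGroup V] [InnerProductSpace ℝ V] (m : Fin M) :
    Population M V →L[ℝ] V :=
  √(M : ℝ) • PiLp.proj 2 (fun _ : Fin M => V) m

theorem particle_apply (m : Fin M) (w : Population M V) : particle V m w = √(M : ℝ) • w m := rfl

/-- The average of the activation over the particles. -/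
def meanField (F : E → V → E) (x : E) (w : Population M V) : E :=
  (M : ℝ)⁻¹ • ∑ m, F x (particle V m w)

/-- The state derivative of `meanField`. -/
def meanFieldA (A : E → V → E →L[ℝ] E) (x : E) (w : Population M V) : E →L[ℝ] E :=
  (M : ℝ)⁻¹ • ∑ m, A x (particle V m w)

/-- The parameter derivative of `meanField`. -/
def meanFieldD (D : E → V → V →L[ℝ] E) (x : E) (w : Population M V) : Population M V →L[ℝ] E :=
  (M : ℝ)⁻¹ • ∑ m, (D x (particle V m w)).comp (particle V m)

theorem norm_mean_le {X : Type*} [NormedAddCommGroup X] [NormedSpace ℝ X] {v : Fin M → X}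
    {r : Fin M → ℝ} (h : ∀ m, ‖v m‖ ≤ r m) :
    ‖(M : ℝ)⁻¹ • ∑ m, v m‖ ≤ (M : ℝ)⁻¹ * ∑ m, r m := by
  rw [norm_smul, norm_inv, Real.norm_natCast]
  exact mul_le_mul_of_nonneg_left (norm_sum_le_of_le _ fun m _ => h m) (by positivity)

/-- The factor `√M` in `particle` is chosen so that this holds without any power of `M`; the
uniformity in `M` rests on it. -/
theorem mean_norm_particle_sq [NeZero M] (w : Population M V) :
    (M : ℝ)⁻¹ * ∑ m, ‖particle V m w‖ ^ 2 = ‖w‖ ^ 2 := by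
  have hM : (M : ℝ) ≠ 0 := by exact_mod_cast NeZero.ne M
  simp only [particle_apply, norm_smul, mul_pow, Real.norm_eq_abs, sq_abs,
    Real.sq_sqrt (Nat.cast_nonneg M), ← Finset.mul_sum, PiLp.norm_sq_eq_of_L2]
  field_simp

theorem mean_norm_particle_mul_le [NeZero M] (w w' : Population M V) :
    (M : ℝ)⁻¹ * ∑ m, ‖particle V m w‖ * ‖particle V m w'‖ ≤ ‖w‖ * ‖w'‖ := by
  refine le_of_sq_le_sq ?_ (by positivity)
  have h := Finset.sum_mul_sq_le_sq_mul_sq Finset.univ (fun m => ‖particle V m w‖)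
    fun m => ‖particle V m w'‖
  rw [mul_pow, mul_pow, ← mean_norm_particle_sq w, ← mean_norm_particle_sq w']
  calc _ ≤ ((M : ℝ)⁻¹) ^ 2 * ((∑ m, ‖particle V m w‖ ^ 2) * ∑ m, ‖particle V m w'‖ ^ 2) := by gcongr
    _ = _ := by ring

theorem mean_norm_particle_le [NeZero M] (w : Population M V) :
    (M : ℝ)⁻¹ * ∑ m, ‖particle V m w‖ ≤ ‖w‖ := by
  have hM : (M : ℝ) ≠ 0 := by exact_mod_cast NeZero.ne M
  refine le_of_sq_le_sq ?_ (norm_nonneg w)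
  have h := sq_sum_le_card_mul_sum_sq (s := Finset.univ) (f := fun m => ‖particle V m w‖)
  rw [Finset.card_univ, Fintype.card_fin] at h
  rw [mul_pow, ← mean_norm_particle_sq w]
  calc _ ≤ ((M : ℝ)⁻¹) ^ 2 * (M * ∑ m, ‖particle V m w‖ ^ 2) := by gcongr
    _ = _ := by field_simp

theorem mean_const_mul (c : ℝ) (r : Fin M → ℝ) :
    (M : ℝ)⁻¹ * ∑ m, c * r m = c * ((M : ℝ)⁻¹ * ∑ m, r m) := by
  rw [← Finset.mul_sum]; ring

theorem meanFieldD_sub_apply (D : E → V → V →L[ℝ] E) (x x' : E) (w w' v : Population M V) :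
    (meanFieldD D x w - meanFieldD D x' w') v = (M : ℝ)⁻¹ • ∑ m,
      (D x (particle V m w) - D x' (particle V m w')) (particle V m v) := by
  simp [meanFieldD, Finset.sum_sub_distrib, smul_sub]

theorem meanFieldA_sub (A : E → V → E →L[ℝ] E) (x x' : E) (w w' : Population M V) :
    meanFieldA A x w - meanFieldA A x' w' = (M : ℝ)⁻¹ • ∑ m,
      (A x (particle V m w) - A x' (particle V m w')) := by
  simp [meanFieldA, Finset.sum_sub_distrib, smul_sub]

/-- Averaging over particles keeps the bounds, uniformly in the number of particles. -/
theorem Activation.meanField [NeZero M] {F : E → V → E} {A : E → V → E →L[ℝ] E}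
    {D : E → V → V →L[ℝ] E} {C : ℝ} (hF : Activation F A D C) :
    Activation (meanField (M := M) F) (meanFieldA A) (meanFieldD D) C := by
  have hM : (M : ℝ) ≠ 0 := by exact_mod_cast NeZero.ne M
  have hC : 0 ≤ C := zero_le_one.trans hF.one_le
  refine ⟨hF.one_le, fun x w => ?_, fun x w => ?_, fun x w => ?_, fun x w => ?_, fun x w => ?_,
    fun x x' w => ?_, fun x w w' => ?_, fun x x' w => ?_, fun x w w' => ?_⟩
  · exact (HasFDerivAt.fun_sum fun m _ => hF.hasFDerivAt_state x (particle V m w)).const_smul _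
  · exact (HasFDerivAt.fun_sum fun m _ =>
      (hF.hasFDerivAt_param x (particle V m w)).comp w (particle V m).hasFDerivAt).const_smul _
  -- Every bound in `Activation`, with `D` tested against a vector, has degree at most two in the
  -- particle norms. Each average is therefore a mean, a mean square or a mean product, and
  -- Cauchy–Schwarz returns the same expression in the population norms.
  · refine (norm_mean_le fun m => hF.norm_le x (particle V m w)).trans ?_
    rw [mean_const_mul, Finset.sum_add_distrib]
    have := mean_norm_particle_le w
    simp only [Finset.sum_const, Finset.card_univ, Fintype.card_fin, nsmul_eq_mul, mul_one,
      inv_mul_cancel₀ hM, mul_add (M : ℝ)⁻¹]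
    gcongr
  · refine (norm_mean_le fun m => hF.norm_A_le x (particle V m w)).trans ?_
    rw [mean_const_mul]
    gcongr
    exact mean_norm_particle_le w
  · refine ContinuousLinearMap.opNorm_le_bound _ (by positivity) fun v => ?_
    have h : meanFieldD D x w v = (M : ℝ)⁻¹ • ∑ m, D x (particle V m w) (particle V m v) := by
      simp [meanFieldD]
    rw [h]
    refine (norm_mean_le fun m => (D x (particle V m w)).le_of_opNorm_le
      (hF.norm_D_le x (particle V m w)) (particle V m v)).trans ?_
    rw [mean_const_mul]
    gcongr
    exact mean_norm_particle_le v
  · rw [meanFieldA_sub]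
    refine (norm_mean_le fun m => hF.norm_A_sub_state x x' (particle V m w)).trans ?_
    rw [← mean_norm_particle_sq w]
    refine le_of_eq ?_
    simp only [Finset.mul_sum, Finset.sum_mul]
    exact Finset.sum_congr rfl fun m _ => by ring
  · rw [meanFieldA_sub]
    refine (norm_mean_le fun m =>
      hF.norm_A_sub_param x (particle V m w) (particle V m w')).trans ?_
    have h1 := mean_norm_particle_mul_le w (w - w')
    have h2 := mean_norm_particle_mul_le w' (w - w')
    have h3 : (M : ℝ)⁻¹ * ∑ m, C * (‖particle V m w‖ + ‖particle V m w'‖) * (‖x‖ + 1)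
          * ‖particle V m w - particle V m w'‖
        = C * (‖x‖ + 1) * ((M : ℝ)⁻¹ * ∑ m, ‖particle V m w‖ * ‖particle V m (w - w')‖
          + (M : ℝ)⁻¹ * ∑ m, ‖particle V m w'‖ * ‖particle V m (w - w')‖) := by
      rw [← mul_add, ← Finset.sum_add_distrib, ← mean_const_mul]
      congr 1
      exact Finset.sum_congr rfl fun m _ => by rw [map_sub]; ring
    rw [h3]
    calc _ ≤ C * (‖x‖ + 1) * (‖w‖ * ‖w - w'‖ + ‖w'‖ * ‖w - w'‖) := by gcongr
      _ = _ := by ring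
  · refine ContinuousLinearMap.opNorm_le_bound _ (by positivity) fun v => ?_
    rw [meanFieldD_sub_apply]
    refine (norm_mean_le fun m => (D x (particle V m w) - D x' (particle V m w)).le_of_opNorm_le
      (hF.norm_D_sub_state x x' (particle V m w)) (particle V m v)).trans ?_
    have h := mean_norm_particle_mul_le w v
    calc _ = C * (‖x‖ + ‖x'‖ + 1) * ‖x - x'‖
          * ((M : ℝ)⁻¹ * ∑ m, ‖particle V m w‖ * ‖particle V m v‖) := by
          rw [← mean_const_mul]
          congr 1
          exact Finset.sum_congr rfl fun m _ => by ring
      _ ≤ C * (‖x‖ + ‖x'‖ + 1) * ‖x - x'‖ * (‖w‖ * ‖v‖) := by gcongr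
      _ = _ := by ring
  · refine ContinuousLinearMap.opNorm_le_bound _ (by positivity) fun v => ?_
    rw [meanFieldD_sub_apply]
    refine (norm_mean_le fun m => (D x (particle V m w) - D x (particle V m w')).le_of_opNorm_le
      (hF.norm_D_sub_param x (particle V m w) (particle V m w')) (particle V m v)).trans ?_
    have h := mean_norm_particle_mul_le (w - w') v
    calc _ = C * (‖x‖ + 1) ^ 2
          * ((M : ℝ)⁻¹ * ∑ m, ‖particle V m (w - w')‖ * ‖particle V m v‖) := by
          rw [← mean_const_mul]
          congr 1
          exact Finset.sum_congr rfl fun m _ => by rw [map_sub]; ring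
      _ ≤ C * (‖x‖ + 1) ^ 2 * (‖w - w'‖ * ‖v‖) := by gcongr
      _ = _ := by ring

end MeanField

/-! ### The networks as mean-field states -/

section Networks

/-! ### Derivatives of the loss along perturbations of the parameters. -/

section Directional

variable {T : Type} [TopologicalSpace T] [CompactSpace T] [LinearOrder T] [MeasurableSpace T]
  [BorelSpace T] [SecondCountableTopology T] [OrderClosedTopology T]
  {E : Type*} [NormedAddCommGroup E] [InnerProductSpace ℝ E] [CompleteSpace E]
  [MeasurableSpace E] [BorelSpace E] [SecondCountableTopology E]
  {W : Type*} [NormedAddCommGroup W] [InnerProductSpace ℝ W] [CompleteSpace W]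
  {ν : Measure T} [IsProbabilityMeasure ν] {τ : T → ℝ} {F : E → W → E}
  {A : E → W → E →L[ℝ] E} {D : E → W → W →L[ℝ] E} {C : ℝ} {ℓ : E → E → ℝ} {b : E → E → E} {R : ℝ}
  {μ : Measure E} [IsProbabilityMeasure μ]

theorem hasDerivAt_loss_add_smul (hT : IsTimeScale E ν τ) (hF : Activation F A D C)
    (hℓ : IsLoss ℓ b R C) (hμ : ∀ᵐ x ∂μ, ‖x‖ ≤ R) (θ h : C(T, W)) :
    HasDerivAt (fun ε : ℝ => loss ν F ℓ μ (θ + ε • h))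
      (∫ t, inner ℝ (grad ν F A D b μ θ t) (h t) ∂ν) 0 := by
  have h1 : HasDerivAt (fun ε : ℝ => θ + ε • h) h 0 := by
    simpa using ((hasDerivAt_id (0 : ℝ)).smul_const h).const_add θ
  have h2 := hasFDerivAt_loss hT hF hℓ hμ (θ + (0 : ℝ) • h)
  have h3 := h2.comp_hasDerivAt (0 : ℝ) h1
  rw [zero_smul, add_zero, pairing_apply] at h3
  exact h3

theorem hasFDerivAt_loss_add_comp {X : Type*} [NormedAddCommGroup X] [NormedSpace ℝ X]
    (hT : IsTimeScale E ν τ) (hF : Activation F A D C)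
    (hℓ : IsLoss ℓ b R C) (hμ : ∀ᵐ x ∂μ, ‖x‖ ≤ R) (θ : C(T, W)) (B : X →L[ℝ] C(T, W)) (v₀ : X) :
    HasFDerivAt (fun v => loss ν F ℓ μ (θ + B (v - v₀)))
      ((pairing ν (grad ν F A D b μ θ)).comp B) v₀ := by
  have h1 : HasFDerivAt (fun v => θ + B (v - v₀)) B v₀ := by
    simpa using (B.hasFDerivAt.comp v₀ ((hasFDerivAt_id v₀).sub_const v₀)).const_add θ
  have h2 := hasFDerivAt_loss hT hF hℓ hμ (θ + B (v₀ - v₀))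
  have h3 := h2.comp v₀ h1
  rw [sub_self, map_zero, add_zero] at h3
  exact h3

end Directional

/-! ### Encoding `M` particle paths as one path of populations. -/

section Bundle

variable {T : Type} [TopologicalSpace T] {V : Type} [NormedAddCommGroup V] [InnerProductSpace ℝ V]
  {M : ℕ}

/-- A list of parameter paths as a path of populations. -/
def bundle (Θ : Fin M → C(T, V)) : C(T, Population M V) where
  toFun t := WithLp.toLp 2 fun m => (√(M : ℝ))⁻¹ • Θ m t
  continuous_toFun := by fun_prop

theorem bundle_apply (Θ : Fin M → C(T, V)) (t : T) (m : Fin M) :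
    bundle Θ t m = (√(M : ℝ))⁻¹ • Θ m t := rfl

theorem sqrt_natCast_ne_zero (M : ℕ) [NeZero M] : √(M : ℝ) ≠ 0 := by
  have hM : (M : ℝ) ≠ 0 := by exact_mod_cast NeZero.ne M
  exact (Real.sqrt_pos.2 (lt_of_le_of_ne (Nat.cast_nonneg M) hM.symm)).ne'

theorem particle_bundle [NeZero M] (Θ : Fin M → C(T, V)) (t : T) (m : Fin M) :
    particle V m (bundle Θ t) = Θ m t := by
  rw [particle_apply, bundle_apply, smul_inv_smul₀ (sqrt_natCast_ne_zero M)]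

theorem continuous_bundle [LocallyCompactSpace T] :
    Continuous (bundle : (Fin M → C(T, V)) → C(T, Population M V)) := by
  refine ContinuousMap.continuous_of_continuous_uncurry _ ?_
  refine (PiLp.continuous_toLp 2 _).comp (continuous_pi fun m => ?_)
  have : Continuous fun p : (Fin M → C(T, V)) × T => p.1 m p.2 := by fun_prop
  exact this.const_smul _

theorem bundle_update_add (Θ : Fin M → C(T, V)) (m : Fin M) (h : C(T, V)) :
    bundle (Function.update Θ m (Θ m + h)) = bundle Θ + bundle (Pi.single m h) := by
  ext t : 1
  refine PiLp.ext fun n => ?_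
  rw [ContinuousMap.add_apply, PiLp.add_apply]
  simp only [bundle_apply]
  obtain rfl | hn := eq_or_ne n m
  · simp
  · simp [hn]

theorem bundle_single_smul (m : Fin M) (c : ℝ) (h : C(T, V)) :
    bundle (Pi.single m (c • h)) = c • bundle (Pi.single m h) := by
  ext t : 1
  refine PiLp.ext fun n => ?_
  rw [ContinuousMap.smul_apply, PiLp.smul_apply]
  simp only [bundle_apply]
  obtain rfl | hn := eq_or_ne n m
  · simp [smul_comm c]
  · simp [hn]

theorem bundle_single_add (m : Fin M) (h h' : C(T, V)) :
    bundle (Pi.single m (h + h')) = bundle (Pi.single m h) + bundle (Pi.single m h') := by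
  ext t : 1
  refine PiLp.ext fun n => ?_
  rw [ContinuousMap.add_apply, PiLp.add_apply]
  simp only [bundle_apply]
  obtain rfl | hn := eq_or_ne n m
  · simp
  · simp [hn]

theorem inner_bundle_single (w : Population M V) (m : Fin M) (h : C(T, V)) (t : T) :
    inner ℝ w (bundle (Pi.single m h) t) = inner ℝ ((√(M : ℝ))⁻¹ • w m) (h t) := by
  rw [PiLp.inner_apply, Finset.sum_eq_single m]
  · rw [bundle_apply, Pi.single_eq_same, real_inner_smul_left, real_inner_smul_right]
  · intro n _ hn
    rw [bundle_apply, Pi.single_eq_of_ne hn, ContinuousMap.zero_apply, smul_zero, inner_zero_right]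
  · simp

/-- The parameters of a finite network as a list of paths over the grid. -/
def gridPaths {L : ℕ} (Θ : Fin L → Fin M → V) (m : Fin M) : C(Fin L, V) :=
  ⟨fun l => Θ l m, continuous_of_discreteTopology⟩

/-- A path over the grid that is supported at `l`. -/
def gridSingle {L : ℕ} (l : Fin L) (v : V) : C(Fin L, V) :=
  ⟨Pi.single l v, continuous_of_discreteTopology⟩

/-- The perturbation of the `m`-th particle of the `l`-th layer. -/
def gridBump {L : ℕ} [FiniteDimensional ℝ V] (l : Fin L) (m : Fin M) :
    V →L[ℝ] C(Fin L, Population M V) :=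
  LinearMap.toContinuousLinearMap
    { toFun := fun v => bundle (Pi.single m (gridSingle l v))
      map_add' := fun v v' => by
        rw [← bundle_single_add]
        congr 2
        ext1 j
        exact congrFun (Pi.single_add (f := fun _ => V) l v v') j
      map_smul' := fun c v => by
        rw [RingHom.id_apply, ← bundle_single_smul]
        congr 2
        ext1 j
        exact congrFun (Pi.single_smul (f := fun _ => V) l c v) j }

theorem sum_inner_gridBump {L : ℕ} [FiniteDimensional ℝ V] (l : Fin L) (m : Fin M)
    (G : C(Fin L, Population M V)) (v : V) :
    ∑ j, inner ℝ (G j) (gridBump l m v j) = inner ℝ ((√(M : ℝ))⁻¹ • G l m) v := by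
  change ∑ j, inner ℝ (G j) (bundle (Pi.single m (gridSingle l v)) j) = _
  simp only [inner_bundle_single]
  rw [Finset.sum_eq_single l]
  · simp [gridSingle]
  · intro j _ hj
    simp [gridSingle, hj]
  · simp

theorem bundle_gridPaths_update {L : ℕ} [FiniteDimensional ℝ V] (Θ : Fin L → Fin M → V)
    (l : Fin L) (m : Fin M) (v : V) :
    bundle (gridPaths (Function.update Θ l (Function.update (Θ l) m v)))
      = bundle (gridPaths Θ) + gridBump l m (v - Θ l m) := by
  change _ = bundle (gridPaths Θ) + bundle (Pi.single m (gridSingle l (v - Θ l m)))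
  rw [← bundle_update_add]
  congr 1
  funext n
  ext1 j
  obtain rfl | hn := eq_or_ne n m <;> obtain rfl | hj := eq_or_ne j l <;>
    simp [gridPaths, gridSingle, *]

theorem meanField_bundle [NeZero M] {E : Type*} [NormedAddCommGroup E] [InnerProductSpace ℝ E]
    (f : E → V → E) (Θ : Fin M → C(T, V)) (x : E) (t : T) :
    meanField f x (bundle Θ t) = (M : ℝ)⁻¹ • ∑ m, f x (Θ m t) := by
  simp only [meanField, particle_bundle]

theorem norm_bundle_sq [NeZero M] (Θ : Fin M → C(T, V)) (t : T) :
    ‖bundle Θ t‖ ^ 2 = (M : ℝ)⁻¹ * ∑ m, ‖Θ m t‖ ^ 2 := by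
  simp only [← mean_norm_particle_sq, particle_bundle]

theorem norm_bundle_sub_sq [NeZero M] (Θ : Fin M → C(T, V)) (t t' : T) :
    ‖bundle Θ t - bundle Θ t'‖ ^ 2 = (M : ℝ)⁻¹ * ∑ m, ‖Θ m t - Θ m t'‖ ^ 2 := by
  simp only [← mean_norm_particle_sq, map_sub, particle_bundle]

/-- The rescaled flow of a bundle. -/
theorem isFlow_bundle [NeZero M] [LocallyCompactSpace T]
    {G : C(T, Population M V) → C(T, Population M V)}
    {Θ : ℝ → Fin M → C(T, V)} (hc : ContinuousOn Θ (Set.Ici 0))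
    (hd : ∀ s, 0 < s → ∀ m t, HasDerivAt (fun s' => Θ s' m t)
      (-((M : ℝ) • (√(M : ℝ))⁻¹ • G (bundle (Θ s)) t m) - (2 * Real.exp (-s)) • Θ s m t) s) :
    IsFlow G fun s => bundle (Θ s) := by
  -- The prefactor `M` of the flow against two factors `1/√M`: one from the component of the
  -- gradient, one from the scaling in `bundle`.
  have hM : (√(M : ℝ))⁻¹ * (M * (√(M : ℝ))⁻¹) = 1 := by
    have h1 := Real.mul_self_sqrt (Nat.cast_nonneg (α := ℝ) M)
    have h2 := sqrt_natCast_ne_zero M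
    nth_rw 2 [← h1]
    field_simp
  refine ⟨continuous_bundle.comp_continuousOn hc, fun s hs t => ?_⟩
  have h1 : HasDerivAt (fun s' m => (√(M : ℝ))⁻¹ • Θ s' m t)
      (fun m => (√(M : ℝ))⁻¹ • (-((M : ℝ) • (√(M : ℝ))⁻¹ • G (bundle (Θ s)) t m)
        - (2 * Real.exp (-s)) • Θ s m t)) s :=
    hasDerivAt_pi.2 fun m => (hd s hs m t).const_smul _
  have h2 := ((PiLp.continuousLinearEquiv 2 ℝ fun _ : Fin M => V).symm :
    (Fin M → V) →L[ℝ] Population M V).hasFDerivAt.comp_hasDerivAt s h1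
  refine h2.congr_deriv (PiLp.ext fun m => ?_)
  rw [PiLp.sub_apply, PiLp.neg_apply, PiLp.smul_apply, bundle_apply]
  change (√(M : ℝ))⁻¹ • (-((M : ℝ) • (√(M : ℝ))⁻¹ • G (bundle (Θ s)) t m)
        - (2 * Real.exp (-s)) • Θ s m t) = _
  rw [smul_sub, smul_neg, smul_smul, smul_smul, mul_assoc, hM, one_smul, smul_comm]

end Bundle

/-! ### The networks, their losses and their flows in the encoded form. -/

variable {d k M : ℕ} [NeZero M] {f : Euc d → Euc k → Euc d}
  {A : Euc d → Euc k → Euc d →L[ℝ] Euc d} {D : Euc d → Euc k → Euc k →L[ℝ] Euc d} {C : ℝ}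

theorem eq_zero_of_integral_unitInterval {φ : I → ℝ} (hφ : Continuous φ) (h0 : ∀ t, 0 ≤ φ t)
    (h : ∫ t, φ t = 0) (t : I) : φ t = 0 := by
  by_contra hne
  rw [integral_unitInterval] at h
  refine (intervalIntegral.integral_pos zero_lt_one (hφ.comp continuous_toI).continuousOn
    (fun r _ => h0 _) ⟨t, t.2, ?_⟩).ne' h
  rw [Function.comp_apply, toI_coe]
  exact lt_of_le_of_ne (h0 t) (Ne.symm hne)

/-- Existence is needed before anything can be said of the choice made by `flowZ`. The witness is
the primitive of the field along the Volterra state; the clamp `toI` makes it meaningful for all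
real times. -/
theorem exists_isResNetODE (hf : Activation f A D C) (Θ : Fin M → ParamPath k) (x : Euc d) :
    ∃ z, IsResNetODE f Θ x z := by
  have hT := isTimeScale_unitInterval (E := Euc d)
  set q := state volume (meanField f) (bundle Θ) x with hq
  have hst : IsState volume (meanField f) (bundle Θ) x q :=
    isState_state hT hf.meanField (bundle Θ) x
  have hv : Continuous fun r : ℝ => meanField f (q (toI r)) (bundle Θ (toI r)) :=
    (hf.meanField.continuous_comp q.continuous (bundle Θ)).comp continuous_toI
  have hz : ∀ t ∈ Set.Icc (0 : ℝ) 1,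
      q (toI t) = x + ∫ r in (0 : ℝ)..t, meanField f (q (toI r)) (bundle Θ (toI r)) := by
    intro t ht
    rw [hst (toI t), integral_Iio_unitInterval fun r => meanField f (q r) (bundle Θ r),
      coe_toI ht.1 ht.2]
  refine ⟨fun t => x + ∫ r in (0 : ℝ)..t, meanField f (q (toI r)) (bundle Θ (toI r)), by simp,
    fun t ht => ?_⟩
  dsimp only
  rw [← hz t ht, ← meanField_bundle]
  exact ((intervalIntegral.integral_hasDerivAt_right (hv.intervalIntegrable _ _)
    (hv.stronglyMeasurableAtFilter _ _) hv.continuousAt).const_add x).hasDerivWithinAt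

/-- The chosen ODE solution, restricted to `[0,1]`, satisfies the Volterra equation by the
fundamental theorem of calculus, so `eq_state` identifies it with `state`. -/
theorem flowZ_one (hf : Activation f A D C) (Θ : Fin M → ParamPath k) (x : Euc d) :
    flowZ f Θ x 1 = finalState volume (meanField f) (bundle Θ) x := by
  have hT := isTimeScale_unitInterval (E := Euc d)
  obtain ⟨h0, hz⟩ : IsResNetODE f Θ x (flowZ f Θ x) :=
    Classical.epsilon_spec (exists_isResNetODE hf Θ x)
  set z := flowZ f Θ x
  have hc : ContinuousOn z (Set.Icc 0 1) := fun t ht => (hz t ht).continuousWithinAt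
  set q : C(I, Euc d) := ⟨fun t => z t, hc.comp_continuous continuous_subtype_val fun t => t.2⟩
    with hq
  have hint : ∀ t : I, z t = x + ∫ r in (0 : ℝ)..t, meanField f (q (toI r)) (bundle Θ (toI r)) := by
    intro t
    have hv : Continuous fun r : ℝ => meanField f (q (toI r)) (bundle Θ (toI r)) :=
      (hf.meanField.continuous_comp q.continuous (bundle Θ)).comp continuous_toI
    rw [intervalIntegral.integral_eq_sub_of_hasDerivAt_of_le t.2.1
      (hc.mono (Set.Icc_subset_Icc_right t.2.2)) (fun r hr => ?_) (hv.intervalIntegrable _ _), h0]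
    · abel
    · have hr' : r ∈ Set.Icc (0 : ℝ) 1 := ⟨hr.1.le, hr.2.le.trans t.2.2⟩
      rw [meanField_bundle]
      have : q (toI r) = z r := congrArg z (coe_toI hr'.1 hr'.2)
      rw [this]
      exact (hz r hr').hasDerivAt (Icc_mem_nhds hr.1 (hr.2.trans_le t.2.2))
  have hst : IsState volume (meanField f) (bundle Θ) x q := fun t => by
    rw [integral_Iio_unitInterval fun r => meanField f (q r) (bundle Θ r)]
    exact hint t
  have h1 := hint 1
  rw [finalState, ← eq_state hT hf.meanField hst,
    integral_unitInterval fun r => meanField f (q r) (bundle Θ r)]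
  simpa using h1

theorem continuousLoss_eq (hf : Activation f A D C) (g y : Euc d → ℝ) (μ : Measure (Euc d))
    (Θ : Fin M → ParamPath k) : continuousLoss f g y μ Θ
      = loss volume (meanField f) (fun x z => 1 / 2 * (g z - y x) ^ 2) μ (bundle Θ) := by
  simp only [continuousLoss, loss, flowZ_one hf]

theorem layer_eq_finalState {L : ℕ} [NeZero L] (hf : Activation f A D C)
    (Θ : Fin L → Fin M → Euc k) (x : Euc d) :
    layer f Θ x L = finalState (gridMeasure L) (meanField f) (bundle (gridPaths Θ)) x := by
  have hT := isTimeScale_gridMeasure (E := Euc d) L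
  -- Extended by `0` beyond depth `L`, as in `layer`, so that the summation formula holds for every
  -- natural number and ordinary induction applies.
  set ψ : ℕ → Euc d := fun j =>
    if h : j < L then meanField f (layer f Θ x j) (bundle (gridPaths Θ) ⟨j, h⟩) else 0 with hψ
  have hlayer : ∀ l, layer f Θ x l = x + (L : ℝ)⁻¹ • ∑ j ∈ Finset.range l, ψ j := by
    intro l
    induction l with
    | zero => simp [layer]
    | succ l ih =>
      rw [layer, Finset.sum_range_succ, smul_add, ← add_assoc, ← ih]
      congr 1
      simp only [hψ]
      split_ifs with h
      · rw [meanField_bundle, smul_smul, mul_inv, mul_comm]; rfl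
      · rw [smul_zero]
  have hψ' : ∀ j : Fin L, ψ j = meanField f (layer f Θ x j) (bundle (gridPaths Θ) j) := fun j => by
    simp [hψ]
  set q : C(Fin L, Euc d) := ⟨fun l => layer f Θ x l, continuous_of_discreteTopology⟩ with hq
  have hst : IsState (gridMeasure L) (meanField f) (bundle (gridPaths Θ)) x q := fun t => by
    have := integral_Iio_gridMeasure ψ t
    simp only [hψ'] at this
    rw [hq]
    simp only [ContinuousMap.coe_mk]
    rw [this]
    exact hlayer t
  have := integral_gridMeasure_nat (L := L) ψ
  simp only [hψ'] at this
  rw [finalState, ← eq_state hT hf.meanField hst, hlayer, ← this]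
  rfl

theorem discreteLoss_eq {L : ℕ} [NeZero L] (hf : Activation f A D C) (g y : Euc d → ℝ)
    (μ : Measure (Euc d)) (Θ : Fin L → Fin M → Euc k) : discreteLoss f g y μ Θ
      = loss (gridMeasure L) (meanField f) (fun x z => 1 / 2 * (g z - y x) ^ 2) μ
        (bundle (gridPaths Θ)) := by
  simp only [discreteLoss, loss, layer_eq_finalState hf]

variable {g y : Euc d → ℝ} {μ : Measure (Euc d)} [IsProbabilityMeasure μ]
  {b : Euc d → Euc d → Euc d} {R : ℝ}

/-- The functional derivative is the rescaled component of the gradient. -/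
theorem IsFunctionalDeriv.eq (hf : Activation f A D C)
    (hℓ : IsLoss (fun x z => 1 / 2 * (g z - y x) ^ 2) b R C) (hμ : ∀ᵐ x ∂μ, ‖x‖ ≤ R)
    {Θ : Fin M → ParamPath k} {m : Fin M} {G : ParamPath k}
    (hG : IsFunctionalDeriv (continuousLoss f g y μ) Θ m G) (t : I) :
    G t = (√(M : ℝ))⁻¹ • grad volume (meanField f) (meanFieldA A) (meanFieldD D) b μ (bundle Θ) t m
      := by
  have hT := isTimeScale_unitInterval (E := Euc d)
  set Γ := grad volume (meanField f) (meanFieldA A) (meanFieldD D) b μ (bundle Θ) with hΓ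
  set H : ParamPath k := ⟨fun t => (√(M : ℝ))⁻¹ • Γ t m, by fun_prop⟩ with hH
  have key : ∀ h : ParamPath k, ∫ t : I, inner ℝ (G t) (h t) = ∫ t : I, inner ℝ (H t) (h t) := by
    intro h
    refine (hG h).unique ?_
    have h2 := hasDerivAt_loss_add_smul hT hf.meanField hℓ hμ (bundle Θ) (bundle (Pi.single m h))
    rw [← hΓ] at h2
    simp only [inner_bundle_single] at h2
    refine h2.congr_of_eventuallyEq (Eventually.of_forall fun ε => ?_)
    dsimp only
    rw [continuousLoss_eq hf, bundle_update_add, bundle_single_smul]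
  have hint : ∀ u v : ParamPath k, Integrable (fun t : I => (inner ℝ (u t) (v t) : ℝ)) :=
    fun u v => integrable_of_continuous (by fun_prop)
  -- Test `key` with `h = G - H`; continuity then turns a vanishing integral into pointwise
  -- equality.
  have h0 : ∫ t : I, ‖(G - H) t‖ ^ 2 = 0 := by
    simp only [← real_inner_self_eq_norm_sq]
    conv_lhs =>
      enter [2, t]
      rw [ContinuousMap.sub_apply, inner_sub_left, ← ContinuousMap.sub_apply]
    rw [integral_sub (hint _ _) (hint _ _), key, sub_self]
  have hcont : Continuous fun t : I => ‖(G - H) t‖ ^ 2 := by fun_prop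
  have h3 : ‖(G - H) t‖ ^ 2 = 0 :=
    eq_zero_of_integral_unitInterval hcont (fun t => by positivity) h0 t
  have h4 : (G - H) t = 0 := by simpa using h3
  rw [ContinuousMap.sub_apply, sub_eq_zero] at h4
  exact h4

theorem IsContinuousFlow.isFlow (hf : Activation f A D C)
    (hℓ : IsLoss (fun x z => 1 / 2 * (g z - y x) ^ 2) b R C) (hμ : ∀ᵐ x ∂μ, ‖x‖ ≤ R)
    {Θ₀ : Fin M → ParamPath k} {Θ : ℝ → Fin M → ParamPath k}
    (h : IsContinuousFlow f g y μ Θ₀ Θ) :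
    IsFlow (grad volume (meanField f) (meanFieldA A) (meanFieldD D) b μ) fun s => bundle (Θ s) := by
  refine isFlow_bundle h.1 fun s hs m t => ?_
  obtain ⟨G, hG, hd⟩ := h.2.2 s hs m
  rw [← hG.eq hf hℓ hμ]
  exact hd t

/-- Moving one `θ_{l,m}` perturbs the path by `gridBump`, whose pairing with the gradient carries
the mass `1/L` of the layer and the scaling `1/√M` of the bundle. The prefactor `ML` of the discrete
flow removes the `1/L`. -/
theorem partialGrad_discreteLoss {L : ℕ} [NeZero L] (hf : Activation f A D C)
    (hℓ : IsLoss (fun x z => 1 / 2 * (g z - y x) ^ 2) b R C) (hμ : ∀ᵐ x ∂μ, ‖x‖ ≤ R)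
    (Θ : Fin L → Fin M → Euc k) (l : Fin L) (m : Fin M) :
    partialGrad (discreteLoss f g y μ) Θ l m = (L : ℝ)⁻¹ • (√(M : ℝ))⁻¹ •
      grad (gridMeasure L) (meanField f) (meanFieldA A) (meanFieldD D) b μ
        (bundle (gridPaths Θ)) l m := by
  have hT := isTimeScale_gridMeasure (E := Euc d) L
  set Γ := grad (gridMeasure L) (meanField f) (meanFieldA A) (meanFieldD D) b μ
    (bundle (gridPaths Θ)) with hΓ
  have h2 := hasFDerivAt_loss_add_comp hT hf.meanField hℓ hμ (bundle (gridPaths Θ))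
    (gridBump l m) (Θ l m)
  rw [← hΓ] at h2
  rw [partialGrad]
  refine HasGradientAt.gradient ?_
  rw [hasGradientAt_iff_hasFDerivAt]
  refine (h2.congr_fderiv ?_).congr_of_eventuallyEq (Eventually.of_forall fun v => ?_)
  · ext v
    rw [ContinuousLinearMap.comp_apply, pairing_apply, integral_gridMeasure,
      InnerProductSpace.toDual_apply_apply, real_inner_smul_left, sum_inner_gridBump, smul_eq_mul]
  · dsimp only
    rw [discreteLoss_eq hf, bundle_gridPaths_update]

theorem IsDiscreteFlow.isFlow {L : ℕ} [NeZero L] (hf : Activation f A D C)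
    (hℓ : IsLoss (fun x z => 1 / 2 * (g z - y x) ^ 2) b R C) (hμ : ∀ᵐ x ∂μ, ‖x‖ ≤ R)
    {Θ₀ : Fin L → Fin M → Euc k} {Θ : ℝ → Fin L → Fin M → Euc k}
    (h : IsDiscreteFlow f g y μ Θ₀ Θ) :
    IsFlow (grad (gridMeasure L) (meanField f) (meanFieldA A) (meanFieldD D) b μ)
      fun s => bundle (gridPaths (Θ s)) := by
  have hL : (L : ℝ) ≠ 0 := by exact_mod_cast NeZero.ne L
  refine isFlow_bundle (Θ := fun s => gridPaths (Θ s)) ?_ fun s hs m l => ?_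
  · have : Continuous (gridPaths : (Fin L → Fin M → Euc k) → Fin M → C(Fin L, Euc k)) := by
      refine continuous_pi fun m => ContinuousMap.continuous_of_continuous_uncurry _ ?_
      rw [continuous_prod_of_discrete_right]
      intro l
      change Continuous fun Θ : Fin L → Fin M → Euc k => Θ l m
      fun_prop
    exact this.comp_continuousOn h.1
  · have h1 := h.2.2 s hs l m
    rw [partialGrad_discreteLoss hf hℓ hμ, smul_smul, mul_inv_cancel_right₀ hL] at h1
    exact h1

end Networks

/-! ### The random initialization -/

section Random

variable {d k M L : ℕ}

theorem StandingAssumption.exists_activation_isLoss {f : Euc d → Euc k → Euc d} {g y : Euc d → ℝ}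
    {μ : Measure (Euc d)} (hA : StandingAssumption f g y μ) :
    ∃ (A : Euc d → Euc k → Euc d →L[ℝ] Euc d) (D : Euc d → Euc k → Euc k →L[ℝ] Euc d)
      (b : Euc d → Euc d → Euc d) (R C : ℝ), Activation f A D C ∧
      IsLoss (fun x z => 1 / 2 * (g z - y x) ^ 2) b R C ∧ ∀ᵐ x ∂μ, ‖x‖ ≤ R := by
  obtain ⟨C₁, hC₁⟩ := hA.deriv_bound
  obtain ⟨R, hR, hμ⟩ := hA.compact_support
  obtain ⟨Y, hY⟩ := hA.bounded_y R
  obtain ⟨K₁, hK₁⟩ := hA.lipschitz_g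
  obtain ⟨K₂, hK₂⟩ := hA.lipschitz_grad_g
  obtain ⟨C, hf⟩ := exists_activation hA.contDiff_f hC₁
  obtain ⟨C', hℓ⟩ := exists_isLoss (hA.contDiff_g.differentiable two_ne_zero)
    hA.contDiff_y.continuous hK₁ hK₂ hR.le fun x hx =>
      hY ⟨x, by simpa using hx, rfl⟩
  refine ⟨_, _, _, R, max C C', hf.mono (le_max_left _ _), hℓ.mono (le_max_right _ _), ?_⟩
  filter_upwards [measure_eq_zero_iff_ae_notMem.1 hμ] with x hx
  exact (not_le.1 hx).le

/-- The lists of paths with bounded second moments. -/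
def momentSet (M k : ℕ) (C₄ : ℝ) : Set (Fin M → ParamPath k) :=
  {Θ | ∀ t : I, (M : ℝ)⁻¹ * ∑ m, ‖Θ m t‖ ^ 2 ≤ C₄}

/-- The lists of paths with small discretization error at depth `L`. -/
def discretizationSet (L M k : ℕ) (C₄ : ℝ) : Set (Fin M → ParamPath k) :=
  {Θ | (M : ℝ)⁻¹ * ∑ l : Fin L, ∑ m,
          ∫ t in ((l : ℕ) / L : ℝ)..(((l : ℕ) + 1) / L : ℝ),
            ‖Θ m (toI t) - Θ m (toI ((l : ℕ) / L))‖ ^ 2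
        ≤ C₄ / (L : ℝ) ^ 2}

/-- Closedness of this event and of the next serves to make them measurable, so that their
probabilities can be combined and transported to `Ω`. -/
theorem isClosed_momentSet (C₄ : ℝ) : IsClosed (momentSet M k C₄) := by
  rw [momentSet, Set.ofPred_forall]
  exact isClosed_iInter fun t => isClosed_le (by fun_prop) continuous_const

theorem isClosed_discretizationSet (C₄ : ℝ) : IsClosed (discretizationSet L M k C₄) := by
  refine isClosed_le (continuous_const.mul (continuous_finsetSum _ fun l _ =>
    continuous_finsetSum _ fun m _ => ?_)) continuous_const
  refine intervalIntegral.continuous_parametric_intervalIntegral_of_continuous' ?_ _ _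
  have h1 : Continuous fun p : (Fin M → ParamPath k) × ℝ => p.1 m (toI p.2) := by
    have := continuous_toI
    fun_prop
  have h2 : Continuous fun p : (Fin M → ParamPath k) × ℝ => p.1 m (toI ((l : ℕ) / L)) := by
    fun_prop
  exact (h1.sub h2).norm.pow 2

theorem norm_bundle_le [NeZero M] {C₄ : ℝ} {Θ : Fin M → ParamPath k} (h : Θ ∈ momentSet M k C₄)
    (t : I) : ‖bundle Θ t‖ ≤ √(max C₄ 0) := by
  refine Real.le_sqrt_of_sq_le ?_
  rw [norm_bundle_sq]
  exact (h t).trans (le_max_left _ _)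

theorem cellSum_bundle [NeZero M] (L : ℕ) (Θ : Fin M → ParamPath k) :
    cellSum L (fun t r => ‖bundle Θ t - bundle Θ r‖ ^ 2)
      = (M : ℝ)⁻¹ * ∑ l : Fin L, ∑ m, ∫ t in ((l : ℕ) / L : ℝ)..(((l : ℕ) + 1) / L : ℝ),
            ‖Θ m (toI t) - Θ m (toI ((l : ℕ) / L))‖ ^ 2 := by
  rw [cellSum, Fin.sum_univ_eq_sum_range fun l => ∑ m, ∫ t in (l / L : ℝ)..((l + 1) / L : ℝ),
    ‖Θ m (toI t) - Θ m (toI (l / L))‖ ^ 2, Finset.mul_sum]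
  refine Finset.sum_congr rfl fun l _ => ?_
  simp only [norm_bundle_sub_sq]
  rw [intervalIntegral.integral_const_mul, intervalIntegral.integral_finsetSum]
  · simp only [gridPoint, Nat.cast_add, Nat.cast_one]
  · intro m _
    have h1 : Continuous fun t : ℝ => Θ m (toI t) := (Θ m).continuous.comp continuous_toI
    exact ((h1.sub continuous_const).norm.pow 2).intervalIntegrable _ _

theorem le_measureReal_inter {Ω : Type*} [MeasurableSpace Ω] {P : Measure Ω}
    [IsProbabilityMeasure P] {s t : Set Ω} (ht : MeasurableSet t) {a b : ℝ}
    (hs : 1 - a ≤ P.real s) (hb : 1 - b ≤ P.real t) : 1 - (a + b) ≤ P.real (s ∩ t) := by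
  have h1 := measureReal_union_add_inter (μ := P) (s := s) ht
  have h2 : P.real (s ∪ t) ≤ 1 := measureReal_le_one
  linarith

/-- Independent initial paths satisfy both admissibility bounds with high probability. -/
theorem IsLimitAdmissible.le_measureReal {ρ : I → Measure (Euc k)} {C₃ C₄ : ℝ}
    {Q : Measure (ParamPath k)} (hQ : IsLimitAdmissible ρ C₃ C₄ Q) {η : ℝ} (hη : 0 < η)
    (hM : C₃ / (η / 2) < M) (hL : 0 < L) {Ω : Type*} [MeasurableSpace Ω] {P : Measure Ω}
    [IsProbabilityMeasure P] {θ₀ : Fin M → Ω → ParamPath k} (hm : ∀ m, Measurable (θ₀ m))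
    (hind : iIndepFun θ₀ P) (hlaw : ∀ m, P.map (θ₀ m) = Q) :
    1 - η ≤ P.real {ω | (fun m => θ₀ m ω) ∈ momentSet M k C₄ ∩ discretizationSet L M k C₄} := by
  have hX : Measurable fun ω m => θ₀ m ω := measurable_pi_lambda _ hm
  have hmap : P.map (fun ω m => θ₀ m ω) = Measure.pi fun _ : Fin M => Q := by
    rw [(iIndepFun_iff_map_fun_eq_pi_map fun m => (hm m).aemeasurable).1 hind]
    simp only [hlaw]
  -- Half of the allowed failure probability goes to each event, which is why `M` must exceed `2 C₃
  -- / η`.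
  have h1 := hQ.second_moment (η / 2) M (by positivity) hM
  have h2 := hQ.discretization (η / 2) M (by positivity) hM L hL
  have m1 := (isClosed_momentSet (M := M) (k := k) C₄).measurableSet
  have m2 := (isClosed_discretizationSet (L := L) (M := M) (k := k) C₄).measurableSet
  have : IsProbabilityMeasure (P.map fun ω m => θ₀ m ω) :=
    Measure.isProbabilityMeasure_map hX.aemeasurable
  rw [← hmap] at h1 h2
  have h3 := le_measureReal_inter (s := momentSet M k C₄) m2 h1 h2
  rw [add_halves, map_measureReal_apply hX (m1.inter m2)] at h3
  exact h3

end Random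

end

end DeepResNet

/-! ### Choice of the constant and conclusion on the good event. -/

theorem mainTheorem8 {d k : ℕ}
    (f : DeepResNet.Euc d → DeepResNet.Euc k → DeepResNet.Euc d)
    (g y : DeepResNet.Euc d → ℝ) (μ : Measure (DeepResNet.Euc d))
    (hA : DeepResNet.StandingAssumption f g y μ)
    (ρini : unitInterval → Measure (DeepResNet.Euc k)) (C₃ C₄ : ℝ)
    (S : ℝ) (hS : 0 < S) :
    ∃ C : ℝ, 0 < C ∧
      ∀ Q : Measure (DeepResNet.ParamPath k), DeepResNet.IsLimitAdmissible ρini C₃ C₄ Q →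
      ∀ ε η : ℝ, 0 < ε → 0 < η →
      ∀ M L : ℕ, C / η ≤ M → C / ε ≤ L →
      ∀ (Ω : Type*) [MeasurableSpace Ω] (P : Measure Ω) [IsProbabilityMeasure P]
        (θ₀ : Fin M → Ω → DeepResNet.ParamPath k),
        (∀ m, Measurable (θ₀ m)) → iIndepFun θ₀ P → (∀ m, P.map (θ₀ m) = Q) →
      ∀ (Θ : Ω → ℝ → Fin M → DeepResNet.ParamPath k)
        (ΘL : Ω → ℝ → Fin L → Fin M → DeepResNet.Euc k),
        (∀ᵐ ω ∂P, DeepResNet.IsContinuousFlow f g y μ (fun m => θ₀ m ω) (Θ ω)) →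
        (∀ᵐ ω ∂P, DeepResNet.IsDiscreteFlow f g y μ
          (fun l m => θ₀ m ω (DeepResNet.toI ((l : ℕ) / L))) (ΘL ω)) →
      ∀ s : ℝ, 0 ≤ s → s < S →
        1 - η ≤ P.real {ω | |DeepResNet.continuousLoss f g y μ (Θ ω s)
          - DeepResNet.discreteLoss f g y μ (ΘL ω s)| ≤ ε} := by
  have := hA.isProbabilityMeasure
  obtain ⟨A, D, b, R, C, hf, hℓ, hμ⟩ := hA.exists_activation_isLoss
  -- The constant `c` is obtained before `Q`, `M` and `L` appear; `M` enters only through the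
  -- parameter space `Population M`, which `hcomp` leaves arbitrary. The maximum with `0` gives the
  -- nonnegative bounds required there whatever the sign of `C₄`.
  obtain ⟨c, hc, hcomp⟩ := DeepResNet.exists_flow_comparison (S := S) hf.one_le hℓ hμ
    (Real.sqrt_nonneg (max C₄ 0)) (le_max_right C₄ 0)
  -- `1` forces `M` and `L` to be nonzero, `c` makes the error `c / L` at most `ε`, and `2 C₃ + 1`
  -- gives the strict inequality `M > C₃ / (η / 2)`.
  refine ⟨max 1 (max c (2 * C₃ + 1)), lt_of_lt_of_le one_pos (le_max_left _ _), ?_⟩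
  set K := max 1 (max c (2 * C₃ + 1)) with hK
  have hK1 : 0 < K := lt_of_lt_of_le one_pos (le_max_left _ _)
  have hKc : c ≤ K := (le_max_left _ _).trans (le_max_right _ _)
  have hKC₃ : 2 * C₃ + 1 ≤ K := (le_max_right _ _).trans (le_max_right _ _)
  intro Q hQ ε η hε hη M L hM hL Ω _ P _ θ₀ hmeas hind hlaw Θ ΘL hΘ hΘL s hs hsS
  have hM0 : (0 : ℝ) < M := (div_pos hK1 hη).trans_le hM
  have hL0 : (0 : ℝ) < L := (div_pos hK1 hε).trans_le hL
  have : NeZero M := ⟨by rintro rfl; simp at hM0⟩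
  have : NeZero L := ⟨by rintro rfl; simp at hL0⟩
  have hM' : C₃ / (η / 2) < M := by
    refine lt_of_lt_of_le ?_ hM
    rw [div_lt_div_iff₀ (by positivity) hη]
    nlinarith
  have hcL : c * (1 / L) ≤ ε := by
    rw [div_le_iff₀ hε] at hL
    rw [mul_one_div, div_le_iff₀ hL0]
    linarith
  -- The good event is contained, up to a null set, in the event of the conclusion; monotonicity of
  -- the measure needs no measurability of the latter.
  refine (hQ.le_measureReal hη hM' (by exact_mod_cast hL0) hmeas hind hlaw).trans
    (ENNReal.toReal_mono (measure_ne_top _ _) (measure_mono_ae ?_))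
  filter_upwards [hΘ, hΘL] with ω hω hωL hev
  have hflow := hω.isFlow hf hℓ hμ
  have hflowL := hωL.isFlow hf hℓ hμ
  have hΘ0 : Θ ω 0 = fun m => θ₀ m ω := hω.2.1
  have hbound := hcomp hf.meanField L _ _ hflow hflowL
    (fun l => by rw [hωL.2.1, hΘ0]; rfl)
    (fun t => by rw [hΘ0]; exact DeepResNet.norm_bundle_le hev.1 t)
    (by
      rw [hΘ0, DeepResNet.cellSum_bundle]
      exact hev.2.trans (by gcongr; exact le_max_left _ _)) s hs hsS
  rw [← DeepResNet.continuousLoss_eq hf, ← DeepResNet.discreteLoss_eq hf] at hbound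
  exact hbound.trans hcL
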